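/- **Theorem.** Let $(M_i,g_i)$, $1\le i\le N$, be simply connected Riemannian spin manifolds (smooth, without boundary) of dimension $D_i$, each with a spin structure, and let $S_i$ be the spinor bundle of $M_i$, i.e. the complex vector bundle associated to the principal $Spin(D_i)$-bundle by an irreducible complex module $V_i$ of the Clifford algebra of $\mathbb R^{D_i}$ (with $v\cdot v=-|v|^2$). Let $M=M_1\times\cdots\times M_N$, so that $TM=\bigoplus_i TM_i$ (pullbacks along the projections being omitted), and let $g$ be a Riemannian metric on $M$ of the form $$g_x(X,Y)=\sum_{i=1}^N g_i\big(A_i(x)X_i,A_i(x)Y_i\big),\qquad X=\sum_i X_i,\ Y=\sum_i Y_i,\quad X_i,Y_i\in T_{x_i}M_i,$$ where $A_i(x)$ is an endomorphism of $T_{x_i}M_i$ depending smoothly on $x\in M$. If $D_i$ is even, let $S_i^{\pm}\subset S_i$ be the $\pm1$-eigenbundles of the complex volume element $\mathrm i^{D_i/2}e_1\cdots e_{D_i}$, so $S_i=S_i^+\oplus S_i^-$. If $D_i$ is odd, let $S_i^+$ and $S_i^-$ be two copies of $S_i$ and let $\Delta(S_i^+\oplus S_i^-)=\{(\xi,\xi)\}$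 be the diagonal. Put $W=\bigotimes_{i=1}^N(S_i^+\oplus S_i^-)$, a bundle over $M$, with the multiplication by $X\in TM$ given on $\Xi=\xi_1\otimes\cdots\otimes\xi_N$, $\xi_i\in S_i^{\epsilon_i}$, by $$X\cdot\Xi=\sum_{i=1}^N(-1)^{\epsilon_1+\cdots+\epsilon_{i-1}}\,\xi_1\otimes\cdots\otimes (A_iX_i)\xi_i\otimes\cdots\otimes\xi_N ,$$ where a vector of $TM_i$ acts on $S_i^+\oplus S_i^-$ by $(\xi^+,\xi^-)\mapsto(X_i\xi^-,X_i\xi^+)$. Let $N_o$ be the number of odd $D_i$, choose a set $K$ of $N_o-[N_o/2]$ indices $i$ with $D_i$ odd, and let $S\subset W$ be the subbundle $$S=\bigotimes_{i\notin K}(S_i^+\oplus S_i^-)\otimes\bigotimes_{k\in K}\Delta(S_k^+\oplus S_k^-)$$ (the tensor factors being kept in their order $1,\dots,N$). Then $(M,g)$ is spin, and for every spin structure on $(M,g)$ the spinor bundle of $M$ (associated by any irreducible complex module of the Clifford algebra of $\mathbb R^{D}$, $D=\sum_i D_i$) is isomorphic to $S$ as a smooth complex vector bundle. The isomorphism $\Phi$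 can be chosen compatible with the reduction of the structure group to $Spin(D_1)\times\cdots\times Spin(D_N)$, in the sense that $\Phi(X\cdot Y\cdot\psi)=X\cdot Y\cdot\Phi(\psi)$ whenever $X,Y\in TM_i$ for the same $i$, the products on the right being taken in $W$. -/

import Mathlib

open scoped Manifold ContDiff Bundle Topology TensorProduct
open Bundle

universe u v w

noncomputable section

/-! ### The product of finitely many manifolds -/

/-- A finite product of manifolds without boundary is a manifold (for the product charts). -/
instance piIsManifold {ι : Type*} [Fintype ι] {E : ι → Type*} [∀ i, NormedAddCommGroup (E i)]
    [∀ i, NormedSpace ℝ (E i)] (n : ℕ∞ω) (M : ι → Type*)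
    [∀ i, TopologicalSpace (M i)] [∀ i, ChartedSpace (E i) (M i)]
    [∀ i, IsManifold (𝓘(ℝ, E i)) n (M i)] :
    IsManifold (ModelWithCorners.pi fun i => 𝓘(ℝ, E i)) n (∀ i, M i) := by
  apply isManifold_of_contDiffOn
  rintro _ _ ⟨e, he, rfl⟩ ⟨e', he', rfl⟩
  rw [contDiffOn_pi]
  intro i
  have h := ((contDiffGroupoid n 𝓘(ℝ, E i)).compatible (he i trivial) (he' i trivial)).1
  refine ContDiffOn.comp (g := fun y : E i => ((e i).symm ≫ₕ e' i) y)
    (f := fun f : (∀ i, E i) => f i) h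
    (ContinuousLinearMap.proj (R := ℝ) (φ := E) i).contDiff.contDiffOn ?_
  rintro x ⟨hx, -⟩
  refine ⟨?_, ⟨x i, rfl⟩⟩
  have hx' : x ∈ ((OpenPartialHomeomorph.pi e).symm ≫ₕ OpenPartialHomeomorph.pi e').source := hx
  rw [OpenPartialHomeomorph.trans_source] at hx'
  change x i ∈ ((e i).symm ≫ₕ e' i).source
  rw [OpenPartialHomeomorph.trans_source]
  exact ⟨hx'.1 i trivial, hx'.2 i trivial⟩

/-- The model of the product manifold `∏ i, M i` with `dim (M i) = D i`. -/
abbrev prodModel {N : ℕ} (D : Fin N → ℕ) :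
    ModelWithCorners ℝ (∀ i, EuclideanSpace ℝ (Fin (D i)))
      (ModelPi fun i => EuclideanSpace ℝ (Fin (D i))) :=
  ModelWithCorners.pi fun i => 𝓡 (D i)

/-- A smooth Riemannian metric on a manifold. -/
abbrev SmoothMetric {E : Type*} [NormedAddCommGroup E] [NormedSpace ℝ E] {H : Type*}
    [TopologicalSpace H] (I : ModelWithCorners ℝ E H) (M : Type*) [TopologicalSpace M]
    [ChartedSpace H M] [IsManifold I ∞ M] :=
  ContMDiffRiemannianMetric I ∞ E (fun x : M => TangentSpace I x)

/-! ### Clifford algebra, spin group, spinor modules -/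

/-- The form `-(x₁² + ⋯ + xₙ²)` on `ℝⁿ`. -/
def negEuclid (n : ℕ) : QuadraticForm ℝ (Fin n → ℝ) :=
  QuadraticMap.weightedSumSquares ℝ fun _ : Fin n => (-1 : ℝ)

/-- The Clifford algebra of Euclidean `ℝⁿ`, with the convention `v * v = -|v|²`. -/
abbrev Cl (n : ℕ) : Type := CliffordAlgebra (negEuclid n)

/-- `Spin(n)`, inside the Clifford algebra. -/
abbrev Spin (n : ℕ) : Submonoid (Cl n) := spinGroup (negEuclid n)

/-- Euclidean vectors as elements of the Clifford algebra. -/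
abbrev clVec {n : ℕ} (v : Fin n → ℝ) : Cl n := CliffordAlgebra.ι (negEuclid n) v

/-- The standard basis vector `e a` as an element of the Clifford algebra. -/
abbrev clE {n : ℕ} (a : Fin n) : Cl n := clVec (Pi.single a 1)

/-- Complex modules over the Clifford algebra. -/
abbrev ClRep (n : ℕ) (V : Type v) [NormedAddCommGroup V] [NormedSpace ℂ V] :=
  Cl n →ₐ[ℝ] Module.End ℂ V

/-- A complex module over the Clifford algebra is a *spinor module* if it is irreducible:
it is nonzero and has no invariant complex subspaces besides `0` and itself. -/
def ClRep.IsSpinorModule {n : ℕ} {V : Type v} [NormedAddCommGroup V] [NormedSpace ℂ V]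
    (ρ : ClRep n V) : Prop :=
  Nontrivial V ∧
    ∀ U : Submodule ℂ V, (∀ a : Cl n, ∀ ξ ∈ U, ρ a ξ ∈ U) → U = ⊥ ∨ U = ⊤

/-! ### Spin structures -/

section SpinStructure

variable {E : Type*} [NormedAddCommGroup E] [NormedSpace ℝ E] {H : Type*}
  [TopologicalSpace H] (I : ModelWithCorners ℝ E H) {M : Type u} [TopologicalSpace M]
  [ChartedSpace H M] [IsManifold I ∞ M]

/-- A spin structure on the Riemannian manifold `(M, g)` of dimension `n`, given through local
sections and transition functions: a covering of `M` by open sets `baseSet α`, with smooth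
`g`-orthonormal frames `frame α` on them, and smooth maps `lift α β` from the overlaps into
`Spin(n)`, which satisfy the cocycle condition (so they define a principal `Spin(n)`-bundle)
and which are mapped by the two-fold covering `Spin(n) → SO(n)`, `s ↦ (v ↦ s v s⁻¹)`, to the
transition functions of the frames (so that this principal bundle doubly covers the bundle of
oriented orthonormal frames, for the orientation given by the frames). A function into the finite
dimensional space `Cl n` is smooth if its composites with all linear functionals are. -/
structure SpinStructure (g : SmoothMetric I M) (n : ℕ) where
  Index : Type u
  baseSet : Index → Set M
  isOpen_baseSet : ∀ α, IsOpen (baseSet α)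
  indexAt : M → Index
  mem_baseSet_at : ∀ x, x ∈ baseSet (indexAt x)
  frame : Index → Fin n → (x : M) → TangentSpace I x
  isLocalFrameOn : ∀ α, IsLocalFrameOn I E ∞ (frame α) (baseSet α)
  orthonormal : ∀ α, ∀ x ∈ baseSet α, ∀ a b,
    g.inner x (frame α a x) (frame α b x) = if a = b then 1 else 0
  lift : Index → Index → M → Spin n
  lift_smooth : ∀ α β, ∀ φ : Cl n →ₗ[ℝ] ℝ,
    ContMDiffOn I 𝓘(ℝ, ℝ) ∞ (fun x => φ (lift α β x)) (baseSet α ∩ baseSet β)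
  lift_cocycle : ∀ α β γ, ∀ x ∈ baseSet α ∩ baseSet β ∩ baseSet γ,
    lift α β x * lift β γ x = lift α γ x
  lift_covers : ∀ α β, ∀ x ∈ baseSet α ∩ baseSet β, ∀ b,
    (lift α β x : Cl n) * clE b * ((lift α β x)⁻¹ : Spin n) =
      ∑ a, g.inner x (frame α a x) (frame β b x) • clE a

namespace SpinStructure

variable {I} {g : SmoothMetric I M} {n : ℕ} (σ : SpinStructure I g n)
  {V : Type v} [NormedAddCommGroup V] [NormedSpace ℂ V] [FiniteDimensional ℂ V] (ρ : ClRep n V)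

theorem lift_self (α : σ.Index) (x : M) (hx : x ∈ σ.baseSet α) : σ.lift α α x = 1 :=
  mul_eq_left.1 (σ.lift_cocycle α α α x ⟨⟨hx, hx⟩, hx⟩)

theorem continuousOn_rep (α β : σ.Index) :
    ContinuousOn (fun x => LinearMap.toContinuousLinearMap (ρ (σ.lift α β x : Cl n)))
      (σ.baseSet α ∩ σ.baseSet β) := by
  have : FiniteDimensional ℝ (V →L[ℂ] V) := FiniteDimensional.complexToReal _
  let b := Module.finBasis ℝ (V →L[ℂ] V)
  let L : Cl n →ₗ[ℝ] (V →L[ℂ] V) :=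
    ((LinearMap.toContinuousLinearMap : (V →ₗ[ℂ] V) ≃ₗ[ℂ] _).toLinearMap.restrictScalars ℝ).comp
      ρ.toLinearMap
  have h : ContinuousOn (fun x => b.equivFun (L (σ.lift α β x : Cl n)))
      (σ.baseSet α ∩ σ.baseSet β) := by
    rw [continuousOn_pi]
    intro j
    exact (σ.lift_smooth α β ((LinearMap.proj j).comp (b.equivFun.toLinearMap.comp L))).continuousOn
  have h' := (LinearMap.continuous_of_finiteDimensional b.equivFun.symm.toLinearMap).comp_continuousOn h
  refine h'.congr fun x _ => ?_
  simp [L]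

/-- The spinor bundle: the vector bundle associated to the principal `Spin(n)`-bundle of the spin
structure by the representation of `Spin(n)` on a Clifford module. The coordinates `ξ_α`, `ξ_β`
of a spinor for the sections number `α` and `β` are related by `ξ_β = ρ (lift β α) ξ_α`. -/
def spinorBundle : VectorBundleCore ℂ M V σ.Index where
  baseSet := σ.baseSet
  isOpen_baseSet := σ.isOpen_baseSet
  indexAt := σ.indexAt
  mem_baseSet_at := σ.mem_baseSet_at
  coordChange α β x := LinearMap.toContinuousLinearMap (ρ (σ.lift β α x : Cl n))
  coordChange_self α x hx ξ := by simp [σ.lift_self α x hx]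
  continuousOn_coordChange α β := by
    rw [Set.inter_comm]
    exact σ.continuousOn_rep ρ β α
  coordChange_comp α β γ x hx ξ := by
    have h := σ.lift_cocycle γ β α x ⟨⟨hx.2, hx.1.2⟩, hx.1.1⟩
    simp [← h]

/-- The coordinates of a tangent vector in the preferred orthonormal frame at `x`. -/
def frameCoord (x : M) (X : TangentSpace I x) : Fin n → ℝ :=
  fun a => g.inner x (σ.frame (σ.indexAt x) a x) X

/-- Clifford multiplication of tangent vectors and spinors. The fibre of the spinor bundle at `x`
is the spinor module itself, through the preferred section at `x`. -/
def cliffordMul (x : M) (X : TangentSpace I x) :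
    (σ.spinorBundle ρ).Fiber x →ₗ[ℂ] (σ.spinorBundle ρ).Fiber x :=
  (ρ (clVec (σ.frameCoord x X)) : V →ₗ[ℂ] V)

end SpinStructure

end SpinStructure

/-! ### Operations on vector bundles given by coordinate changes -/

namespace VectorBundleCore

variable {B : Type*} [TopologicalSpace B] {F F' : Type*} [NormedAddCommGroup F] [NormedSpace ℂ F]
  [NormedAddCommGroup F'] [NormedSpace ℂ F'] {ι : Type*}

/-- The subbundle with standard fibre `U`, for a subspace `U` of the standard fibre that is
invariant under all coordinate changes. -/
def sub (Z : VectorBundleCore ℂ B F ι) (U : Submodule ℂ F)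
    (hU : ∀ i j x, ∀ ξ ∈ U, Z.coordChange i j x ξ ∈ U) : VectorBundleCore ℂ B U ι where
  baseSet := Z.baseSet
  isOpen_baseSet := Z.isOpen_baseSet
  indexAt := Z.indexAt
  mem_baseSet_at := Z.mem_baseSet_at
  coordChange i j x := (Z.coordChange i j x).restrict (hU i j x)
  coordChange_self i x hx ξ := Subtype.ext (Z.coordChange_self i x hx ξ)
  continuousOn_coordChange i j := by
    have hi : Isometry fun f : U →L[ℂ] U => U.subtypeL.comp f :=
      AddMonoidHomClass.isometry_of_norm (ContinuousLinearMap.compL ℂ U U F U.subtypeL)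
        fun f => U.subtypeₗᵢ.norm_toContinuousLinearMap_comp
    rw [hi.isEmbedding.isInducing.continuousOn_iff]
    exact ((ContinuousLinearMap.compL ℂ U F F).flip U.subtypeL).continuous.comp_continuousOn
      (Z.continuousOn_coordChange i j)
  coordChange_comp i j k x hx ξ := Subtype.ext (Z.coordChange_comp i j k x hx ξ)

theorem sub_baseSet (Z : VectorBundleCore ℂ B F ι) (U : Submodule ℂ F)
    (hU : ∀ i j x, ∀ ξ ∈ U, Z.coordChange i j x ξ ∈ U) : (Z.sub U hU).baseSet = Z.baseSet :=
  rfl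

/-- The direct sum of two bundles given over the same covering. -/
def directSum (Z : VectorBundleCore ℂ B F ι) (Z' : VectorBundleCore ℂ B F' ι)
    (h : Z'.baseSet = Z.baseSet) : VectorBundleCore ℂ B (F × F') ι where
  baseSet := Z.baseSet
  isOpen_baseSet := Z.isOpen_baseSet
  indexAt := Z.indexAt
  mem_baseSet_at := Z.mem_baseSet_at
  coordChange i j x := (Z.coordChange i j x).prodMap (Z'.coordChange i j x)
  coordChange_self i x hx ξ :=
    Prod.ext (Z.coordChange_self i x hx ξ.1) (Z'.coordChange_self i x (h ▸ hx) ξ.2)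
  continuousOn_coordChange i j :=
    (Z.continuousOn_coordChange i j).prod_mapL ℂ (h ▸ Z'.continuousOn_coordChange i j)
  coordChange_comp i j k x hx ξ :=
    Prod.ext (Z.coordChange_comp i j k x hx ξ.1) (Z'.coordChange_comp i j k x (h ▸ hx) ξ.2)


end VectorBundleCore

/-- The projective norm on a tensor product of finite dimensional spaces is a norm. -/
theorem piTensor_eq_zero {κ : Type*} [Fintype κ] {F : κ → Type*} [∀ i, NormedAddCommGroup (F i)]
    [∀ i, NormedSpace ℂ (F i)] [∀ i, FiniteDimensional ℂ (F i)] (t : ⨂[ℂ] i, F i)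
    (ht : ‖t‖ = 0) : t = 0 := by
  let b := fun i => Module.finBasis ℂ (F i)
  refine (Basis.piTensorProduct b).ext_elem fun p => ?_
  let f : ContinuousMultilinearMap ℂ F ℂ :=
    (ContinuousMultilinearMap.mkPiAlgebra ℂ κ ℂ).compContinuousLinearMap
      fun i => LinearMap.toContinuousLinearMap ((b i).coord (p i))
  have h1 : PiTensorProduct.lift f.toMultilinearMap t = 0 := by
    have := PiTensorProduct.norm_eval_le_projectiveSeminorm f t
    rw [ht, mul_zero] at this
    exact norm_le_zero_iff.1 this
  have h2 : (Basis.piTensorProduct b).coord p = PiTensorProduct.lift f.toMultilinearMap := by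
    ext x
    simp [f]
  have h3 := LinearMap.congr_fun h2 t
  rw [h1] at h3
  simpa using h3

instance piTensorNormed {κ : Type*} [Fintype κ] {F : κ → Type*} [∀ i, NormedAddCommGroup (F i)]
    [∀ i, NormedSpace ℂ (F i)] [∀ i, FiniteDimensional ℂ (F i)] :
    NormedAddCommGroup (⨂[ℂ] i, F i) :=
  fast_instance% NormedAddCommGroup.ofSeparation piTensor_eq_zero

/-- The tensor product `⨂ i, pᵢ^* Zᵢ` over a finite product `∏ i, B i` of the pullbacks of vector
bundles `Zᵢ` over the factors along the projections `pᵢ`. -/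
def VectorBundleCore.tensor {κ : Type*} [Fintype κ] {B : κ → Type*} [∀ i, TopologicalSpace (B i)]
    {F : κ → Type*} [∀ i, NormedAddCommGroup (F i)] [∀ i, NormedSpace ℂ (F i)]
    [∀ i, FiniteDimensional ℂ (F i)] {ι : κ → Type*}
    (Z : ∀ i, VectorBundleCore ℂ (B i) (F i) (ι i)) :
    VectorBundleCore ℂ (∀ i, B i) (⨂[ℂ] i, F i) (∀ i, ι i) where
  baseSet α := Set.univ.pi fun i => (Z i).baseSet (α i)
  isOpen_baseSet α := isOpen_set_pi Set.finite_univ fun i _ => (Z i).isOpen_baseSet (α i)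
  indexAt x := fun i => (Z i).indexAt (x i)
  mem_baseSet_at x := fun i _ => (Z i).mem_baseSet_at (x i)
  coordChange α β x := PiTensorProduct.mapL fun i => (Z i).coordChange (α i) (β i) (x i)
  coordChange_self α x hx ξ := by
    have h : (fun i => (Z i).coordChange (α i) (α i) (x i)) =
        fun i => ContinuousLinearMap.id ℂ (F i) := by
      funext i
      ext v
      exact (Z i).coordChange_self (α i) (x i) (hx i trivial) v
    rw [h, PiTensorProduct.mapL_id]
    rfl
  continuousOn_coordChange α β := by
    refine (PiTensorProduct.mapLMultilinear ℂ F F).cont.comp_continuousOn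
      (continuousOn_pi.2 fun i => ?_)
    refine ((Z i).continuousOn_coordChange (α i) (β i)).comp (continuous_apply i).continuousOn ?_
    exact fun x hx => ⟨hx.1 i trivial, hx.2 i trivial⟩
  coordChange_comp α β γ x hx ξ := by
    have h : (fun i => (Z i).coordChange (α i) (γ i) (x i)) =
        fun i => ((Z i).coordChange (β i) (γ i) (x i)).comp
          ((Z i).coordChange (α i) (β i) (x i)) := by
      funext i
      ext v
      exact ((Z i).coordChange_comp (α i) (β i) (γ i) (x i)
        ⟨⟨hx.1.1 i trivial, hx.1.2 i trivial⟩, hx.2 i trivial⟩ v).symm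
    rw [h, PiTensorProduct.mapL_comp]
    rfl

/-- A smooth isomorphism of complex vector bundles over a real manifold: a family of complex linear
isomorphisms of the fibres, smooth together with its inverse as a map of the total spaces. -/
structure SmoothBundleIso {E : Type*} [NormedAddCommGroup E] [NormedSpace ℝ E] {H : Type*}
    [TopologicalSpace H] (I : ModelWithCorners ℝ E H) {B : Type*} [TopologicalSpace B]
    [ChartedSpace H B] {F F' : Type*} [NormedAddCommGroup F] [NormedSpace ℂ F]
    [NormedAddCommGroup F'] [NormedSpace ℂ F'] {ι ι' : Type*}
    (Z : VectorBundleCore ℂ B F ι) (Z' : VectorBundleCore ℂ B F' ι') where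
  fiberEquiv : ∀ x, Z.Fiber x ≃ₗ[ℂ] Z'.Fiber x
  smooth : ContMDiff (I.prod 𝓘(ℝ, F)) (I.prod 𝓘(ℝ, F')) ∞
    fun p : TotalSpace F Z.Fiber => TotalSpace.mk' F' (E := Z'.Fiber) p.1 (fiberEquiv p.1 p.2)
  smooth_symm : ContMDiff (I.prod 𝓘(ℝ, F')) (I.prod 𝓘(ℝ, F)) ∞
    fun p : TotalSpace F' Z'.Fiber =>
      TotalSpace.mk' F (E := Z.Fiber) p.1 ((fiberEquiv p.1).symm p.2)

/-! ### The grading of spinors -/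

namespace ClRep

variable {n : ℕ} {V : Type v} [NormedAddCommGroup V] [NormedSpace ℂ V] (ρ : ClRep n V)

/-- The product of the standard basis vectors. -/
def volumeElement (n : ℕ) : Cl n := (List.ofFn fun a : Fin n => clE a).prod

theorem clE_sq_swap (a b : Fin n) (h : a ≠ b) : clE a * clE b = -(clE b * clE a) := by
  refine CliffordAlgebra.ι_mul_ι_comm_of_isOrtho ?_
  rw [QuadraticMap.isOrtho_def]
  simp only [negEuclid, QuadraticMap.weightedSumSquares_apply, Pi.add_apply, smul_eq_mul,
    ← Finset.sum_add_distrib]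
  refine Finset.sum_congr rfl fun c _ => ?_
  by_cases hc : c = a
  · subst hc
    simp [h]
  · simp [Pi.single_apply, hc]

theorem clE_mul_prod (a : Fin n) (l : List (Fin n)) (hl : l.Nodup) :
    clE a * (l.map clE).prod =
      ((-1 : ℝ) ^ l.length * if a ∈ l then -1 else 1) • ((l.map clE).prod * clE a) := by
  induction l with
  | nil => simp
  | cons b t ih =>
    have ht := ih (List.nodup_cons.1 hl).2
    by_cases hab : a = b
    · subst hab
      have hn : a ∉ t := (List.nodup_cons.1 hl).1
      simp only [hn, if_false, mul_one] at ht
      simp only [List.map_cons, List.prod_cons, List.length_cons, List.mem_cons, true_or, if_true]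
      rw [mul_assoc (clE a) _ (clE a)]
      conv_lhs => rw [ht, mul_smul_comm]
      congr 1
      ring
    · simp only [List.map_cons, List.prod_cons, List.length_cons, List.mem_cons, hab, false_or]
      rw [← mul_assoc, clE_sq_swap a b hab, neg_mul, mul_assoc, ht, mul_smul_comm, mul_assoc,
        ← neg_smul]
      congr 1
      ring

/-- In even dimension the volume element anticommutes with vectors. -/
theorem volume_anticomm (hn : Even n) (v : Fin n → ℝ) :
    volumeElement n * clVec v = -(clVec v * volumeElement n) := by
  have h : ∀ a, clE a * volumeElement n = -(volumeElement n * clE a) := by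
    intro a
    have := clE_mul_prod a (List.finRange n) (List.nodup_finRange n)
    simp only [List.length_finRange, hn.neg_one_pow, List.mem_finRange, if_true, one_mul,
      neg_smul, one_smul] at this
    rwa [volumeElement, List.ofFn_eq_map]
  have hv : clVec v = ∑ a, v a • clE a := by
    conv_lhs => rw [pi_eq_sum_univ' v]
    simp [clVec, map_sum]
  rw [hv, Finset.mul_sum, Finset.sum_mul, ← Finset.sum_neg_distrib]
  refine Finset.sum_congr rfl fun a _ => ?_
  rw [smul_mul_assoc, h, mul_smul_comm, smul_neg, neg_neg]

theorem volume_comm_even (hn : Even n) (s : Cl n) (hs : s ∈ CliffordAlgebra.even (negEuclid n)) :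
    volumeElement n * s = s * volumeElement n := by
  refine CliffordAlgebra.even_induction (Q := negEuclid n)
    (motive := fun s _ => volumeElement n * s = s * volumeElement n) ?_ ?_ ?_ s hs
  · exact fun r => (Algebra.commutes r _).symm
  · intro x y _ _ hx hy
    rw [mul_add, add_mul, hx, hy]
  · intro v w x _ hx
    calc volumeElement n * (clVec v * clVec w * x)
        = volumeElement n * clVec v * clVec w * x := by noncomm_ring
      _ = -(clVec v * (volumeElement n * clVec w) * x) := by
          rw [volume_anticomm hn]; noncomm_ring
      _ = clVec v * clVec w * (volumeElement n * x) := by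
          rw [volume_anticomm hn]; noncomm_ring
      _ = clVec v * clVec w * x * volumeElement n := by rw [hx]; noncomm_ring

/-- The complex volume element `i^(n/2) e₁ ⋯ eₙ`; for even `n` its square is `1`. -/
def chirality : Module.End ℂ V := (Complex.I ^ (n / 2)) • ρ (volumeElement n)

/-- The halves `V⁺` (for `s = 1`) and `V⁻` (for `s = -1`) of a spinor module `V`. In even dimension
they are the eigenspaces of the complex volume element. In odd dimension the spinor module is
doubled, and both halves are copies of `V` itself. -/
def half (s : ℂ) : Submodule ℂ V :=
  if Even n then Module.End.eigenspace ρ.chirality s else ⊤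

theorem spin_mem_half (s : ℂ) (a : Spin n) (ξ : V) (hξ : ξ ∈ ρ.half s) :
    ρ (a : Cl n) ξ ∈ ρ.half s := by
  unfold half at *
  split_ifs with hn
  · rw [if_pos hn, Module.End.mem_eigenspace_iff] at hξ
    rw [Module.End.mem_eigenspace_iff]
    have h := congrArg ρ (volume_comm_even hn a (spinGroup.mem_even a.2))
    rw [map_mul, map_mul] at h
    have h' := LinearMap.congr_fun h ξ
    simp only [Module.End.mul_apply] at h'
    simp only [chirality, LinearMap.smul_apply] at hξ ⊢
    rw [h', ← map_smul, hξ, map_smul]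
  · trivial

theorem vec_mem_half (s t : ℂ) (hst : t = -s) (v : Fin n → ℝ) (ξ : V) (hξ : ξ ∈ ρ.half s) :
    ρ (clVec v) ξ ∈ ρ.half t := by
  subst hst
  unfold half at *
  split_ifs with hn
  · rw [if_pos hn, Module.End.mem_eigenspace_iff] at hξ
    rw [Module.End.mem_eigenspace_iff]
    have h := congrArg ρ (volume_anticomm hn v)
    rw [map_neg, map_mul, map_mul] at h
    have h' := LinearMap.congr_fun h ξ
    simp only [Module.End.mul_apply, LinearMap.neg_apply] at h'
    simp only [chirality, LinearMap.smul_apply] at hξ ⊢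
    rw [h', smul_neg, ← map_smul, hξ, map_smul, neg_smul]
  · trivial

/-- The standard fibre `V⁺ ⊕ V⁻` of `S⁺ ⊕ S⁻`. -/
def Graded : Type v := ρ.half 1 × ρ.half (-1)

instance : NormedAddCommGroup ρ.Graded :=
  inferInstanceAs (NormedAddCommGroup (ρ.half 1 × ρ.half (-1)))

instance : NormedSpace ℂ ρ.Graded :=
  inferInstanceAs (NormedSpace ℂ (ρ.half 1 × ρ.half (-1)))

instance [FiniteDimensional ℂ V] : FiniteDimensional ℂ ρ.Graded :=
  inferInstanceAs (FiniteDimensional ℂ (ρ.half 1 × ρ.half (-1)))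

/-- The components of an element of `V⁺ ⊕ V⁻`. -/
def toProd : ρ.Graded ≃ₗ[ℂ] ρ.half 1 × ρ.half (-1) :=
  LinearEquiv.refl ℂ (ρ.half 1 × ρ.half (-1))

/-- The action of a vector on `V⁺ ⊕ V⁻`, namely `(ξ⁺, ξ⁻) ↦ (v ξ⁻, v ξ⁺)`. -/
def gradedVec (v : Fin n → ℝ) : ρ.Graded →ₗ[ℂ] ρ.Graded :=
  ρ.toProd.symm.conj <| LinearMap.prod
    (((ρ (clVec v)).restrict (ρ.vec_mem_half (-1) 1 (neg_neg 1).symm v)).comp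
      (LinearMap.snd ℂ _ _))
    (((ρ (clVec v)).restrict (ρ.vec_mem_half 1 (-1) rfl v)).comp (LinearMap.fst ℂ _ _))

/-- The parity `(ξ⁺, ξ⁻) ↦ (ξ⁺, -ξ⁻)`. -/
def parity : ρ.Graded →ₗ[ℂ] ρ.Graded :=
  ρ.toProd.symm.conj <| LinearMap.prodMap LinearMap.id (-LinearMap.id)

/-- The diagonal of `V⁺ ⊕ V⁻` (where both are copies of `V`). -/
def diagonal : Submodule ℂ ρ.Graded where
  carrier := {ξ | ((ρ.toProd ξ).1 : V) = (ρ.toProd ξ).2}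
  add_mem' {ξ η} h h' := by simp_all
  zero_mem' := by simp
  smul_mem' c ξ h := by simp_all

end ClRep

/-! ### The bundles `W` and `S` over the product -/

section GradedSpinors

variable {E : Type*} [NormedAddCommGroup E] [NormedSpace ℝ E] {H : Type*} [TopologicalSpace H]
  {I : ModelWithCorners ℝ E H} {M : Type u} [TopologicalSpace M] [ChartedSpace H M]
  [IsManifold I ∞ M] {g : SmoothMetric I M} {n : ℕ} (σ : SpinStructure I g n)
  {V : Type v} [NormedAddCommGroup V] [NormedSpace ℂ V] [FiniteDimensional ℂ V] (ρ : ClRep n V)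

/-- The bundle `S⁺` (for `s = 1`) or `S⁻` (for `s = -1`), where `S` is the spinor bundle. -/
def SpinStructure.halfSpinorBundle (s : ℂ) : VectorBundleCore ℂ M (ρ.half s) σ.Index :=
  (σ.spinorBundle ρ).sub (ρ.half s) fun α β x => ρ.spin_mem_half s (σ.lift β α x)

/-- The bundle `S⁺ ⊕ S⁻`. -/
def SpinStructure.gradedSpinorBundle : VectorBundleCore ℂ M ρ.Graded σ.Index :=
  VectorBundleCore.directSum (σ.halfSpinorBundle ρ 1) (σ.halfSpinorBundle ρ (-1))
    ((VectorBundleCore.sub_baseSet _ _ _).trans (VectorBundleCore.sub_baseSet _ _ _).symm)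

end GradedSpinors

section Product

variable {N : ℕ} {D : Fin N → ℕ} {M : Fin N → Type u} [∀ i, TopologicalSpace (M i)]
  [∀ i, ChartedSpace (EuclideanSpace ℝ (Fin (D i))) (M i)]

/-- The differential of the projection onto the factor number `i`. It is the projection onto the
summand number `i` of the tangent space of the product. -/
def tangentProj (x : ∀ i, M i) (i : Fin N) :
    TangentSpace (prodModel D) x →L[ℝ] TangentSpace (𝓡 (D i)) (x i) :=
  mfderiv (prodModel D) (𝓡 (D i)) (fun y : ∀ i, M i => y i) x

variable [∀ i, IsManifold (𝓡 (D i)) ∞ (M i)] {g : ∀ i, SmoothMetric (𝓡 (D i)) (M i)}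
  (σ : ∀ i, SpinStructure (𝓡 (D i)) (g i) (D i))
  {V : Fin N → Type v} [∀ i, NormedAddCommGroup (V i)] [∀ i, NormedSpace ℂ (V i)]
  [∀ i, FiniteDimensional ℂ (V i)] (ρ : ∀ i, ClRep (D i) (V i))

/-- The bundle `W = (S₁⁺ ⊕ S₁⁻) ⊗ ⋯ ⊗ (S_N⁺ ⊕ S_N⁻)` over the product. -/
def bundleW : VectorBundleCore ℂ (∀ i, M i) (⨂[ℂ] i, (ρ i).Graded) (∀ i, (σ i).Index) :=
  VectorBundleCore.tensor fun i => (σ i).gradedSpinorBundle (ρ i)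

/-- The standard fibre of `S`: inside the standard fibre of `W`, the tensor product of the diagonals
of the factors with number in `K` and of all the other factors `Sᵢ⁺ ⊕ Sᵢ⁻`. -/
def fiberS (K : Finset (Fin N)) : Submodule ℂ (⨂[ℂ] i, (ρ i).Graded) :=
  Submodule.span ℂ {t | ∃ ξ : ∀ i, (ρ i).Graded,
    (∀ k ∈ K, ξ k ∈ (ρ k).diagonal) ∧ PiTensorProduct.tprod ℂ ξ = t}

theorem coordChange_mem_fiberS (K : Finset (Fin N)) (α β : ∀ i, (σ i).Index) (x : ∀ i, M i)
    (t : ⨂[ℂ] i, (ρ i).Graded) (ht : t ∈ fiberS ρ K) :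
    (bundleW σ ρ).coordChange α β x t ∈ fiberS ρ K := by
  suffices h : fiberS ρ K ≤
      (fiberS ρ K).comap ((bundleW σ ρ).coordChange α β x).toLinearMap from h ht
  refine Submodule.span_le.2 ?_
  rintro _ ⟨ξ, hξ, rfl⟩
  refine Submodule.subset_span ⟨fun i => ((σ i).gradedSpinorBundle (ρ i)).coordChange
    (α i) (β i) (x i) (ξ i), fun k hk => ?_, ?_⟩
  · exact congrArg (ρ k ((σ k).lift (β k) (α k) (x k) : Cl (D k))) (hξ k hk)
  · exact (PiTensorProduct.map_tprod _ _).symm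

/-- The subbundle `S` of `W` in which the factors with number in `K` are diagonalized. -/
def bundleS (K : Finset (Fin N)) :
    VectorBundleCore ℂ (∀ i, M i) (fiberS ρ K) (∀ i, (σ i).Index) :=
  (bundleW σ ρ).sub (fiberS ρ K) (coordChange_mem_fiberS σ ρ K)

/-- The inclusion of `S` into `W`. -/
def inclS (K : Finset (Fin N)) (x : ∀ i, M i) :
    (bundleS σ ρ K).Fiber x →ₗ[ℂ] (bundleW σ ρ).Fiber x :=
  (fiberS ρ K).subtype

/-- Clifford multiplication on `W`: the tangent vector `X = X₁ + ⋯ + X_N` maps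
`ξ₁ ⊗ ⋯ ⊗ ξ_N` with `ξⱼ` of degree `εⱼ` to
`∑ i, (-1)^(ε₁ + ⋯ + ε_{i-1}) ξ₁ ⊗ ⋯ ⊗ (Aᵢ Xᵢ) ξᵢ ⊗ ⋯ ⊗ ξ_N`. -/
def cliffordMulW
    (A : ∀ i, ∀ x : (∀ i, M i), TangentSpace (𝓡 (D i)) (x i) →L[ℝ] TangentSpace (𝓡 (D i)) (x i))
    (x : ∀ i, M i) (X : TangentSpace (prodModel D) x) :
    (bundleW σ ρ).Fiber x →ₗ[ℂ] (bundleW σ ρ).Fiber x :=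
  (∑ i, PiTensorProduct.map fun j =>
      if j < i then (ρ j).parity
      else if j = i then
        (ρ j).gradedVec ((σ j).frameCoord (x j) (A j x (tangentProj x j X)))
      else LinearMap.id : (⨂[ℂ] i, (ρ i).Graded) →ₗ[ℂ] ⨂[ℂ] i, (ρ i).Graded)

end Product

end

/-! The structure group of the product reduces to Spin(D₁) × ⋯ × Spin(D_N), and spin groups consist
of even elements. The spinor module of the product and the standard fibre of `S` therefore need to
be compared only as modules over the even parts of the Clifford algebras of the factors.

Algebra. Take as generators the basis vectors of a block of even dimension, and the products
eₐe_last (a ≠ last) in a block of odd dimension. Each block has an even number 2[Dᵢ/2] of these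
square roots of -1. All generators from even dimensional blocks anticommute and form one class; each
odd dimensional block is a class of its own, and it commutes with everything else because its
generators are even. The same relations hold on the fibre of `S`, where a vector acts with the
parities of only the even dimensional factors in front of it: the parity of a diagonalized factor
would not preserve the diagonal. The signs between blocks then differ from those of `W`, but
products of two vectors from one block do not see them.

Since all classes have even size, such a system generates a simple algebra
(`IsPauliSystem.isSimpleRing`), and a finite dimensional representation is determined by its
dimension (`IsPauliSystem.exists_intertwiner`). An irreducible Clifford module has dimension 2^[D/2]
by Burnside's theorem and a trace argument (`ClRep.IsSpinorModule.finrank_eq`). Diagonalizing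
exactly N_o - [N_o/2] odd factors gives `S` the same rank (`finrank_fiberS`). This yields the
isomorphism Ψ of standard fibres in `exists_fiberS_equiv`.

Geometry. The frames dual to the forms X ↦ ⟨eₐ, Aᵢ Xᵢ⟩ are orthonormal and change blockwise, so the
products of the lifts of the factors define a spin structure (`prodSpinStructure`), for which Ψ is
equivariant. An arbitrary spin structure on the product is compared with this one by lifting the
change of frames to units of the Clifford algebra. Local lifts are unique up to sign, the signs form
a Čech cocycle, and this cocycle is a coboundary on a simply connected manifold
(`SpinStructure.exists_global_lift`). The resulting global family s may be odd, so no orientations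
have to be matched. The bundle isomorphism is Φ = Ψ ∘ ρ'(s). It respects products of two vectors
because conjugation by s carries the product in one frame to the product in the other, whether s is
even or odd. -/

noncomputable section

/-! ### Words in anticommuting and commuting generators -/

/-- Square roots of `-1` indexed by `Gen`, which anticommute when they are in the same class
(for the map `c`) and commute otherwise. -/
structure IsPauliSystem {Gen C A : Type*} [Ring A] (x : Gen → A) (c : Gen → C) : Prop where
  sq : ∀ s, x s * x s = -1
  anti : ∀ s t, s ≠ t → c s = c t → x s * x t = -(x t * x s)
  comm : ∀ s t, c s ≠ c t → x s * x t = x t * x s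

namespace IsPauliSystem

variable {Gen C A : Type*} [Ring A] {x : Gen → A} {c : Gen → C}

theorem isUnit_word (h : IsPauliSystem x c) (l : List Gen) : IsUnit (l.map x).prod := by
  induction l with
  | nil => simp
  | cons s l ih =>
    rw [List.map_cons, List.prod_cons]
    refine IsUnit.mul ⟨⟨x s, -x s, ?_, ?_⟩, rfl⟩ ih <;> simp [h.sq]

section WordSum

variable {𝕜 : Type*} [Field 𝕜] [Algebra 𝕜 A]

/-- Linear combinations of words. -/
def wordSum (x : Gen → A) (L : List (𝕜 × List Gen)) : A :=
  (L.map fun p => p.1 • (p.2.map x).prod).sum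

theorem wordSum_nil : wordSum x ([] : List (𝕜 × List Gen)) = 0 := rfl

theorem wordSum_cons (p : 𝕜 × List Gen) (L : List (𝕜 × List Gen)) :
    wordSum x (p :: L) = p.1 • (p.2.map x).prod + wordSum x L := by
  simp [wordSum]

theorem exists_wordSum (y : A) (hy : y ∈ Algebra.adjoin 𝕜 (Set.range x)) :
    ∃ L : List (𝕜 × List Gen), y = wordSum x L := by
  rw [← Subalgebra.mem_toSubmodule, Algebra.adjoin_eq_span] at hy
  induction hy using Submodule.span_induction with
  | mem y hy =>
    obtain ⟨l, hl, rfl⟩ := Submonoid.exists_list_of_mem_closure hy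
    obtain ⟨l', rfl⟩ : l ∈ Set.range (List.map x) := by
      rw [Set.range_list_map]
      exact hl
    exact ⟨[(1, l')], by simp [wordSum]⟩
  | zero => exact ⟨[], rfl⟩
  | add y z _ _ hy hz =>
    obtain ⟨L, rfl⟩ := hy
    obtain ⟨L', rfl⟩ := hz
    exact ⟨L ++ L', by simp [wordSum]⟩
  | smul a y _ hy =>
    obtain ⟨L, rfl⟩ := hy
    exact ⟨L.map fun p => (a * p.1, p.2), by
      simp [wordSum, List.smul_sum, List.map_map, Function.comp_def, mul_smul]⟩

end WordSum

variable [DecidableEq Gen] [DecidableEq C]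

/-- Each letter of the class of `t` other than `t` itself contributes one sign; copies of `t` and
letters of other classes pass freely. -/
theorem mul_word (h : IsPauliSystem x c) (t : Gen) (l : List Gen) :
    x t * (l.map x).prod =
      (-1) ^ (l.countP fun s => c s = c t ∧ s ≠ t) * ((l.map x).prod * x t) := by
  induction l with
  | nil => simp
  | cons s l ih =>
    rw [List.map_cons, List.prod_cons, ← mul_assoc, List.countP_cons]
    have hc : ∀ k : ℕ, x s * (-1 : A) ^ k = (-1) ^ k * x s := fun k =>
      ((Commute.neg_one_right (x s)).pow_right k).eq
    by_cases hst : s = t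
    · subst hst
      simp only [ne_eq, not_true_eq_false, and_false, decide_false, Bool.false_eq_true, if_false,
        add_zero]
      conv_lhs => rw [mul_assoc, ih, ← mul_assoc, hc]
      simp only [mul_assoc, ne_eq]
    · by_cases hcl : c s = c t
      · simp only [hcl, ne_eq, hst, not_false_eq_true, and_self, decide_true, if_true]
        rw [h.anti t s (Ne.symm hst) hcl.symm, neg_mul, mul_assoc, ih, ← mul_assoc, hc, pow_succ]
        simp only [mul_assoc, ne_eq, mul_neg, neg_mul, mul_one]
      · simp only [hcl, false_and, decide_false, Bool.false_eq_true, if_false, add_zero]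
        rw [h.comm t s (Ne.symm hcl), mul_assoc, ih, ← mul_assoc, hc]
        simp only [mul_assoc]

/-- A word in which every generator occurs an even number of times is `1` or `-1`. -/
theorem word_eq_of_even (h : IsPauliSystem x c) (l : List Gen) (hl : ∀ s, Even (l.count s)) :
    (l.map x).prod = 1 ∨ (l.map x).prod = -1 := by
  induction hn : l.length using Nat.strong_induction_on generalizing l with
  | _ n ih =>
    cases l with
    | nil => simp
    | cons s l =>
      have hs : s ∈ l := by
        have := hl s
        rw [List.count_cons_self] at this
        refine List.count_pos_iff.1 (Nat.pos_of_ne_zero fun h0 => ?_)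
        rw [h0] at this
        exact absurd this (by decide)
      obtain ⟨l₁, l₂, rfl⟩ := List.append_of_mem hs
      have hl' : ∀ r, Even ((l₁ ++ l₂).count r) := by
        intro r
        have := hl r
        rw [List.count_cons, List.count_append, List.count_cons] at this
        rw [List.count_append]
        split_ifs at this with hr
        · rw [Nat.even_iff] at this ⊢; omega
        · simpa using this
      -- The leading letter moves to its next occurrence, where the two copies multiply to `-1`.
      -- Removing both keeps all letter counts even.
      have key : ((s :: (l₁ ++ s :: l₂)).map x).prod =
          -((-1) ^ (l₁.countP fun r => c r = c s ∧ r ≠ s) * ((l₁ ++ l₂).map x).prod) := by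
        simp only [List.map_cons, List.map_append, List.prod_cons, List.prod_append]
        rw [← mul_assoc, h.mul_word s l₁]
        simp only [mul_assoc]
        rw [← mul_assoc (x s) (x s), h.sq]
        simp
      have := ih _ (by rw [← hn]; simp) (l₁ ++ l₂) hl' rfl
      rw [key]
      rcases neg_one_pow_eq_or A (l₁.countP fun r => c r = c s ∧ r ≠ s) with h1 | h1 <;>
        rcases this with h2 | h2 <;> rw [h1, h2] <;> simp

/-- Words and reversed words are inverse to each other up to a sign. -/
theorem word_mul_reverse (h : IsPauliSystem x c) (l : List Gen) :
    ((l ++ l.reverse).map x).prod = 1 ∨ ((l ++ l.reverse).map x).prod = -1 :=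
  h.word_eq_of_even _ fun s => by simp [List.count_append]

theorem _root_.Finset.count_toList (I : Finset Gen) (s : Gen) :
    I.toList.count s = if s ∈ I then 1 else 0 := by
  rw [List.Nodup.count I.nodup_toList]
  simp

/-- Up to a sign, every word is the product of the generators in a finite set. -/
theorem exists_finset_word [Fintype Gen] (h : IsPauliSystem x c) (l : List Gen) :
    ∃ I : Finset Gen, (l.map x).prod = (I.toList.map x).prod ∨
      (l.map x).prod = -(I.toList.map x).prod := by
  -- The letters that occur an odd number of times. Appending the reversed word of `I` makes both
  -- `l` and the word of `I` even, so the two differ by a sign.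
  let I : Finset Gen := Finset.univ.filter fun s => ¬ Even (l.count s)
  refine ⟨I, ?_⟩
  have h1 := h.word_eq_of_even (l ++ I.toList.reverse) fun s => by
    rw [List.count_append, List.count_reverse, Finset.count_toList]
    by_cases hs : Even (l.count s)
    · simpa only [I, Finset.mem_filter, Finset.mem_univ, hs, not_true_eq_false, and_false, if_false]
    · simp only [I, Finset.mem_filter, Finset.mem_univ, hs, not_false_eq_true, and_self, if_true]
      exact (Nat.not_even_iff_odd.1 hs).add_odd odd_one
  have h2 := h.word_mul_reverse I.toList
  rw [List.map_append, List.prod_append] at h1 h2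
  have hu := h.isUnit_word I.toList.reverse
  rcases h1 with h1 | h1 <;> rcases h2 with h2 | h2
  · exact Or.inl (hu.mul_right_cancel (h1.trans h2.symm))
  · exact Or.inr (hu.mul_right_cancel (by rw [h1, neg_mul, h2, neg_neg]))
  · exact Or.inr (hu.mul_right_cancel (by rw [h1, neg_mul, h2]))
  · exact Or.inl (hu.mul_right_cancel (h1.trans h2.symm))

/-- This produces a generator that anticommutes with the word, and it is where classes of even size
are needed: in a class of odd size the product of all generators would be central. If the class of
`s₀` occurs an even number of times in all, `t = s₀` works. Otherwise the letters of that class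
cannot all have odd counts, since their number is even, so some `t` in it has an even count. -/
theorem exists_odd_countP [Fintype Gen] (hc : ∀ a, Even (Finset.univ.filter fun s => c s = a).card)
    (l : List Gen) (s₀ : Gen) (hs₀ : ¬ Even (l.count s₀)) :
    ∃ t, Odd (l.countP fun s => c s = c t ∧ s ≠ t) := by
  have hsplit : ∀ t (m : List Gen), m.countP (fun s => c s = c t) =
      (m.countP fun s => c s = c t ∧ s ≠ t) + m.count t := by
    intro t m
    induction m with
    | nil => simp
    | cons s m ih =>
      simp only [List.countP_cons, List.count_cons, ih]
      by_cases hst : s = t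
      · subst hst; simp; omega
      · simp [hst]; omega
  have hsum : ∀ (a : C) (m : List Gen), m.countP (fun s => c s = a) =
      ∑ s ∈ Finset.univ.filter (fun s => c s = a), m.count s := by
    intro a m
    induction m with
    | nil => simp
    | cons s m ih =>
      simp only [List.countP_cons, List.count_cons, ih, Finset.sum_add_distrib]
      congr 1
      by_cases hs : c s = a
      · simp [hs, beq_iff_eq]
      · simp [hs, beq_iff_eq]
  by_cases hn : Even (l.countP fun s => c s = c s₀)
  · refine ⟨s₀, ?_⟩
    rw [hsplit] at hn
    rw [Nat.even_iff] at hn hs₀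
    rw [Nat.odd_iff]
    omega
  · obtain ⟨t, htc, ht⟩ : ∃ t, c t = c s₀ ∧ Even (l.count t) := by
      by_contra hcon
      push Not at hcon
      apply hn
      rw [hsum, Finset.even_sum_iff_even_card_odd, Finset.filter_true_of_mem]
      · exact hc _
      · intro s hs
        exact Nat.not_even_iff_odd.1 (hcon s (Finset.mem_filter.1 hs).2)
    refine ⟨t, ?_⟩
    rw [← htc, hsplit] at hn
    rw [Nat.even_iff] at hn ht
    rw [Nat.odd_iff]
    omega

section Algebra

variable {𝕜 : Type*} [Field 𝕜] [Algebra 𝕜 A]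

/-- Induction on the number of terms of a nonzero element of the ideal. Conjugation by a generator
multiplies each word by a sign, so half the sum and half the difference of an element and its
conjugate split it by that sign inside the ideal. After normalizing the first word to a scalar,
either all words are scalars or the splitting shortens the sum. -/
theorem one_mem_of_wordSum_mem [NeZero (2 : 𝕜)] [Fintype Gen] (h : IsPauliSystem x c)
    (hc : ∀ a, Even (Finset.univ.filter fun s => c s = a).card) (J : TwoSidedIdeal A)
    (L : List (𝕜 × List Gen)) (hJ : wordSum x L ∈ J) (h0 : wordSum x L ≠ 0) : (1 : A) ∈ J := by
  have smul_mem : ∀ (a : 𝕜) (y : A), y ∈ J → a • y ∈ J := fun a y hy => by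
    rw [Algebra.smul_def]; exact J.mul_mem_left _ _ hy
  induction hn : L.length using Nat.strong_induction_on generalizing L with
  | _ n ih =>
    cases L with
    | nil => exact absurd rfl h0
    | cons p L =>
      obtain ⟨a, l⟩ := p
      -- Multiplying by the reversed first word turns the first term into `l ++ l.reverse`, in which
      -- every count is even.
      let L' : List (𝕜 × List Gen) := ((a, l) :: L).map fun p => (p.1, p.2 ++ l.reverse)
      have hL' : wordSum x L' = wordSum x ((a, l) :: L) * (l.reverse.map x).prod := by
        simp only [L']
        generalize (a, l) :: L = L₀
        induction L₀ with
        | nil => simp [wordSum_nil]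
        | cons q L₀ ih' => rw [List.map_cons, wordSum_cons, ih', wordSum_cons, add_mul]; simp
      have hJ' : wordSum x L' ∈ J := by rw [hL']; exact J.mul_mem_right _ _ hJ
      have h0' : wordSum x L' ≠ 0 := by
        rw [hL']
        exact fun h' => h0 ((h.isUnit_word _).mul_left_eq_zero.1 h')
      have hlen : L'.length = n := by rw [← hn]; simp [L']
      by_cases hall : ∀ p ∈ L', ∀ s, Even (p.2.count s)
      · obtain ⟨b, hb⟩ : ∃ b : 𝕜, wordSum x L' = algebraMap 𝕜 A b := by
          clear_value L'
          clear hL' hJ' h0' hlen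
          induction L' with
          | nil => exact ⟨0, by simp [wordSum]⟩
          | cons p L' ih' =>
            obtain ⟨b, hb⟩ := ih' fun q hq => hall q (List.mem_cons_of_mem _ hq)
            have hp := h.word_eq_of_even p.2 (hall p List.mem_cons_self)
            rcases hp with hp | hp
            · exact ⟨p.1 + b, by rw [wordSum_cons, hp, hb]; simp [Algebra.smul_def]⟩
            · exact ⟨-p.1 + b, by rw [wordSum_cons, hp, hb]; simp [Algebra.smul_def]⟩
        have hb0 : b ≠ 0 := by
          rintro rfl
          exact h0' (by simpa using hb)
        have := smul_mem b⁻¹ _ hJ'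
        rwa [hb, Algebra.smul_def, ← map_mul, inv_mul_cancel₀ hb0, map_one] at this
      · push Not at hall
        obtain ⟨p, hp, s₀, hs₀⟩ := hall
        obtain ⟨t, ht⟩ := exists_odd_countP hc p.2 s₀ hs₀
        let sgn : 𝕜 × List Gen → ℕ := fun q => q.2.countP fun s => c s = c t ∧ s ≠ t
        let Lp := L'.filter fun q => Even (sgn q)
        let Lm := L'.filter fun q => Odd (sgn q)
        have hsum : wordSum x L' = wordSum x Lp + wordSum x Lm := by
          simp only [Lp, Lm]
          clear_value L'
          clear hL' hJ' h0' hlen hp Lp Lm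
          induction L' with
          | nil => simp [wordSum]
          | cons q L' ih' =>
            rw [wordSum_cons, ih']
            rcases Nat.even_or_odd (sgn q) with hq | hq
            · rw [List.filter_cons_of_pos (by simpa using hq),
                List.filter_cons_of_neg (by simpa using hq), wordSum_cons, add_assoc]
            · rw [List.filter_cons_of_neg (by simpa using hq),
                List.filter_cons_of_pos (by simpa using hq), wordSum_cons, add_left_comm]
        -- Conjugation by `x t`, whose inverse is `-x t`.
        have hdiff : x t * wordSum x L' * -x t = wordSum x Lp - wordSum x Lm := by
          simp only [Lp, Lm]
          clear_value L'
          clear hL' hJ' h0' hlen hp hsum Lp Lm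
          induction L' with
          | nil => simp [wordSum]
          | cons q L' ih' =>
            have hq' : x t * (q.1 • (q.2.map x).prod) * -x t =
                (-1) ^ sgn q * (q.1 • (q.2.map x).prod) := by
              rw [mul_smul_comm, h.mul_word, smul_mul_assoc, mul_assoc, mul_assoc, mul_neg, h.sq,
                neg_neg, mul_one, mul_smul_comm]
            rw [wordSum_cons, mul_add, add_mul, hq', ih']
            rcases Nat.even_or_odd (sgn q) with hq | hq
            · rw [List.filter_cons_of_pos (by simpa using hq),
                List.filter_cons_of_neg (by simpa using hq), wordSum_cons, hq.neg_one_pow, one_mul,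
                add_sub_assoc]
            · rw [List.filter_cons_of_neg (by simpa using hq),
                List.filter_cons_of_pos (by simpa using hq), wordSum_cons, hq.neg_one_pow,
                neg_one_mul]
              abel
        have hcJ : x t * wordSum x L' * -x t ∈ J :=
          J.mul_mem_right _ _ (J.mul_mem_left _ _ hJ')
        have h2 : (2 : 𝕜) ≠ 0 := NeZero.ne _
        have hpJ : wordSum x Lp ∈ J := by
          have := smul_mem (2⁻¹ : 𝕜) _ (J.add_mem hJ' hcJ)
          rwa [hdiff, hsum, add_add_sub_cancel, ← two_smul 𝕜, smul_smul, inv_mul_cancel₀ h2,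
            one_smul] at this
        have hmJ : wordSum x Lm ∈ J := by
          have := J.sub_mem hJ' hpJ
          rwa [hsum, add_sub_cancel_left] at this
        -- One of the two parts is nonzero, and both are strictly shorter: `Lm` loses the normalized
        -- first term, `Lp` loses `p`.
        by_cases hz : wordSum x Lp = 0
        · refine ih Lm.length ?_ Lm hmJ (fun hz' => h0' (by rw [hsum, hz, hz', add_zero])) rfl
          rw [← hlen]
          refine List.length_filter_lt_length_iff_exists.2 ⟨(a, l ++ l.reverse), by simp [L'], ?_⟩
          simp [sgn, List.countP_append]
        · refine ih Lp.length ?_ Lp hpJ hz rfl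
          rw [← hlen]
          refine List.length_filter_lt_length_iff_exists.2 ⟨p, hp, ?_⟩
          simpa [sgn] using ht

/-- Up to sign there are only finitely many words, one for each subset of the generators. -/
theorem finite_of_adjoin_eq_top [Fintype Gen] (h : IsPauliSystem x c)
    (htop : Algebra.adjoin 𝕜 (Set.range x) = ⊤) : Module.Finite 𝕜 A := by
  let w : Finset Gen → A := fun I => (I.toList.map x).prod
  refine ⟨Submodule.fg_def.2 ⟨Set.range w, Set.finite_range w, eq_top_iff.2 fun f _ => ?_⟩⟩
  obtain ⟨L, rfl⟩ := exists_wordSum (𝕜 := 𝕜) (x := x) f (htop ▸ trivial)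
  refine list_sum_mem fun g hg => ?_
  obtain ⟨⟨a, l⟩, -, rfl⟩ := List.mem_map.1 hg
  refine Submodule.smul_mem _ _ ?_
  obtain ⟨I, h3⟩ := h.exists_finset_word l
  have hw : w I ∈ Submodule.span 𝕜 (Set.range w) := Submodule.subset_span ⟨I, rfl⟩
  rcases h3 with h3 | h3
  · exact h3 ▸ hw
  · exact h3 ▸ neg_mem hw

/-- The algebra generated by a Pauli system with classes of even size is simple. -/
theorem isSimpleRing [NeZero (2 : 𝕜)] [Fintype Gen] [Nontrivial A] (h : IsPauliSystem x c)
    (hc : ∀ a, Even (Finset.univ.filter fun s => c s = a).card)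
    (htop : Algebra.adjoin 𝕜 (Set.range x) = ⊤) : IsSimpleRing A := by
  refine ⟨⟨fun J => ?_⟩⟩
  by_cases hJ : J = ⊥
  · exact Or.inl hJ
  · right
    obtain ⟨y, hy, hy0⟩ : ∃ y ∈ J, y ≠ 0 := by
      by_contra hcon
      push Not at hcon
      exact hJ (le_bot_iff.1 fun y hy => by simpa using hcon y hy)
    obtain ⟨L, rfl⟩ := exists_wordSum (𝕜 := 𝕜) (x := x) y (htop ▸ trivial)
    exact (TwoSidedIdeal.one_mem_iff J).1 (h.one_mem_of_wordSum_mem hc J L hy hy0)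

end Algebra

end IsPauliSystem

end

noncomputable section

/-! ### Modules over the algebra generated by a Pauli system -/

/-- A simple Artinian ring has only one simple module up to isomorphism, and every finite module is
a power of it; the dimension over the field determines the exponent. -/
theorem exists_linearEquiv_of_isSimpleRing {𝕜 R : Type*} [Field 𝕜] [Ring R] [Algebra 𝕜 R]
    [Module.Finite 𝕜 R] [IsSimpleRing R] {Z Z' : Type*} [AddCommGroup Z] [AddCommGroup Z']
    [Module 𝕜 Z] [Module 𝕜 Z'] [Module R Z] [Module R Z'] [IsScalarTower 𝕜 R Z]
    [IsScalarTower 𝕜 R Z'] [FiniteDimensional 𝕜 Z] [FiniteDimensional 𝕜 Z']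
    (hd : Module.finrank 𝕜 Z = Module.finrank 𝕜 Z') : Nonempty (Z ≃ₗ[R] Z') := by
  have : IsArtinianRing R := IsArtinianRing.of_finite 𝕜 R
  have : Module.Finite R Z := Module.Finite.of_restrictScalars_finite 𝕜 R Z
  have : Module.Finite R Z' := Module.Finite.of_restrictScalars_finite 𝕜 R Z'
  rcases subsingleton_or_nontrivial Z with hZ | hZ
  · have : Subsingleton Z' := by
      rw [← Module.finrank_zero_iff (R := 𝕜)] at hZ ⊢
      omega
    exact ⟨0⟩
  obtain ⟨n, hn, S, hS, ⟨e⟩⟩ := (IsSimpleRing.isIsotypic R Z).linearEquiv_fun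
  -- Simple submodules of `Z` and of `Z'` are compared inside `Z × Z'`, which is isotypic as well.
  have hS' : IsIsotypicOfType R Z' S := by
    intro m hm
    let e₁ := S.equivMapOfInjective (LinearMap.inl R Z Z') LinearMap.inl_injective
    let e₂ := m.equivMapOfInjective (LinearMap.inr R Z Z') LinearMap.inr_injective
    have h₁ : IsSimpleModule R (S.map (LinearMap.inl R Z Z')) := .congr e₁.symm
    have h₂ : IsSimpleModule R (m.map (LinearMap.inr R Z Z')) := .congr e₂.symm
    obtain ⟨e₃⟩ := IsSimpleRing.isIsotypic R (Z × Z') (S.map (LinearMap.inl R Z Z'))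
      (m.map (LinearMap.inr R Z Z'))
    exact ⟨e₂.trans (e₃.trans e₁.symm)⟩
  obtain ⟨n', ⟨e'⟩⟩ := hS'.linearEquiv_fun
  have : FiniteDimensional 𝕜 S :=
    Module.Finite.of_injective (S.subtype.restrictScalars 𝕜) S.subtype_injective
  have h1 := (e.restrictScalars 𝕜).finrank_eq
  have h2 := (e'.restrictScalars 𝕜).finrank_eq
  have hS0 : Module.finrank 𝕜 S ≠ 0 := by
    have := hS.nontrivial
    exact (Module.finrank_pos (R := 𝕜) (M := S)).ne'
  rw [Module.finrank_pi_fintype, Finset.sum_const, Finset.card_univ, Fintype.card_fin,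
    smul_eq_mul] at h1 h2
  have : n = n' := by
    apply Nat.eq_of_mul_eq_mul_right (Nat.pos_of_ne_zero hS0)
    rw [← h1, ← h2, hd]
  subst this
  exact ⟨e.trans e'.symm⟩

namespace IsPauliSystem

variable {Gen C : Type*} {c : Gen → C} [Fintype Gen] [DecidableEq Gen] [DecidableEq C]
  {𝕜 : Type*} [Field 𝕜]

/-- Two representations of a Pauli system with classes of even size are isomorphic if they have the
same dimension. -/
theorem exists_intertwiner [NeZero (2 : 𝕜)] {Z Z' : Type*} [AddCommGroup Z] [AddCommGroup Z']
    [Module 𝕜 Z] [Module 𝕜 Z'] [FiniteDimensional 𝕜 Z] [FiniteDimensional 𝕜 Z']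
    {x : Gen → Module.End 𝕜 Z} {x' : Gen → Module.End 𝕜 Z'} (h : IsPauliSystem x c)
    (h' : IsPauliSystem x' c) (hc : ∀ a, Even (Finset.univ.filter fun s => c s = a).card)
    (hd : Module.finrank 𝕜 Z = Module.finrank 𝕜 Z') :
    ∃ Ψ : Z ≃ₗ[𝕜] Z', ∀ s ξ, Ψ (x s ξ) = x' s (Ψ ξ) := by
  rcases subsingleton_or_nontrivial Z with hZ | hZ
  · have : Subsingleton Z' := by
      rw [← Module.finrank_zero_iff (R := 𝕜)] at hZ ⊢
      omega
    exact ⟨0, fun s ξ => Subsingleton.elim _ _⟩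
  -- The pairs of operators generate one simple algebra `R`, through which both spaces become
  -- modules over the same ring; an `R`-linear isomorphism is the required intertwiner.
  let y : Gen → Module.End 𝕜 Z × Module.End 𝕜 Z' := fun s => (x s, x' s)
  let R := Algebra.adjoin 𝕜 (Set.range y)
  have : Nontrivial (Module.End 𝕜 Z × Module.End 𝕜 Z') := inferInstance
  let z : Gen → R := fun s => ⟨y s, Algebra.subset_adjoin ⟨s, rfl⟩⟩
  have hz : IsPauliSystem z c :=
    { sq := fun s => Subtype.ext (Prod.ext (h.sq s) (h'.sq s))
      anti := fun s t hst hcl => Subtype.ext (Prod.ext (h.anti s t hst hcl) (h'.anti s t hst hcl))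
      comm := fun s t hcl => Subtype.ext (Prod.ext (h.comm s t hcl) (h'.comm s t hcl)) }
  have htop : Algebra.adjoin 𝕜 (Set.range z) = ⊤ := by
    have hz' : Set.range z = (Subtype.val : R → _) ⁻¹' Set.range y := by
      ext w
      simp [z, Subtype.ext_iff]
    rw [hz']
    exact Algebra.adjoin_adjoin_coe_preimage
  have : IsSimpleRing R := hz.isSimpleRing hc htop
  let f : R →ₐ[𝕜] Module.End 𝕜 Z := (AlgHom.fst 𝕜 _ _).comp R.val
  let f' : R →ₐ[𝕜] Module.End 𝕜 Z' := (AlgHom.snd 𝕜 _ _).comp R.val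
  let : Module R Z := Module.compHom Z f.toRingHom
  let : Module R Z' := Module.compHom Z' f'.toRingHom
  have hsm : ∀ (r : R) (ξ : Z), r • ξ = f r ξ := fun _ _ => rfl
  have hsm' : ∀ (r : R) (ξ : Z'), r • ξ = f' r ξ := fun _ _ => rfl
  have : IsScalarTower 𝕜 R Z := ⟨fun a r ξ => by rw [hsm, hsm, map_smul]; rfl⟩
  have : IsScalarTower 𝕜 R Z' := ⟨fun a r ξ => by rw [hsm', hsm', map_smul]; rfl⟩
  obtain ⟨e⟩ := exists_linearEquiv_of_isSimpleRing (R := R) hd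
  exact ⟨e.restrictScalars 𝕜, fun s ξ => e.map_smul (z s) ξ⟩

/-- **Burnside's theorem**: operators without a common invariant subspace generate the
endomorphism algebra. -/
theorem _root_.adjoin_eq_top_of_irreducible [IsAlgClosed 𝕜] {V : Type*} [AddCommGroup V]
    [Module 𝕜 V] [FiniteDimensional 𝕜 V] [Nontrivial V] (s : Set (Module.End 𝕜 V))
    (hirr : ∀ U : Submodule 𝕜 V, (∀ a ∈ s, ∀ ξ ∈ U, a ξ ∈ U) → U = ⊥ ∨ U = ⊤) :
    Algebra.adjoin 𝕜 s = ⊤ := by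
  let R := Algebra.adjoin 𝕜 s
  have hsm : ∀ (r : R) (ξ : V), r • ξ = (r : Module.End 𝕜 V) ξ := fun _ _ => rfl
  have hgen : ∀ a (ha : a ∈ s) (ξ : V), (⟨a, Algebra.subset_adjoin ha⟩ : R) • ξ = a ξ :=
    fun _ _ _ => rfl
  have hsimple : IsSimpleModule R V := by
    refine (isSimpleModule_iff R V).2 { exists_pair_ne := ⟨⊥, ⊤, bot_ne_top⟩, eq_bot_or_eq_top := fun U => ?_ }
    refine (hirr (U.restrictScalars 𝕜) fun a ha ξ hξ => ?_).imp (fun hU => ?_) fun hU => ?_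
    · exact hgen a ha ξ ▸ U.smul_mem _ hξ
    · exact Submodule.restrictScalars_injective 𝕜 R V (hU.trans rfl)
    · exact Submodule.restrictScalars_injective 𝕜 R V (hU.trans rfl)
  -- Schur's lemma: an eigenspace of an `R`-endomorphism is invariant, hence everything.
  have hschur : ∀ φ : Module.End R V, ∃ μ : 𝕜, ∀ ξ, φ ξ = μ • ξ := by
    intro φ
    let φ' : Module.End 𝕜 V := φ.restrictScalars 𝕜
    obtain ⟨μ, hμ⟩ := Module.End.exists_eigenvalue φ'
    refine ⟨μ, fun ξ => ?_⟩
    have := (hirr (φ'.eigenspace μ) fun a ha ξ hξ => ?_).resolve_left hμ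
    · exact Module.End.mem_eigenspace_iff.1 (this ▸ trivial : ξ ∈ φ'.eigenspace μ)
    · rw [Module.End.mem_eigenspace_iff] at hξ ⊢
      rw [← hgen a ha ξ]
      refine (φ.map_smul _ ξ).trans ?_
      rw [show φ ξ = μ • ξ from hξ, hgen a ha, hgen a ha, map_smul]
  rw [eq_top_iff]
  intro f _
  -- All `R`-endomorphisms are scalars, so any linear `f` commutes with them, and the density
  -- theorem matches it with an element of `R` on a basis.
  let F : Module.End (Module.End R V) V :=
    { toFun := f
      map_add' := map_add f
      map_smul' := fun φ ξ => by
        obtain ⟨μ, hμ⟩ := hschur φ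
        simp [Module.End.smul_def, hμ] }
  let b := Module.finBasis 𝕜 V
  classical
  obtain ⟨r, hr⟩ := jacobson_density (R := R) F (Finset.univ.image b)
  have : f = r := b.ext fun i => hr (b i) (Finset.mem_image_of_mem _ (Finset.mem_univ _))
  exact this ▸ r.2

section Dimension

variable {V : Type*} [AddCommGroup V] [Module 𝕜 V] {x : Gen → Module.End 𝕜 V}

/-- Some generator anticommutes with the word. Conjugation by it changes the sign of the word but
not its trace. -/
theorem trace_word_eq_zero [NeZero (2 : 𝕜)] (h : IsPauliSystem x c)
    (hc : ∀ a, Even (Finset.univ.filter fun s => c s = a).card)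
    (l : List Gen) (s₀ : Gen) (hs₀ : ¬ Even (l.count s₀)) :
    LinearMap.trace 𝕜 V (l.map x).prod = 0 := by
  obtain ⟨t, ht⟩ := exists_odd_countP hc l s₀ hs₀
  have h1 := h.mul_word t l
  rw [ht.neg_one_pow, neg_one_mul] at h1
  have h2 : (l.map x).prod = x t * (l.map x).prod * x t := by
    rw [h1, neg_mul, mul_assoc, h.sq]; simp
  have h3 : LinearMap.trace 𝕜 V (l.map x).prod = -LinearMap.trace 𝕜 V (l.map x).prod := by
    conv_lhs => rw [h2, LinearMap.trace_mul_comm, ← mul_assoc, h.sq]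
    simp
  have h4 : (2 : 𝕜) * LinearMap.trace 𝕜 V (l.map x).prod = 0 := by
    rw [two_mul]; nth_rewrite 1 [h3]; simp
  exact (mul_eq_zero.1 h4).resolve_left (NeZero.ne _)

/-- The products over subsets of the generators form a basis of `End V`: they are orthogonal for the
trace form up to reversal of words, and they span by Burnside's theorem. -/
theorem finrank_sq [CharZero 𝕜] [IsAlgClosed 𝕜] [FiniteDimensional 𝕜 V] [Nontrivial V]
    (h : IsPauliSystem x c) (hc : ∀ a, Even (Finset.univ.filter fun s => c s = a).card)
    (hirr : ∀ U : Submodule 𝕜 V, (∀ s, ∀ ξ ∈ U, x s ξ ∈ U) → U = ⊥ ∨ U = ⊤) :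
    Module.finrank 𝕜 V ^ 2 = 2 ^ Fintype.card Gen := by
  let w : Finset Gen → Module.End 𝕜 V := fun I => (I.toList.map x).prod
  have hli : LinearIndependent 𝕜 w := by
    rw [Fintype.linearIndependent_iff]
    intro a ha J
    -- Pairing with the reversed word of `J` isolates the coefficient of `J`: for `I ≠ J` a letter
    -- of the symmetric difference occurs exactly once, so the trace vanishes.
    have h1 := congrArg (fun f => LinearMap.trace 𝕜 V (f * (J.toList.reverse.map x).prod)) ha
    simp only [Finset.sum_mul, map_sum, zero_mul, map_zero, smul_mul_assoc, map_smul] at h1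
    rw [Finset.sum_eq_single J] at h1
    · have h2 := h.word_mul_reverse J.toList
      rw [List.map_append, List.prod_append] at h2
      have h3 : LinearMap.trace 𝕜 V (w J * (J.toList.reverse.map x).prod) ≠ 0 := by
        have hf : (Module.finrank 𝕜 V : 𝕜) ≠ 0 := by
          exact_mod_cast (Module.finrank_pos (R := 𝕜) (M := V)).ne'
        rcases h2 with h2 | h2 <;> simp only [w, h2] <;> simpa using hf
      exact (smul_eq_zero.1 h1).resolve_right h3
    · intro I _ hIJ
      have h2 : ∃ s, ¬ (s ∈ I ↔ s ∈ J) := by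
        by_contra hcon
        push Not at hcon
        exact hIJ (Finset.ext hcon)
      obtain ⟨s, hs⟩ := h2
      have := h.trace_word_eq_zero hc (I.toList ++ J.toList.reverse) s (by
        rw [List.count_append, List.count_reverse, Finset.count_toList, Finset.count_toList]
        by_cases h1 : s ∈ I <;> by_cases h2 : s ∈ J <;> simp_all)
      rw [List.map_append, List.prod_append] at this
      rw [this, smul_zero]
    · exact fun hJ => absurd (Finset.mem_univ J) hJ
  have hspan : ⊤ ≤ Submodule.span 𝕜 (Set.range w) := by
    intro f _
    have hf : f ∈ Algebra.adjoin 𝕜 (Set.range x) := by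
      rw [adjoin_eq_top_of_irreducible (Set.range x) fun U hU => hirr U fun s => hU _ ⟨s, rfl⟩]
      trivial
    obtain ⟨L, rfl⟩ := exists_wordSum f hf
    refine list_sum_mem ?_
    intro g hg
    obtain ⟨⟨a, l⟩, -, rfl⟩ := List.mem_map.1 hg
    refine Submodule.smul_mem _ _ ?_
    obtain ⟨I, h3⟩ := h.exists_finset_word l
    have hw : w I ∈ Submodule.span 𝕜 (Set.range w) := Submodule.subset_span ⟨I, rfl⟩
    rcases h3 with h3 | h3
    · exact h3 ▸ hw
    · exact h3 ▸ neg_mem hw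
  have := Module.finrank_eq_card_basis (Module.Basis.mk hli hspan)
  rw [Module.finrank_linearMap, Fintype.card_finset] at this
  rw [pow_two, this]

end Dimension

end IsPauliSystem

end

noncomputable section

/-! ### The Clifford algebra of Euclidean space -/

section CliffordBasics

variable {n : ℕ}

theorem negEuclid_apply (v : Fin n → ℝ) : negEuclid n v = -∑ a, v a * v a := by
  simp [negEuclid, QuadraticMap.weightedSumSquares_apply]

theorem clVec_mul_self (v : Fin n → ℝ) :
    clVec v * clVec v = algebraMap ℝ (Cl n) (-∑ a, v a * v a) := by
  rw [CliffordAlgebra.ι_sq_scalar, negEuclid_apply]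

theorem clVec_eq_sum (v : Fin n → ℝ) : clVec v = ∑ a, v a • clE a := by
  conv_lhs => rw [pi_eq_sum_univ' v]
  simp [clVec, map_sum]

theorem clE_mul_self (a : Fin n) : clE a * clE a = -1 := by
  rw [clVec_mul_self]
  simp [Pi.single_apply]

theorem isPauliSystem_clE : IsPauliSystem (clE : Fin n → Cl n) fun _ => () where
  sq := clE_mul_self
  anti _ _ h _ := ClRep.clE_sq_swap _ _ h
  comm _ _ h := absurd rfl h

theorem adjoin_range_clE : Algebra.adjoin ℝ (Set.range (clE : Fin n → Cl n)) = ⊤ := by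
  rw [eq_top_iff, ← CliffordAlgebra.adjoin_range_ι (Q := negEuclid n)]
  refine Algebra.adjoin_le ?_
  rintro _ ⟨v, rfl⟩
  rw [show CliffordAlgebra.ι (negEuclid n) v = clVec v from rfl, clVec_eq_sum]
  exact sum_mem fun a _ => Subalgebra.smul_mem _ (Algebra.subset_adjoin (Set.mem_range_self a)) _

instance finite_cl : Module.Finite ℝ (Cl n) :=
  isPauliSystem_clE.finite_of_adjoin_eq_top adjoin_range_clE

/-- Induction over words in the standard basis. -/
theorem cl_word_induction {p : Cl n → Prop} (hword : ∀ l : List (Fin n), p (l.map clE).prod)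
    (hadd : ∀ x y, p x → p y → p (x + y)) (hsmul : ∀ (r : ℝ) x, p x → p (r • x)) (x : Cl n) :
    p x := by
  obtain ⟨L, rfl⟩ := IsPauliSystem.exists_wordSum (𝕜 := ℝ) (x := (clE : Fin n → Cl n)) x
    (adjoin_range_clE ▸ trivial)
  induction L with
  | nil => simpa [IsPauliSystem.wordSum_nil] using hsmul 0 _ (hword [])
  | cons q L ih =>
    rw [IsPauliSystem.wordSum_cons]
    exact hadd _ _ (hsmul _ _ (hword _)) ih

theorem IsPauliSystem.map {Gen C A B : Type*} [Ring A] [Ring B] {x : Gen → A} {c : Gen → C}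
    (h : IsPauliSystem x c) (f : A →+* B) : IsPauliSystem (fun s => f (x s)) c where
  sq s := by rw [← map_mul, h.sq, map_neg, map_one]
  anti s t hst hcl := by rw [← map_mul, ← map_mul, h.anti s t hst hcl, map_neg]
  comm s t hcl := by rw [← map_mul, ← map_mul, h.comm s t hcl]

theorem IsPauliSystem.comp_injective {Gen Gen' C A : Type*} [Ring A] {x : Gen → A} {c : Gen → C}
    (h : IsPauliSystem x c) (f : Gen' → Gen) (hf : Function.Injective f) :
    IsPauliSystem (fun s => x (f s)) (fun s => c (f s)) where
  sq _ := h.sq _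
  anti _ _ hst hcl := h.anti _ _ (hf.ne hst) hcl
  comm _ _ hcl := h.comm _ _ hcl

end CliffordBasics

/-! ### The dimension of spinor modules -/

namespace ClRep

variable {n : ℕ} {V : Type v} [NormedAddCommGroup V] [NormedSpace ℂ V]

theorem isPauliSystem (ρ : ClRep n V) : IsPauliSystem (fun a => ρ (clE a)) fun _ => () :=
  isPauliSystem_clE.map (ρ : Cl n →+* Module.End ℂ V)

/-- A subspace that is invariant under the standard basis vectors is invariant under the whole
Clifford algebra. -/
theorem invariant_of_clE (ρ : ClRep n V) (U : Submodule ℂ V)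
    (hU : ∀ a, ∀ ξ ∈ U, ρ (clE a) ξ ∈ U) (x : Cl n) : ∀ ξ ∈ U, ρ x ξ ∈ U := by
  induction x using cl_word_induction with
  | hword l =>
    induction l with
    | nil => simp
    | cons a l ih =>
      intro ξ hξ
      rw [List.map_cons, List.prod_cons, map_mul]
      exact hU a _ (ih ξ hξ)
  | hadd x y hx hy =>
    intro ξ hξ
    rw [map_add]
    exact U.add_mem (hx ξ hξ) (hy ξ hξ)
  | hsmul r x hx =>
    intro ξ hξ
    rw [map_smul]
    have := U.smul_mem (r : ℂ) (hx ξ hξ)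
    rwa [Complex.coe_smul] at this

/-- In odd dimension the volume element is central. -/
theorem volume_comm_odd (hn : Odd n) (x : Cl n) : x * volumeElement n = volumeElement n * x := by
  have h : ∀ a, clE a * volumeElement n = volumeElement n * clE a := by
    intro a
    have := clE_mul_prod a (List.finRange n) (List.nodup_finRange n)
    simp only [List.length_finRange, hn.neg_one_pow, List.mem_finRange, if_true, mul_neg, mul_one,
      neg_neg, one_smul] at this
    rwa [volumeElement, List.ofFn_eq_map]
  induction x using cl_word_induction with
  | hword l =>
    induction l with
    | nil => simp
    | cons a l ih => rw [List.map_cons, List.prod_cons, mul_assoc, ih, ← mul_assoc, h, mul_assoc]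
  | hadd x y hx hy => rw [add_mul, hx, hy, mul_add]
  | hsmul r x hx => rw [smul_mul_assoc, hx, mul_smul_comm]

theorem half_of_odd (ρ : ClRep n V) (hn : Odd n) (s : ℂ) : ρ.half s = ⊤ :=
  if_neg (Nat.not_even_iff_odd.2 hn)

theorem finrank_diagonal_of_odd (ρ : ClRep n V) (hn : Odd n) :
    Module.finrank ℂ ρ.diagonal = Module.finrank ℂ V := by
  have hmem : ∀ (s : ℂ) ξ, ξ ∈ ρ.half s := fun s ξ => by rw [ρ.half_of_odd hn]; trivial
  let f : ρ.diagonal →ₗ[ℂ] V :=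
    (ρ.half 1).subtype ∘ₗ LinearMap.fst ℂ _ _ ∘ₗ ρ.toProd.toLinearMap ∘ₗ ρ.diagonal.subtype
  have hf : ∀ ξ, f ξ = (ρ.toProd ξ.1).1 := fun _ => rfl
  refine LinearEquiv.finrank_eq (LinearEquiv.ofBijective f ⟨fun ξ η h => ?_, fun ξ => ?_⟩)
  · rw [hf, hf] at h
    refine Subtype.ext (ρ.toProd.injective (Prod.ext (Subtype.ext h) (Subtype.ext ?_)))
    exact (ξ.2.symm.trans h).trans η.2
  · refine ⟨⟨ρ.toProd.symm (⟨ξ, hmem _ ξ⟩, ⟨ξ, hmem _ ξ⟩), ?_⟩, ?_⟩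
    · change ((ρ.toProd _).1 : V) = (ρ.toProd _).2
      rw [LinearEquiv.apply_symm_apply]
    · rw [hf, LinearEquiv.apply_symm_apply]

/-- Reordering k anticommuting letters costs k(k-1)/2 signs, and the k squares `-1` contribute k
more, hence k(k+1)/2. -/
theorem prod_map_clE_mul_self (l : List (Fin n)) (hl : l.Nodup) :
    (l.map clE).prod * (l.map clE).prod =
      ((-1 : ℝ) ^ (l.length * (l.length + 1) / 2)) • (1 : Cl n) := by
  induction l with
  | nil => simp
  | cons a l ih =>
    have h := clE_mul_prod a l (List.nodup_cons.1 hl).2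
    simp only [(List.nodup_cons.1 hl).1, if_false, mul_one] at h
    have h' : (l.map clE).prod * clE a = (-1 : ℝ) ^ l.length • (clE a * (l.map clE).prod) := by
      rw [h, smul_smul, ← mul_pow]; simp
    have hk : (l.length + 1) * (l.length + 1 + 1) / 2 =
        l.length * (l.length + 1) / 2 + (l.length + 1) := by
      rw [← Nat.add_mul_div_left _ _ two_pos]
      congr 1
      ring
    rw [List.map_cons, List.prod_cons, List.length_cons, hk]
    calc clE a * (l.map clE).prod * (clE a * (l.map clE).prod)
        = clE a * ((l.map clE).prod * clE a) * (l.map clE).prod := by simp only [mul_assoc]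
      _ = (-1 : ℝ) ^ l.length • (clE a * clE a * ((l.map clE).prod * (l.map clE).prod)) := by
          rw [h', mul_smul_comm, smul_mul_assoc]; simp only [mul_assoc]
      _ = _ := by
          rw [ih (List.nodup_cons.1 hl).2, clE_mul_self, neg_one_mul, ← neg_smul, smul_smul]
          congr 1
          ring

/-- For n = 2m the exponent is m(2m+1) = m + 2m², so the volume element squares to (-1)^m, which the
factor i^(2m) cancels. -/
theorem chirality_mul_self (ρ : ClRep n V) (hn : Even n) : ρ.chirality * ρ.chirality = 1 := by
  obtain ⟨m, rfl⟩ := hn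
  have h := prod_map_clE_mul_self (List.finRange (m + m)) (List.nodup_finRange _)
  rw [← List.ofFn_eq_map, List.length_finRange] at h
  have hv : ρ (volumeElement (m + m)) * ρ (volumeElement (m + m)) = ((-1 : ℂ) ^ m) • 1 := by
    rw [← map_mul, volumeElement, h, map_smul, map_one]
    have : (m + m) * (m + m + 1) / 2 = m + 2 * (m * m) := by
      rw [show (m + m) * (m + m + 1) = 2 * (m + 2 * (m * m)) by ring]
      simp
    rw [this, pow_add, pow_mul, neg_one_sq, one_pow, mul_one, ← Complex.coe_smul]
    simp
  have hd : (m + m) / 2 = m := by omega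
  rw [chirality, smul_mul_smul_comm, hv, smul_smul, hd, ← mul_pow, Complex.I_mul_I, ← mul_pow]
  simp

variable [FiniteDimensional ℂ V] {ρ : ClRep n V}

/-- Schur's lemma for the volume element, which is central in odd dimension. -/
theorem IsSpinorModule.exists_volume_eq_smul (hρ : ρ.IsSpinorModule) (hn : Odd n) :
    ∃ μ : ℂ, ∀ ξ, ρ (volumeElement n) ξ = μ • ξ := by
  have := hρ.1
  obtain ⟨μ, hμ⟩ := Module.End.exists_eigenvalue (ρ (volumeElement n))
  refine ⟨μ, fun ξ => ?_⟩
  have h := (hρ.2 ((ρ (volumeElement n)).eigenspace μ) fun x ξ hξ => ?_).resolve_left hμ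
  · exact Module.End.mem_eigenspace_iff.1 (h ▸ trivial : ξ ∈ (ρ (volumeElement n)).eigenspace μ)
  · rw [Module.End.mem_eigenspace_iff] at hξ ⊢
    rw [← Module.End.mul_apply, ← map_mul, ← volume_comm_odd hn, map_mul, Module.End.mul_apply,
      hξ, map_smul]

/-- In odd dimension the first `m` basis vectors already act irreducibly: the volume element is a
scalar, so the last basis vector acts as a multiple of their product. Hence
`IsPauliSystem.finrank_sq` applies with an even number of generators. -/
theorem IsSpinorModule.finrank_sq (hρ : ρ.IsSpinorModule) {m : ℕ} (hm : Even m)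
    (h : n = m ∨ n = m + 1) : Module.finrank ℂ V ^ 2 = 2 ^ m := by
  have := hρ.1
  have hmn : m ≤ n := by omega
  have hsys := ρ.isPauliSystem.comp_injective (Fin.castLE hmn) (Fin.castLE_injective hmn)
  rw [hsys.finrank_sq, Fintype.card_fin]
  · intro a
    simpa using hm
  · intro U hU
    refine hρ.2 U (ρ.invariant_of_clE U ?_)
    rcases h with rfl | rfl
    · exact hU
    · intro a
      refine Fin.lastCases ?_ (fun a => hU a) a
      obtain ⟨μ, hμ⟩ := hρ.exists_volume_eq_smul hm.add_one
      let p : Cl (m + 1) := (((List.finRange m).map Fin.castSucc).map clE).prod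
      have hvol : volumeElement (m + 1) = p * clE (Fin.last m) := by
        simp only [volumeElement, p, List.ofFn_succ', List.concat_eq_append, List.prod_append,
          List.ofFn_eq_map, List.map_map, List.prod_singleton]
        rfl
      have hpU : ∀ ξ ∈ U, ρ p ξ ∈ U := by
        simp only [p]
        induction List.finRange m with
        | nil => simp
        | cons b l ih =>
          intro ξ hξ
          rw [List.map_cons, List.map_cons, List.prod_cons, map_mul]
          exact hU b _ (ih ξ hξ)
      have hp : p * p = 1 ∨ p * p = -1 := by
        simp only [p]
        rw [← List.prod_append, ← List.map_append]
        exact isPauliSystem_clE.word_eq_of_even _ fun s => by simp [List.count_append]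
      intro ξ hξ
      -- The inner factor is the volume element, a scalar, and `p` preserves `U`; since `p * p =
      -- ±1`, the left side is the last basis vector applied to `ξ`, up to sign.
      have h1 : ρ p (ρ (p * clE (Fin.last m)) ξ) ∈ U := by
        rw [← hvol, hμ, map_smul]
        exact U.smul_mem _ (hpU ξ hξ)
      rw [← Module.End.mul_apply, ← map_mul, ← mul_assoc] at h1
      rcases hp with hp | hp <;> rw [hp] at h1
      · rwa [one_mul] at h1
      · rw [neg_one_mul, map_neg, LinearMap.neg_apply] at h1
        exact neg_mem_iff.1 h1

/-- The complex dimension of a spinor module. -/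
theorem IsSpinorModule.finrank_eq (hρ : ρ.IsSpinorModule) : Module.finrank ℂ V = 2 ^ (n / 2) := by
  have h := hρ.finrank_sq (m := 2 * (n / 2)) (even_two_mul _) (by omega)
  rw [mul_comm, pow_mul] at h
  exact Nat.pow_left_injective (n := 2) two_ne_zero h

/-- In even dimension a spinor module is the sum of its halves. -/
theorem finrank_half_add (ρ : ClRep n V) (hn : Even n) :
    Module.finrank ℂ (ρ.half 1) + Module.finrank ℂ (ρ.half (-1)) = Module.finrank ℂ V := by
  have hsq : ∀ ξ, ρ.chirality (ρ.chirality ξ) = ξ := fun ξ =>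
    LinearMap.congr_fun (ρ.chirality_mul_self hn) ξ
  have hc : IsCompl (ρ.half 1) (ρ.half (-1)) := by
    simp only [half, if_pos hn]
    refine ⟨?_, ?_⟩
    · rw [Submodule.disjoint_def]
      intro ξ h1 h2
      rw [Module.End.mem_eigenspace_iff] at h1 h2
      rw [h1, one_smul, neg_one_smul] at h2
      have h3 : (2 : ℂ) • ξ = 0 := by
        rw [two_smul]
        nth_rewrite 1 [h2]
        exact neg_add_cancel ξ
      exact (smul_eq_zero.1 h3).resolve_left two_ne_zero
    · rw [codisjoint_iff, eq_top_iff]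
      intro ξ _
      refine Submodule.mem_sup.2 ⟨(2⁻¹ : ℂ) • (ξ + ρ.chirality ξ), ?_,
        (2⁻¹ : ℂ) • (ξ - ρ.chirality ξ), ?_, ?_⟩
      · rw [Module.End.mem_eigenspace_iff, map_smul, map_add, hsq, one_smul, add_comm]
      · rw [Module.End.mem_eigenspace_iff, map_smul, map_sub, hsq, neg_one_smul, ← smul_neg, neg_sub]
      · rw [← smul_add, add_add_sub_cancel, ← two_smul ℂ ξ, smul_smul]
        norm_num
  exact Submodule.finrank_add_eq_of_isCompl hc

theorem finrank_graded_of_even (ρ : ClRep n V) (hn : Even n) :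
    Module.finrank ℂ ρ.Graded = Module.finrank ℂ V := by
  rw [← ρ.finrank_half_add hn, ρ.toProd.finrank_eq, Module.finrank_prod]

theorem finrank_graded_of_odd (ρ : ClRep n V) (hn : Odd n) :
    Module.finrank ℂ ρ.Graded = 2 * Module.finrank ℂ V := by
  rw [ρ.toProd.finrank_eq, Module.finrank_prod, ρ.half_of_odd hn, ρ.half_of_odd hn, finrank_top,
    two_mul]

end ClRep

end

noncomputable section

/-! ### The Clifford algebras of the blocks -/

/-- The images of even elements commute with the images of vectors, if the images of vectors
commute or anticommute. -/
theorem commute_of_mem_even {n m : ℕ} {B : Type*} [Ring B] [Algebra ℝ B] (f : Cl n →ₐ[ℝ] B)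
    (g : Cl m →ₐ[ℝ] B)
    (h : (∀ v w, f (clVec v) * g (clVec w) = g (clVec w) * f (clVec v)) ∨
      ∀ v w, f (clVec v) * g (clVec w) = -(g (clVec w) * f (clVec v)))
    {a : Cl n} (ha : a ∈ CliffordAlgebra.even (negEuclid n)) (b : Cl m) :
    Commute (f a) (g b) := by
  refine CliffordAlgebra.even_induction (Q := negEuclid n)
    (motive := fun a _ => Commute (f a) (g b)) ?_ ?_ ?_ a ha
  · intro r
    rw [AlgHom.commutes]
    exact Algebra.commute_algebraMap_left r _
  · intro x y _ _ hx hy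
    rw [map_add]
    exact hx.add_left hy
  · intro v w x _ hx
    rw [map_mul]
    refine Commute.mul_left ?_ hx
    clear hx
    induction b using CliffordAlgebra.induction with
    | algebraMap r =>
      rw [AlgHom.commutes]
      exact (Algebra.commute_algebraMap_left r _).symm
    | ι u =>
      rw [map_mul, commute_iff_eq]
      rcases h with h | h
      · rw [mul_assoc, h w u, ← mul_assoc, h v u, mul_assoc]
      · rw [mul_assoc, h w u, mul_neg, ← mul_assoc, h v u, neg_mul, neg_neg, mul_assoc]
    | mul x y hx hy => rw [map_mul g]; exact hx.mul_right hy
    | add x y hx hy => rw [map_add]; exact hx.add_right hy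

section Blocks

variable {N : ℕ} {D : Fin N → ℕ}

/-- The inclusion of the block number `i`. -/
def blockVec (i : Fin N) : (Fin (D i) → ℝ) →ₗ[ℝ] (Fin (∑ i, D i) → ℝ) where
  toFun v k := (Pi.single i v : ∀ j, Fin (D j) → ℝ) (finSigmaFinEquiv.symm k).1
    (finSigmaFinEquiv.symm k).2
  map_add' v w := by ext k; simp [Pi.single_add]
  map_smul' r v := by ext k; simp [Pi.single_smul]

theorem blockVec_apply (i j : Fin N) (v : Fin (D i) → ℝ) (a : Fin (D j)) :
    blockVec i v (finSigmaFinEquiv ⟨j, a⟩) = (Pi.single i v : ∀ j, Fin (D j) → ℝ) j a := by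
  -- Generalizing the pair permits substitution in an expression whose type depends on its first
  -- component.
  have h : ∀ p : Σ j, Fin (D j), p = ⟨j, a⟩ →
      (Pi.single i v : ∀ j, Fin (D j) → ℝ) p.1 p.2 = (Pi.single i v : ∀ j, Fin (D j) → ℝ) j a := by
    rintro _ rfl
    rfl
  exact h _ (Equiv.symm_apply_apply _ _)

theorem sum_block {A : Type*} [AddCommMonoid A] (f : Fin (∑ i, D i) → A) :
    ∑ k, f k = ∑ i, ∑ a, f (finSigmaFinEquiv ⟨i, a⟩) := by
  rw [← Equiv.sum_comp finSigmaFinEquiv, Fintype.sum_sigma]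

theorem blockVec_single (i : Fin N) (a : Fin (D i)) :
    blockVec i (Pi.single a 1) = Pi.single (finSigmaFinEquiv ⟨i, a⟩) 1 := by
  ext k
  obtain ⟨⟨j, b⟩, rfl⟩ := finSigmaFinEquiv.surjective k
  rw [blockVec_apply]
  by_cases hij : j = i
  · subst hij
    by_cases hab : b = a
    · subst hab; simp
    · simp [hab]
  · simp [hij]

/-- The inclusion of the block number `i`, as an isometry. -/
def blockIsometry (i : Fin N) : negEuclid (D i) →qᵢ negEuclid (∑ i, D i) where
  toLinearMap := blockVec i
  map_app' v := by
    change negEuclid _ (blockVec i v) = _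
    rw [negEuclid_apply, negEuclid_apply, sum_block, Finset.sum_eq_single i]
    · simp [blockVec_apply]
    · intro j _ hj
      simp [blockVec_apply, hj]
    · simp

/-- The inclusion of the Clifford algebra of the block number `i`. -/
def embCl (i : Fin N) : Cl (D i) →ₐ[ℝ] Cl (∑ i, D i) :=
  CliffordAlgebra.map (blockIsometry i)

theorem embCl_clVec (i : Fin N) (v : Fin (D i) → ℝ) :
    embCl i (clVec v) = clVec (blockVec i v) :=
  CliffordAlgebra.map_apply_ι _ _

theorem embCl_clE (i : Fin N) (a : Fin (D i)) :
    embCl i (clE a) = clE (finSigmaFinEquiv ⟨i, a⟩) := by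
  rw [embCl_clVec, blockVec_single]

theorem embCl_anticomm {i j : Fin N} (hij : i ≠ j) (v : Fin (D i) → ℝ) (w : Fin (D j) → ℝ) :
    embCl i (clVec v) * embCl j (clVec w) = -(embCl j (clVec w) * embCl i (clVec v)) := by
  have h : ∀ (a : Fin (D i)) (b : Fin (D j)), clE (finSigmaFinEquiv ⟨i, a⟩) * clE (finSigmaFinEquiv ⟨j, b⟩) =
      -(clE (finSigmaFinEquiv ⟨j, b⟩) * clE (finSigmaFinEquiv ⟨i, a⟩)) := fun a b =>
    ClRep.clE_sq_swap _ _ fun h => hij (congrArg Sigma.fst (finSigmaFinEquiv.injective h))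
  rw [clVec_eq_sum v, clVec_eq_sum w]
  simp only [map_sum, map_smul, embCl_clE, Finset.sum_mul, Finset.mul_sum, smul_mul_assoc,
    mul_smul_comm, Finset.smul_sum]
  rw [Finset.sum_comm, ← Finset.sum_neg_distrib]
  refine Finset.sum_congr rfl fun b _ => ?_
  rw [← Finset.sum_neg_distrib]
  refine Finset.sum_congr rfl fun a _ => ?_
  rw [h, smul_neg, smul_neg, smul_comm]

theorem commute_embCl {i j : Fin N} (hij : i ≠ j) {a : Cl (D i)}
    (ha : a ∈ CliffordAlgebra.even (negEuclid (D i))) (b : Cl (D j)) :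
    Commute (embCl i a) (embCl j b) :=
  commute_of_mem_even _ _ (Or.inr fun v w => embCl_anticomm hij v w) ha b

end Blocks

/-! ### Generators of even number -/

/-- Generators of the Clifford algebra (in even dimension) or its even part (in odd dimension). -/
def pauliGen (n : ℕ) (a : Fin (2 * (n / 2))) : Cl n :=
  if h : Even n then clE (a.castLE (by omega))
  else clE (a.castLE (by omega)) * clE ⟨n - 1, by
    rw [Nat.not_even_iff_odd] at h; have := h.pos; omega⟩

theorem pauliGen_mem_even {n : ℕ} (hn : ¬ Even n) (a : Fin (2 * (n / 2))) :
    pauliGen n a ∈ CliffordAlgebra.even (negEuclid n) := by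
  rw [pauliGen, dif_neg hn]
  exact CliffordAlgebra.ι_mul_ι_mem_evenOdd_zero _ _ _

/-- In odd dimension, with l the last basis vector, (eₐl)(e_bl) = eₐe_b because l anticommutes with
e_b and squares to `-1`; so the products eₐl satisfy the relations of the eₐ. -/
theorem isPauliSystem_pauliGen (n : ℕ) : IsPauliSystem (pauliGen n) fun _ => () := by
  by_cases hn : Even n
  · have : pauliGen n = fun a => clE (a.castLE (by omega)) := by
      funext a
      rw [pauliGen, dif_pos hn]
    rw [this]
    exact isPauliSystem_clE.comp_injective _ (Fin.castLE_injective _)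
  · have hpos : 0 < n := (Nat.not_even_iff_odd.1 hn).pos
    have hodd := Nat.odd_iff.1 (Nat.not_even_iff_odd.1 hn)
    let e : Fin (2 * (n / 2)) → Cl n := fun a => clE (a.castLE (by omega))
    let l : Cl n := clE ⟨n - 1, by omega⟩
    have hg : pauliGen n = fun a => e a * l := by
      funext a
      rw [pauliGen, dif_neg hn]
    have hl : l * l = -1 := clE_mul_self _
    have hel : ∀ a, l * e a = -(e a * l) := fun a => by
      refine ClRep.clE_sq_swap _ _ fun h => ?_
      have := congrArg Fin.val h
      simp only [Fin.val_castLE] at this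
      omega
    have hmul : ∀ a b, e a * l * (e b * l) = e a * e b := fun a b => by
      rw [mul_assoc, ← mul_assoc l, hel, neg_mul, mul_assoc, hl]
      simp
    rw [hg]
    refine ⟨fun a => ?_, fun a b hab _ => ?_, fun a b h => absurd rfl h⟩
    · rw [hmul]; exact clE_mul_self _
    · rw [hmul, hmul]
      exact ClRep.clE_sq_swap _ _ fun h => hab (Fin.castLE_injective _ h)

/-- An operator that intertwines the generators also intertwines products of two vectors. In odd
dimension a product eₐe_b equals -(eₐl)(l e_b), with l the last basis vector. -/
theorem clVec_mul_clVec_mem_adjoin {n : ℕ} (v w : Fin n → ℝ) :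
    clVec v * clVec w ∈ Algebra.adjoin ℝ (Set.range (pauliGen n)) := by
  suffices h : ∀ a b : Fin n, clE a * clE b ∈ Algebra.adjoin ℝ (Set.range (pauliGen n)) by
    rw [clVec_eq_sum v, clVec_eq_sum w, Finset.sum_mul]
    refine sum_mem fun a _ => ?_
    rw [Finset.mul_sum]
    refine sum_mem fun b _ => ?_
    rw [smul_mul_smul_comm]
    exact Subalgebra.smul_mem _ (h a b) _
  have hmem : ∀ a, pauliGen n a ∈ Algebra.adjoin ℝ (Set.range (pauliGen n)) := fun a =>
    Algebra.subset_adjoin (Set.mem_range_self a)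
  intro a b
  by_cases hn : Even n
  · have h : ∀ a : Fin n, clE a ∈ Algebra.adjoin ℝ (Set.range (pauliGen n)) := fun a => by
      have hlt : a.1 < 2 * (n / 2) := by
        have := Nat.even_iff.1 hn
        omega
      have := hmem ⟨a, hlt⟩
      rwa [pauliGen, dif_pos hn] at this
    exact mul_mem (h a) (h b)
  · have hpos : 0 < n := (Nat.not_even_iff_odd.1 hn).pos
    have hodd := Nat.odd_iff.1 (Nat.not_even_iff_odd.1 hn)
    let o : Fin n := ⟨n - 1, by omega⟩
    have hleft : ∀ a, clE a * clE o ∈ Algebra.adjoin ℝ (Set.range (pauliGen n)) := fun a => by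
      by_cases ha : a = o
      · rw [ha, clE_mul_self]
        exact neg_mem (one_mem _)
      · have hlt : a.1 < 2 * (n / 2) := by
          have : a.1 ≠ n - 1 := fun h => ha (Fin.ext h)
          omega
        have := hmem ⟨a, hlt⟩
        rwa [pauliGen, dif_neg hn] at this
    have hright : ∀ b, clE o * clE b ∈ Algebra.adjoin ℝ (Set.range (pauliGen n)) := fun b => by
      by_cases hb : o = b
      · exact hb ▸ hleft o
      · rw [ClRep.clE_sq_swap _ _ hb]
        exact neg_mem (hleft b)
    have hab : clE a * clE b = -(clE a * clE o * (clE o * clE b)) := by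
      rw [mul_assoc, ← mul_assoc (clE o), clE_mul_self]
      simp
    rw [hab]
    exact neg_mem (mul_mem (hleft a) (hright b))

/-! ### Modules over several Clifford algebras -/

/-- Representations of Clifford algebras on the same space, such that vectors from different ones
either always commute or always anticommute, and anticommute if both dimensions are even. -/
structure IsBlockSystem {N : ℕ} {D : Fin N → ℕ} {B : Type*} [Ring B] [Algebra ℝ B]
    (η : ∀ i, Cl (D i) →ₐ[ℝ] B) : Prop where
  sign : ∀ i j, i ≠ j →
    (∀ v w, η i (clVec v) * η j (clVec w) = η j (clVec w) * η i (clVec v)) ∨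
      ∀ v w, η i (clVec v) * η j (clVec w) = -(η j (clVec w) * η i (clVec v))
  anti : ∀ i j, i ≠ j → Even (D i) → Even (D j) → ∀ v w,
    η i (clVec v) * η j (clVec w) = -(η j (clVec w) * η i (clVec v))

/-- The class of the generators of the block number `i`. -/
def blockClass {N : ℕ} (D : Fin N → ℕ) (i : Fin N) : Option (Fin N) :=
  if Even (D i) then none else some i

/-- Generators from an odd dimensional block are even, so they commute with every other block
whichever sign its vectors have. Only the even dimensional blocks anticommute among each other, and
they share the class `none`. -/
theorem IsBlockSystem.isPauliSystem {N : ℕ} {D : Fin N → ℕ} {B : Type*} [Ring B] [Algebra ℝ B]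
    {η : ∀ i, Cl (D i) →ₐ[ℝ] B} (h : IsBlockSystem η) :
    IsPauliSystem (fun s : Σ i, Fin (2 * (D i / 2)) => η s.1 (pauliGen _ s.2))
      fun s => blockClass D s.1 := by
  have hsys := fun i => (isPauliSystem_pauliGen (D i)).map (η i : Cl (D i) →+* B)
  refine ⟨fun s => (hsys s.1).sq s.2, ?_, ?_⟩
  · rintro ⟨i, a⟩ ⟨j, b⟩ hst hcl
    by_cases hij : i = j
    · subst hij
      exact (hsys i).anti a b (fun hab => hst (by rw [hab])) rfl
    · simp only [blockClass] at hcl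
      split_ifs at hcl with h1 h2 h2
      · simp only [pauliGen, dif_pos h1, dif_pos h2]
        exact h.anti i j hij h1 h2 _ _
      · exact absurd (Option.some.inj hcl) hij
  · rintro ⟨i, a⟩ ⟨j, b⟩ hcl
    have hij : i ≠ j := by
      rintro rfl
      exact hcl rfl
    simp only [blockClass] at hcl
    by_cases h1 : Even (D i)
    · by_cases h2 : Even (D j)
      · simp [h1, h2] at hcl
      · exact (commute_of_mem_even (η j) (η i) (h.sign j i hij.symm) (pauliGen_mem_even h2 b) _).symm
    · exact commute_of_mem_even (η i) (η j) (h.sign i j hij) (pauliGen_mem_even h1 a) _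

theorem even_card_blockClass {N : ℕ} (D : Fin N → ℕ) (o : Option (Fin N)) :
    Even (Finset.univ.filter
      fun s : Σ i, Fin (2 * (D i / 2)) => blockClass D s.1 = o).card := by
  have h : (Finset.univ.filter fun s : Σ i, Fin (2 * (D i / 2)) => blockClass D s.1 = o) =
      (Finset.univ.filter fun i => blockClass D i = o).sigma fun _ => Finset.univ := by
    ext s
    simp
  rw [h, Finset.card_sigma]
  refine Finset.even_sum _ fun i _ => ?_
  simp

/-- Two block systems of the same dimension have an isomorphism that is compatible with the products
of two vectors from the same block. -/
theorem IsBlockSystem.exists_intertwiner {N : ℕ} {D : Fin N → ℕ} {Z : Type*} {Z' : Type*}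
    [AddCommGroup Z] [AddCommGroup Z'] [Module ℂ Z] [Module ℂ Z'] [FiniteDimensional ℂ Z]
    [FiniteDimensional ℂ Z'] {η : ∀ i, Cl (D i) →ₐ[ℝ] Module.End ℂ Z}
    {η' : ∀ i, Cl (D i) →ₐ[ℝ] Module.End ℂ Z'} (h : IsBlockSystem η) (h' : IsBlockSystem η')
    (hd : Module.finrank ℂ Z = Module.finrank ℂ Z') :
    ∃ Ψ : Z ≃ₗ[ℂ] Z', ∀ i v w ξ,
      Ψ (η i (clVec v * clVec w) ξ) = η' i (clVec v * clVec w) (Ψ ξ) := by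
  obtain ⟨Ψ, hΨ⟩ := h.isPauliSystem.exists_intertwiner h'.isPauliSystem
    (even_card_blockClass D) hd
  refine ⟨Ψ, fun i v w => ?_⟩
  have hmem := clVec_mul_clVec_mem_adjoin v w
  generalize clVec v * clVec w = y at hmem
  induction hmem using Algebra.adjoin_induction with
  | mem x hx =>
    obtain ⟨a, rfl⟩ := hx
    exact hΨ ⟨i, a⟩
  | algebraMap r =>
    intro ξ
    rw [AlgHom.commutes, AlgHom.commutes, Module.algebraMap_end_apply,
      Module.algebraMap_end_apply, ← Complex.coe_smul, map_smul, Complex.coe_smul]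
  | add x y _ _ hx hy => intro ξ; simp [hx, hy]
  | mul x y _ _ hx hy => intro ξ; simp [hx, hy]

end

noncomputable section

/-! ### Operators on tensor products -/

section Tensor

variable {ι : Type*} {s : ι → Type*} [∀ i, AddCommGroup (s i)] [∀ i, Module ℂ (s i)]

/-- Subspaces have complements, and left inverses of the inclusions can be tensored. -/
theorem mapIncl_injective (p : ∀ i, Submodule ℂ (s i)) :
    Function.Injective (PiTensorProduct.mapIncl p) := by
  choose r hr using fun i => (p i).subtype.exists_leftInverse_of_injective (p i).ker_subtype
  refine Function.LeftInverse.injective (g := PiTensorProduct.map r) fun t => ?_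
  rw [PiTensorProduct.mapIncl, ← LinearMap.comp_apply, ← PiTensorProduct.map_comp]
  simp [hr]

variable [DecidableEq ι]

/-- The action of the endomorphisms of one factor on a tensor product. -/
def singleMap (i : ι) : Module.End ℂ (s i) →ₐ[ℂ] Module.End ℂ (⨂[ℂ] i, s i) :=
  AlgHom.ofLinearMap ((PiTensorProduct.mapMultilinear ℂ s s).toLinearMap 1 i)
    (by
      simp only [MultilinearMap.toLinearMap_apply, PiTensorProduct.mapMultilinear_apply]
      rw [show (1 : Module.End ℂ (s i)) = (1 : ∀ i, Module.End ℂ (s i)) i from rfl,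
        Function.update_eq_self]
      exact PiTensorProduct.map_one)
    (fun f g => by
      simp only [MultilinearMap.toLinearMap_apply, PiTensorProduct.mapMultilinear_apply]
      rw [← PiTensorProduct.map_mul]
      congr 1
      funext j
      by_cases hj : j = i
      · subst hj; simp
      · simp [hj])

theorem singleMap_apply (i : ι) (f : Module.End ℂ (s i)) :
    singleMap i f = PiTensorProduct.map (Function.update (fun _ => 1) i f) := rfl

/-- The reason why sign conventions do not matter: involutions on the other factors cancel in a
product of two operators attached to the same factor. -/
theorem map_update_mul_map_update {b : ∀ j, Module.End ℂ (s j)} (hb : ∀ j, b j * b j = 1) (i : ι)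
    (f g : Module.End ℂ (s i)) :
    (PiTensorProduct.map (Function.update b i f) * PiTensorProduct.map (Function.update b i g) :
      Module.End ℂ (⨂[ℂ] i, s i)) = singleMap i (f * g) := by
  rw [singleMap_apply, ← PiTensorProduct.map_mul]
  congr 1
  funext j
  by_cases hj : j = i
  · subst hj; simp
  · simp [hj, hb]

theorem map_eq_neg_map {F G : ∀ j, Module.End ℂ (s j)} (i : ι) (hi : F i = -G i)
    (h : ∀ j, j ≠ i → F j = G j) : PiTensorProduct.map F = -PiTensorProduct.map G := by
  have hF : F = Function.update G i ((-1 : ℂ) • G i) := by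
    funext j
    by_cases hj : j = i
    · subst hj; simp [hi]
    · simp [hj, h]
  rw [hF, PiTensorProduct.map_update_smul, Function.update_eq_self]
  exact neg_one_smul ℂ (PiTensorProduct.map G)

theorem finrank_piTensorProduct [Fintype ι] [∀ i, FiniteDimensional ℂ (s i)] :
    Module.finrank ℂ (⨂[ℂ] i, s i) = ∏ i, Module.finrank ℂ (s i) := by
  rw [Module.finrank_eq_card_basis (Basis.piTensorProduct fun i => Module.finBasis ℂ (s i)),
    Fintype.card_pi]
  simp

end Tensor

/-! ### Graded spinors -/

namespace ClRep

variable {n : ℕ} {V : Type v} [NormedAddCommGroup V] [NormedSpace ℂ V] (ρ : ClRep n V)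

variable {ρ} in
theorem graded_ext {ξ η : ρ.Graded} (h₁ : ((ρ.toProd ξ).1 : V) = (ρ.toProd η).1)
    (h₂ : ((ρ.toProd ξ).2 : V) = (ρ.toProd η).2) : ξ = η :=
  ρ.toProd.injective (Prod.ext (Subtype.ext h₁) (Subtype.ext h₂))

theorem gradedVec_fst (v : Fin n → ℝ) (ξ : ρ.Graded) :
    ((ρ.toProd (ρ.gradedVec v ξ)).1 : V) = ρ (clVec v) (ρ.toProd ξ).2 := rfl

theorem gradedVec_snd (v : Fin n → ℝ) (ξ : ρ.Graded) :
    ((ρ.toProd (ρ.gradedVec v ξ)).2 : V) = ρ (clVec v) (ρ.toProd ξ).1 := rfl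

theorem parity_fst (ξ : ρ.Graded) : ((ρ.toProd (ρ.parity ξ)).1 : V) = (ρ.toProd ξ).1 := rfl

theorem parity_snd (ξ : ρ.Graded) : ((ρ.toProd (ρ.parity ξ)).2 : V) = -(ρ.toProd ξ).2 := rfl

theorem toProd_neg (ξ : ρ.Graded) : ρ.toProd (-ξ) = -ρ.toProd ξ := map_neg _ _

theorem parity_mul_self : (ρ.parity * ρ.parity : Module.End ℂ ρ.Graded) = 1 := by
  refine LinearMap.ext fun ξ => graded_ext ?_ ?_
  · rw [Module.End.mul_apply, parity_fst, parity_fst, Module.End.one_apply]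
  · rw [Module.End.mul_apply, parity_snd, parity_snd, neg_neg, Module.End.one_apply]

theorem gradedVec_mul_parity (v : Fin n → ℝ) :
    (ρ.gradedVec v * ρ.parity : Module.End ℂ ρ.Graded) = -(ρ.parity * ρ.gradedVec v) := by
  refine LinearMap.ext fun ξ => graded_ext ?_ ?_
  · rw [LinearMap.neg_apply, toProd_neg, Prod.fst_neg, Submodule.coe_neg, Module.End.mul_apply,
      Module.End.mul_apply, gradedVec_fst, parity_snd, parity_fst, gradedVec_fst, map_neg]
  · rw [LinearMap.neg_apply, toProd_neg, Prod.snd_neg, Submodule.coe_neg, Module.End.mul_apply,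
      Module.End.mul_apply, gradedVec_snd, parity_fst, parity_snd, gradedVec_snd, neg_neg]

/-- The action of vectors on graded spinors, as a linear map. -/
def gradedLin : (Fin n → ℝ) →ₗ[ℝ] Module.End ℂ ρ.Graded where
  toFun := ρ.gradedVec
  map_add' v w := by
    refine LinearMap.ext fun ξ => graded_ext ?_ ?_ <;>
      simp [gradedVec_fst, gradedVec_snd, map_add]
  map_smul' r v := by
    refine LinearMap.ext fun ξ => graded_ext ?_ ?_ <;>
      simp [gradedVec_fst, gradedVec_snd, map_smul, ← Complex.coe_smul]

theorem gradedLin_apply (v : Fin n → ℝ) : ρ.gradedLin v = ρ.gradedVec v := rfl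

theorem gradedVec_mul_self (v : Fin n → ℝ) :
    (ρ.gradedVec v * ρ.gradedVec v : Module.End ℂ ρ.Graded) =
      algebraMap ℝ _ (negEuclid n v) := by
  have h : ∀ ξ, ρ (clVec v) (ρ (clVec v) ξ) = ((negEuclid n v : ℝ) : ℂ) • ξ := fun ξ => by
    rw [← Module.End.mul_apply, ← map_mul, CliffordAlgebra.ι_sq_scalar, AlgHom.commutes,
      Module.algebraMap_end_apply, Complex.coe_smul]
  have hs : ∀ ξ : ρ.Graded, algebraMap ℝ (Module.End ℂ ρ.Graded) (negEuclid n v) ξ =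
      ((negEuclid n v : ℝ) : ℂ) • ξ := fun ξ => by
    rw [Module.algebraMap_end_apply, Complex.coe_smul]
  refine LinearMap.ext fun ξ => graded_ext ?_ ?_
  · rw [Module.End.mul_apply, gradedVec_fst, gradedVec_snd, h, hs, map_smul, Prod.smul_fst,
      Submodule.coe_smul]
  · rw [Module.End.mul_apply, gradedVec_snd, gradedVec_fst, h, hs, map_smul, Prod.smul_snd,
      Submodule.coe_smul]

/-- The representation of the Clifford algebra on graded spinors. -/
def gradedRep : Cl n →ₐ[ℝ] Module.End ℂ ρ.Graded :=
  CliffordAlgebra.lift (negEuclid n) ⟨ρ.gradedLin, ρ.gradedVec_mul_self⟩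

theorem gradedRep_clVec (v : Fin n → ℝ) : ρ.gradedRep (clVec v) = ρ.gradedVec v :=
  CliffordAlgebra.lift_ι_apply _ _ _

/-- Even elements act on both halves. -/
theorem gradedRep_of_mem_even {a : Cl n} (ha : a ∈ CliffordAlgebra.even (negEuclid n))
    (ξ : ρ.Graded) : ((ρ.toProd (ρ.gradedRep a ξ)).1 : V) = ρ a (ρ.toProd ξ).1 ∧
      ((ρ.toProd (ρ.gradedRep a ξ)).2 : V) = ρ a (ρ.toProd ξ).2 := by
  refine CliffordAlgebra.even_induction (Q := negEuclid n)
    (motive := fun a _ => ((ρ.toProd (ρ.gradedRep a ξ)).1 : V) = ρ a (ρ.toProd ξ).1 ∧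
      ((ρ.toProd (ρ.gradedRep a ξ)).2 : V) = ρ a (ρ.toProd ξ).2) ?_ ?_ ?_ a ha
  · intro r
    rw [AlgHom.commutes, AlgHom.commutes, Module.algebraMap_end_apply,
      ← Complex.coe_smul, map_smul]
    exact ⟨rfl, rfl⟩
  · intro x y _ _ hx hy
    simp only [map_add, LinearMap.add_apply, Prod.fst_add, Prod.snd_add, Submodule.coe_add, hx, hy,
      and_self]
  · intro v w x _ hx
    change _ = ρ (clVec v * clVec w * x) _ ∧ _ = ρ (clVec v * clVec w * x) _
    rw [show CliffordAlgebra.ι (negEuclid n) v * CliffordAlgebra.ι (negEuclid n) w * x =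
      clVec v * clVec w * x from rfl]
    simp only [map_mul, Module.End.mul_apply, gradedRep_clVec, gradedVec_fst, gradedVec_snd, hx,
      and_self]

theorem gradedVec_mem_diagonal (v : Fin n → ℝ) {ξ : ρ.Graded} (hξ : ξ ∈ ρ.diagonal) :
    ρ.gradedVec v ξ ∈ ρ.diagonal := by
  change ((ρ.toProd _).1 : V) = (ρ.toProd _).2
  rw [gradedVec_fst, gradedVec_snd, show ((ρ.toProd ξ).1 : V) = (ρ.toProd ξ).2 from hξ]

end ClRep

end

/-! ### The action of the blocks on the standard fibre of `S`, and its dimension -/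

noncomputable section

section FiberS

variable {N : ℕ} {D : Fin N → ℕ} {V : Fin N → Type v} [∀ i, NormedAddCommGroup (V i)]
  [∀ i, NormedSpace ℂ (V i)] (ρ : ∀ i, ClRep (D i) (V i))

/-- The parities of the even dimensional factors in front of the factor number `i`. -/
def evenParity (i j : Fin N) : Module.End ℂ (ρ j).Graded :=
  if j < i ∧ Even (D j) then (ρ j).parity else 1

theorem evenParity_mul_self (i j : Fin N) : evenParity ρ i j * evenParity ρ i j = 1 := by
  rw [evenParity]
  split_ifs
  · exact (ρ j).parity_mul_self
  · exact one_mul 1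

theorem evenParity_comm (i j k : Fin N) :
    evenParity ρ i k * evenParity ρ j k = evenParity ρ j k * evenParity ρ i k := by
  rw [evenParity, evenParity]
  split_ifs <;> simp

/-- The action of the vectors of the block number `i`, with signs from the parities of the even
dimensional factors in front. -/
def blockAction (i : Fin N) (v : Fin (D i) → ℝ) : Module.End ℂ (⨂[ℂ] i, (ρ i).Graded) :=
  PiTensorProduct.map (Function.update (evenParity ρ i) i ((ρ i).gradedVec v))

theorem blockAction_mul (i : Fin N) (v w : Fin (D i) → ℝ) :
    blockAction ρ i v * blockAction ρ i w =
      singleMap i ((ρ i).gradedVec v * (ρ i).gradedVec w) :=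
  map_update_mul_map_update (evenParity_mul_self ρ i) i _ _

/-- A sign arises only in the factor `i`, where a vector of that block meets the parity that
precedes block `j`. This parity is present exactly if `D i` is even. -/
theorem blockAction_swap {i j : Fin N} (hij : i < j) (v : Fin (D i) → ℝ) (w : Fin (D j) → ℝ) :
    blockAction ρ i v * blockAction ρ j w =
      if Even (D i) then -(blockAction ρ j w * blockAction ρ i v)
      else blockAction ρ j w * blockAction ρ i v := by
  have hj : evenParity ρ i j = 1 := if_neg fun h => absurd (h.1.trans hij) (lt_irrefl _)
  simp only [blockAction]
  rw [← PiTensorProduct.map_mul, ← PiTensorProduct.map_mul]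
  split_ifs with hi
  · have hi' : evenParity ρ j i = (ρ i).parity := if_pos ⟨hij, hi⟩
    refine map_eq_neg_map i ?_ fun k hk => ?_
    · rw [Function.update_self, Function.update_of_ne hij.ne, hi']
      exact (ρ i).gradedVec_mul_parity v
    · rw [Function.update_of_ne hk]
      by_cases hkj : k = j
      · subst hkj
        rw [hj, Function.update_self, one_mul, mul_one]
      · rw [Function.update_of_ne hkj, evenParity_comm]
  · have hi' : evenParity ρ j i = 1 := if_neg fun h => hi h.2
    congr 1
    funext k
    by_cases hk : k = i
    · subst hk
      rw [Function.update_self, Function.update_of_ne hij.ne, hi', one_mul, mul_one]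
    · rw [Function.update_of_ne hk]
      by_cases hkj : k = j
      · subst hkj
        rw [hj, Function.update_self, one_mul, mul_one]
      · rw [Function.update_of_ne hkj, evenParity_comm]

/-- Vectors map a diagonal to itself, whereas the parity sends (ξ, ξ) to (ξ, -ξ). The factors in `K`
are odd dimensional, and `blockAction` puts no parity on them. -/
theorem blockAction_mem_fiberS {K : Finset (Fin N)}
    (hK : K ⊆ Finset.univ.filter fun i => Odd (D i)) (i : Fin N) (v : Fin (D i) → ℝ) :
    ∀ t ∈ fiberS ρ K, blockAction ρ i v t ∈ fiberS ρ K := by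
  suffices h : fiberS ρ K ≤ (fiberS ρ K).comap (blockAction ρ i v) from fun t ht => h ht
  refine Submodule.span_le.2 ?_
  rintro _ ⟨ξ, hξ, rfl⟩
  refine Submodule.subset_span ⟨fun j => Function.update (evenParity ρ i) i ((ρ i).gradedVec v) j
    (ξ j), fun k hk => ?_, (PiTensorProduct.map_tprod _ _).symm⟩
  by_cases hki : k = i
  · subst hki
    simp only [Function.update_self]
    exact (ρ k).gradedVec_mem_diagonal v (hξ k hk)
  · have hodd : ¬ Even (D k) := Nat.not_even_iff_odd.2 (Finset.mem_filter.1 (hK hk)).2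
    simp only [Function.update_of_ne hki, evenParity, if_neg fun h : k < i ∧ Even (D k) => hodd h.2]
    exact hξ k hk

section Rep

variable {K : Finset (Fin N)} (hK : K ⊆ Finset.univ.filter fun i => Odd (D i))

/-- The action of the vectors of the block number `i` on the standard fibre of `S`. -/
def fiberSLin (i : Fin N) : (Fin (D i) → ℝ) →ₗ[ℝ] Module.End ℂ (fiberS ρ K) where
  toFun v := (blockAction ρ i v).restrict (blockAction_mem_fiberS ρ hK i v)
  map_add' v w := by
    refine LinearMap.ext fun t => Subtype.ext ?_
    change blockAction ρ i (v + w) t = blockAction ρ i v t + blockAction ρ i w t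
    rw [← LinearMap.add_apply, blockAction, blockAction, blockAction, ← (ρ i).gradedLin_apply,
      map_add, PiTensorProduct.map_update_add]
    rfl
  map_smul' r v := by
    refine LinearMap.ext fun t => Subtype.ext ?_
    have h : (ρ i).gradedVec (r • v) = (r : ℂ) • (ρ i).gradedVec v := by
      rw [← (ρ i).gradedLin_apply, map_smul, Complex.coe_smul]
      rfl
    change blockAction ρ i (r • v) t = (r : ℂ) • blockAction ρ i v t
    rw [blockAction, h, PiTensorProduct.map_update_smul]
    rfl

theorem fiberSLin_coe (i : Fin N) (v : Fin (D i) → ℝ) (t : fiberS ρ K) :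
    (fiberSLin ρ hK i v t : ⨂[ℂ] i, (ρ i).Graded) = blockAction ρ i v t := rfl

/-- The representation of the Clifford algebra of the block number `i` on the standard fibre
of `S`. -/
def fiberSRep (i : Fin N) : Cl (D i) →ₐ[ℝ] Module.End ℂ (fiberS ρ K) :=
  CliffordAlgebra.lift (negEuclid (D i)) ⟨fiberSLin ρ hK i, fun v => by
    refine LinearMap.ext fun t => Subtype.ext ?_
    rw [Module.End.mul_apply, fiberSLin_coe, fiberSLin_coe, ← Module.End.mul_apply,
      blockAction_mul, (ρ i).gradedVec_mul_self, Module.algebraMap_end_apply,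
      Algebra.algebraMap_eq_smul_one, ← Complex.coe_smul, map_smul, map_one,
      ← Complex.coe_smul]
    rfl⟩

theorem fiberSRep_clVec (i : Fin N) (v : Fin (D i) → ℝ) :
    fiberSRep ρ hK i (clVec v) = fiberSLin ρ hK i v :=
  CliffordAlgebra.lift_ι_apply _ _ _

theorem isBlockSystem_fiberSRep : IsBlockSystem (B := Module.End ℂ (fiberS ρ K)) (fiberSRep ρ hK) := by
  have key : ∀ {i j : Fin N} (hij : i < j) (v : Fin (D i) → ℝ) (w : Fin (D j) → ℝ),
      fiberSRep ρ hK i (clVec v) * fiberSRep ρ hK j (clVec w) =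
      if Even (D i) then -(fiberSRep ρ hK j (clVec w) * fiberSRep ρ hK i (clVec v))
      else fiberSRep ρ hK j (clVec w) * fiberSRep ρ hK i (clVec v) := by
    intro i j hij v w
    rw [fiberSRep_clVec, fiberSRep_clVec]
    have := blockAction_swap ρ hij v w
    split_ifs at this ⊢ <;>
    exact LinearMap.ext fun t => Subtype.ext (LinearMap.congr_fun this t.1)
  have hswap : ∀ {a b : Module.End ℂ (fiberS ρ K)}, a = -b → b = -a := by
    rintro _ b rfl
    exact LinearMap.ext fun t => Subtype.ext (neg_neg (b t : ⨂[ℂ] i, (ρ i).Graded)).symm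
  refine ⟨fun i j hij => ?_, fun i j hij hi hj v w => ?_⟩
  · rcases lt_or_gt_of_ne hij with h | h
    · by_cases hi : Even (D i)
      · exact Or.inr fun v w => by rw [key h, if_pos hi]
      · exact Or.inl fun v w => by rw [key h, if_neg hi]
    · by_cases hj : Even (D j)
      · exact Or.inr fun v w => hswap ((key h w v).trans (if_pos hj))
      · exact Or.inl fun v w => by rw [key h w v, if_neg hj]
  · rcases lt_or_gt_of_ne hij with h | h
    · rw [key h, if_pos hi]
    · exact hswap ((key h w v).trans (if_pos hj))

end Rep

/-- The factors of the standard fibre of `S`. -/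
def factorS (K : Finset (Fin N)) (i : Fin N) : Submodule ℂ (ρ i).Graded :=
  if i ∈ K then (ρ i).diagonal else ⊤

theorem fiberS_eq_range (K : Finset (Fin N)) :
    fiberS ρ K = LinearMap.range (PiTensorProduct.mapIncl (factorS ρ K)) := by
  rw [PiTensorProduct.mapIncl, PiTensorProduct.map_range_eq_span_tprod, fiberS]
  congr 1
  ext t
  constructor
  · rintro ⟨ξ, hξ, rfl⟩
    refine ⟨fun i => ⟨ξ i, ?_⟩, rfl⟩
    rw [factorS]
    split_ifs with h
    · exact hξ i h
    · trivial
  · rintro ⟨ξ, rfl⟩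
    refine ⟨fun i => (ξ i : (ρ i).Graded), fun k hk => ?_, rfl⟩
    have := (ξ k).2
    simp only [factorS, if_pos hk] at this
    exact this

variable [∀ i, FiniteDimensional ℂ (V i)]

/-- The exponent of 2 is the sum of the [Dᵢ/2] plus one for each odd factor that is not
diagonalized. There are [N_o/2] of the latter, and ∑ Dᵢ = 2 ∑ [Dᵢ/2] + N_o. -/
theorem finrank_fiberS {K : Finset (Fin N)}
    (hK : K ⊆ Finset.univ.filter fun i => Odd (D i)) (hρ : ∀ i, (ρ i).IsSpinorModule)
    (hKcard : K.card = (Finset.univ.filter fun i => Odd (D i)).card -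
      (Finset.univ.filter fun i => Odd (D i)).card / 2) :
    Module.finrank ℂ (fiberS ρ K) = 2 ^ ((∑ i, D i) / 2) := by
  let O := Finset.univ.filter fun i => Odd (D i)
  rw [fiberS_eq_range, LinearMap.finrank_range_of_inj (mapIncl_injective _),
    finrank_piTensorProduct]
  -- A doubled spinor module of odd dimension has an extra factor 2, which its diagonal does not
  -- have; in even dimension the two halves add up to the module itself.
  have h1 : ∀ i, Module.finrank ℂ (factorS ρ K i) = 2 ^ (D i / 2 + if i ∈ O \ K then 1 else 0) := by
    intro i
    rw [factorS]
    by_cases hi : i ∈ K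
    · rw [if_pos hi, (ρ i).finrank_diagonal_of_odd (Finset.mem_filter.1 (hK hi)).2,
        (hρ i).finrank_eq, if_neg (by simp [hi]), add_zero]
    · rw [if_neg hi, finrank_top]
      by_cases hodd : Odd (D i)
      · rw [(ρ i).finrank_graded_of_odd hodd, (hρ i).finrank_eq, if_pos (by simp [O, hi, hodd]),
          pow_succ, mul_comm]
      · rw [(ρ i).finrank_graded_of_even (Nat.not_odd_iff_even.1 hodd), (hρ i).finrank_eq,
          if_neg (by simp [O, hodd]), add_zero]
  rw [Finset.prod_congr rfl fun i _ => h1 i, Finset.prod_pow_eq_pow_sum, Finset.sum_add_distrib]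
  congr 1
  have h2 : (∑ i, if i ∈ O \ K then 1 else 0) = O.card - K.card := by
    rw [← Finset.card_sdiff_of_subset hK, ← Finset.card_filter, Finset.filter_mem_eq_inter,
      Finset.univ_inter]
  have h3 : ∑ i, D i = 2 * ∑ i, D i / 2 + O.card := by
    rw [Finset.card_eq_sum_ones, Finset.sum_filter, Finset.mul_sum, ← Finset.sum_add_distrib]
    refine Finset.sum_congr rfl fun i _ => ?_
    split_ifs with h
    · have := Nat.odd_iff.1 h
      omega
    · have := Nat.even_iff.1 (Nat.not_odd_iff_even.1 h)
      omega
  rw [h2]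
  change K.card = O.card - O.card / 2 at hKcard
  omega

theorem isBlockSystem_embCl {B : Type*} [Ring B] [Algebra ℝ B] (f : Cl (∑ i, D i) →ₐ[ℝ] B) :
    IsBlockSystem fun i => f.comp (embCl i) := by
  have h : ∀ i j, i ≠ j → ∀ (v : Fin (D i) → ℝ) (w : Fin (D j) → ℝ),
      f.comp (embCl i) (clVec v) * f.comp (embCl j) (clVec w) =
        -(f.comp (embCl j) (clVec w) * f.comp (embCl i) (clVec v)) := by
    intro i j hij v w
    simp only [AlgHom.comp_apply]
    rw [← map_mul, embCl_anticomm hij, map_neg, map_mul]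
  exact ⟨fun i j hij => Or.inr (h i j hij), fun i j hij _ _ => h i j hij⟩

/-- A spinor module of the product is isomorphic to the standard fibre of `S`, compatibly with the
even parts of the Clifford algebras of the factors. -/
theorem exists_fiberS_equiv {K : Finset (Fin N)}
    (hK : K ⊆ Finset.univ.filter fun i => Odd (D i)) (hρ : ∀ i, (ρ i).IsSpinorModule)
    (hKcard : K.card = (Finset.univ.filter fun i => Odd (D i)).card -
      (Finset.univ.filter fun i => Odd (D i)).card / 2)
    {V' : Type w} [NormedAddCommGroup V'] [NormedSpace ℂ V'] [FiniteDimensional ℂ V']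
    (ρ' : ClRep (∑ i, D i) V') (hρ' : ρ'.IsSpinorModule) :
    ∃ Ψ : V' ≃ₗ[ℂ] fiberS ρ K, ∀ i, ∀ a ∈ CliffordAlgebra.even (negEuclid (D i)), ∀ ξ,
      (Ψ (ρ' (embCl i a) ξ) : ⨂[ℂ] i, (ρ i).Graded) =
        singleMap i ((ρ i).gradedRep a) (Ψ ξ : ⨂[ℂ] i, (ρ i).Graded) := by
  obtain ⟨Ψ, hΨ⟩ := (isBlockSystem_embCl ρ').exists_intertwiner (isBlockSystem_fiberSRep ρ hK)
    (hρ'.finrank_eq.trans (finrank_fiberS ρ hK hρ hKcard).symm)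
  refine ⟨Ψ, fun i a ha => ?_⟩
  refine CliffordAlgebra.even_induction (Q := negEuclid (D i))
    (motive := fun a _ => ∀ ξ, (Ψ (ρ' (embCl i a) ξ) : ⨂[ℂ] i, (ρ i).Graded) =
        singleMap i ((ρ i).gradedRep a) (Ψ ξ : ⨂[ℂ] i, (ρ i).Graded)) ?_ ?_ ?_ a ha
  · intro r ξ
    rw [AlgHom.commutes, AlgHom.commutes, AlgHom.commutes, Module.algebraMap_end_apply,
      ← Complex.coe_smul, map_smul, Algebra.algebraMap_eq_smul_one, ← Complex.coe_smul, map_smul,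
      map_one]
    rfl
  · intro x y _ _ hx hy ξ
    simp only [map_add, LinearMap.add_apply, Submodule.coe_add, hx, hy]
  · intro v w x _ hx ξ
    -- The parities in `blockAction` cancel in the product of the two vectors, so only the factor
    -- `i` is affected.
    have h := hΨ i v w (ρ' (embCl i x) ξ)
    have h' := congrArg (Subtype.val : fiberS ρ K → _) h
    rw [AlgHom.comp_apply, map_mul (fiberSRep ρ hK i), fiberSRep_clVec, fiberSRep_clVec,
      Module.End.mul_apply, fiberSLin_coe, fiberSLin_coe,
      ← Module.End.mul_apply (blockAction ρ i v), blockAction_mul, hx] at h'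
    change (Ψ (ρ' (embCl i (clVec v * clVec w * x)) ξ) : ⨂[ℂ] i, (ρ i).Graded) =
      singleMap i ((ρ i).gradedRep (clVec v * clVec w * x)) _
    rw [map_mul (embCl i), map_mul ρ', Module.End.mul_apply, h',
      map_mul (ρ i).gradedRep, map_mul (ρ i).gradedRep, (ρ i).gradedRep_clVec,
      (ρ i).gradedRep_clVec, map_mul (singleMap i) (_ * _), Module.End.mul_apply]

end FiberS

end

noncomputable section

/-! ### Lifting orthogonal maps to the Clifford algebra -/

section Twisted

variable {n : ℕ}

open CliffordAlgebra (involute)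

/-- The element `s` of the Clifford algebra covers the map that sends the standard basis vectors to
the elements `w a`, for the twisted adjoint representation. -/
def IsTwistedLift (w : Fin n → Cl n) (s : Cl n) : Prop :=
  ∀ a, s * clE a = w a * involute s

/-- The symmetrization with respect to one basis vector. -/
def twistStep (w : Fin n → Cl n) (a : Fin n) : Module.End ℝ (Cl n) :=
  (2⁻¹ : ℝ) • (1 - LinearMap.mulRight ℝ (clE a) ∘ₗ LinearMap.mulLeft ℝ (w a) ∘ₗ
    (involute (Q := negEuclid n)).toLinearMap)

theorem twistStep_apply (w : Fin n → Cl n) (a : Fin n) (y : Cl n) :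
    twistStep w a y = (2⁻¹ : ℝ) • (y - w a * involute y * clE a) := rfl

/-- The symmetrization with respect to all basis vectors. -/
def twistAvg (w : Fin n → Cl n) : Module.End ℝ (Cl n) :=
  ((List.finRange n).map (twistStep w)).prod

theorem half_smul_two (y : Cl n) : (2⁻¹ : ℝ) • (y + y) = y := by
  rw [← two_smul ℝ y, smul_smul]
  norm_num

/-- Left multiplication by a lift turns the symmetrization for `w` into that for the identity map,
which is computed on words below. -/
theorem IsTwistedLift.twistStep_mul {w : Fin n → Cl n} {s : Cl n} (hs : IsTwistedLift w s)
    (a : Fin n) (z : Cl n) : twistStep w a (s * z) = s * twistStep clE a z := by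
  rw [twistStep_apply, twistStep_apply, map_mul, ← mul_assoc (w a), ← hs a, mul_smul_comm, mul_sub]
  simp only [mul_assoc]

theorem IsTwistedLift.twistAvg_mul {w : Fin n → Cl n} {s : Cl n} (hs : IsTwistedLift w s)
    (z : Cl n) : twistAvg w (s * z) = s * twistAvg clE z := by
  simp only [twistAvg]
  induction List.finRange n with
  | nil => simp
  | cons a l ih =>
    rw [List.map_cons, List.prod_cons, List.map_cons, List.prod_cons, Module.End.mul_apply,
      Module.End.mul_apply, ih, hs.twistStep_mul]

theorem IsTwistedLift.twistAvg_self {w : Fin n → Cl n} {s : Cl n} (hs : IsTwistedLift w s) :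
    twistAvg w s = s := by
  simp only [twistAvg]
  induction List.finRange n with
  | nil => simp
  | cons a l ih =>
    rw [List.map_cons, List.prod_cons, Module.End.mul_apply, ih, twistStep_apply, ← hs a, mul_assoc,
      clE_mul_self, mul_neg, mul_one, sub_neg_eq_add, half_smul_two]

theorem involute_word (l : List (Fin n)) :
    involute (l.map clE).prod = (-1 : Cl n) ^ l.length * (l.map clE).prod := by
  induction l with
  | nil => simp
  | cons a l ih =>
    rw [List.map_cons, List.prod_cons, map_mul, ih, CliffordAlgebra.involute_ι, List.length_cons,
      pow_succ, ← mul_assoc, ← mul_assoc]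
    congr 1
    rw [neg_mul, mul_neg, mul_one, neg_mul]
    congr 1
    exact ((Commute.neg_one_right (clE a)).pow_right _).eq

/-- The involution gives (-1)^length, moving `clE a` through the word gives a sign for each letter
other than `a`, and its square is `-1`. So the subtracted term is -(-1)^(count of a) times the word,
and the step is a projection. -/
theorem twistStep_word (a : Fin n) (l : List (Fin n)) :
    twistStep clE a (l.map clE).prod =
      if Even (l.count a) then (l.map clE).prod else 0 := by
  have h1 := isPauliSystem_clE.mul_word a l
  have h2 : l.countP (fun s => () = () ∧ s ≠ a) + l.count a = l.length := by
    rw [List.length_eq_countP_add_countP (p := fun s => s = a) (l := l), List.count, add_comm]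
    congr 1
    refine List.countP_congr fun s _ => ?_
    simp
  have h3 : clE a * involute (l.map clE).prod * clE a =
      -((-1) ^ l.count a * (l.map clE).prod) := by
    rw [involute_word, ← mul_assoc, ← ((Commute.neg_one_left (clE a)).pow_left l.length).eq,
      mul_assoc ((-1) ^ l.length), h1, mul_assoc, mul_assoc, mul_assoc, clE_mul_self, mul_neg,
      mul_one, mul_neg, mul_neg, ← mul_assoc, ← pow_add, ← h2]
    congr 2
    rw [add_right_comm, pow_add, ← two_mul, pow_mul]
    simp
  rw [twistStep_apply, h3, sub_neg_eq_add]
  split_ifs with h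
  · rw [h.neg_one_pow, one_mul, half_smul_two]
  · rw [(Nat.not_even_iff_odd.1 h).neg_one_pow, neg_one_mul, add_neg_cancel, smul_zero]

/-- The symmetrization for the identity map has scalar values. -/
theorem exists_twistAvg_eq (z : Cl n) : ∃ r : ℝ, twistAvg clE z = algebraMap ℝ (Cl n) r := by
  induction z using cl_word_induction with
  | hword l =>
    by_cases h : ∀ a, Even (l.count a)
    · have h1 : twistAvg clE (l.map clE).prod = (l.map clE).prod := by
        simp only [twistAvg]
        induction List.finRange n with
        | nil => simp
        | cons a m ih =>
          rw [List.map_cons, List.prod_cons, Module.End.mul_apply, ih, twistStep_word,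
            if_pos (h a)]
      rw [h1]
      rcases isPauliSystem_clE.word_eq_of_even l h with h2 | h2
      · exact ⟨1, by rw [h2, map_one]⟩
      · exact ⟨-1, by rw [h2, map_neg, map_one]⟩
    · push Not at h
      obtain ⟨a, ha⟩ := h
      refine ⟨0, ?_⟩
      rw [map_zero]
      have h1 : ∀ m : List (Fin n), (m.map (twistStep clE)).prod (l.map clE).prod =
          (l.map clE).prod ∨ (m.map (twistStep clE)).prod (l.map clE).prod = 0 := by
        intro m
        induction m with
        | nil => simp
        | cons b m ih =>
          rw [List.map_cons, List.prod_cons, Module.End.mul_apply]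
          rcases ih with ih | ih
          · rw [ih, twistStep_word]
            split_ifs <;> simp
          · rw [ih, map_zero]
            exact Or.inr rfl
      obtain ⟨m₁, m₂, hm⟩ := List.append_of_mem (List.mem_finRange a)
      rw [twistAvg, hm, List.map_append, List.prod_append, List.map_cons, List.prod_cons,
        Module.End.mul_apply, Module.End.mul_apply]
      rcases h1 m₂ with h2 | h2
      · rw [h2, twistStep_word, if_neg ha, map_zero]
      · rw [h2, map_zero, map_zero]
  | hadd x y hx hy =>
    obtain ⟨r, hr⟩ := hx
    obtain ⟨r', hr'⟩ := hy
    exact ⟨r + r', by rw [map_add, hr, hr', map_add]⟩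
  | hsmul r x hx =>
    obtain ⟨r', hr'⟩ := hx
    exact ⟨r * r', by rw [map_smul, hr', map_mul, Algebra.smul_def]⟩

/-- The symmetrization projects onto the line spanned by the lift. As it is polynomial in `w`, it
gives a lift that depends smoothly on `w` after normalization. -/
theorem IsTwistedLift.exists_twistAvg {w : Fin n → Cl n} {s : Cl n} (hs : IsTwistedLift w s)
    (hs1 : s * star s = 1) (y : Cl n) : ∃ r : ℝ, twistAvg w y = r • s := by
  obtain ⟨r, hr⟩ := exists_twistAvg_eq (star s * y)
  refine ⟨r, ?_⟩
  have := hs.twistAvg_mul (star s * y)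
  rwa [← mul_assoc, hs1, one_mul, hr, ← Algebra.commutes, ← Algebra.smul_def] at this

theorem algebraMap_cl_injective : Function.Injective (algebraMap ℝ (Cl n)) :=
  (algebraMap ℝ (Cl n)).injective

/-- Lifts of the same map agree up to a sign. -/
theorem IsTwistedLift.eq_or_eq_neg {w : Fin n → Cl n} {s s' : Cl n} (hs : IsTwistedLift w s)
    (hs' : IsTwistedLift w s') (h1 : s * star s = 1) (h2 : star s * s = 1)
    (h2' : star s' * s' = 1) : s' = s ∨ s' = -s := by
  obtain ⟨r, hr⟩ := hs.exists_twistAvg h1 s'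
  rw [hs'.twistAvg_self] at hr
  have : algebraMap ℝ (Cl n) (r * r) = algebraMap ℝ (Cl n) 1 := by
    rw [hr, CliffordAlgebra.star_smul, smul_mul_smul_comm, h2, Algebra.smul_def, mul_one] at h2'
    rw [h2', map_one]
  rcases mul_self_eq_one_iff.1 (algebraMap_cl_injective this) with h | h
  · exact Or.inl (by rw [hr, h, one_smul])
  · exact Or.inr (by rw [hr, h, neg_one_smul])

theorem clVec_swap (v w : Fin n → ℝ) :
    clVec v * clVec w + clVec w * clVec v = algebraMap ℝ (Cl n) (-2 * ∑ a, v a * w a) := by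
  rw [CliffordAlgebra.ι_mul_ι_add_swap, QuadraticMap.polar, negEuclid_apply, negEuclid_apply,
    negEuclid_apply]
  congr 1
  simp only [Pi.add_apply, Finset.mul_sum, ← Finset.sum_neg_distrib, ← Finset.sum_sub_distrib]
  exact Finset.sum_congr rfl fun a _ => by ring

open InnerProductSpace in
/-- Every orthogonal map has a lift. -/
theorem exists_isTwistedLift_of_isometry
    (φ : EuclideanSpace ℝ (Fin n) ≃ₗᵢ[ℝ] EuclideanSpace ℝ (Fin n)) :
    ∃ s : Cl n, s * star s = 1 ∧ star s * s = 1 ∧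
      ∀ v, s * clVec (WithLp.ofLp v) = clVec (WithLp.ofLp (φ v)) * involute s := by
  -- Cartan–Dieudonné: an orthogonal map is a product of reflections, and for the twisted adjoint
  -- representation the reflection along u is covered by u/|u|.
  obtain ⟨l, -, rfl⟩ := φ.reflections_generate_dim
  induction l with
  | nil => exact ⟨1, by simp, by simp, fun v => by simp⟩
  | cons u l ih =>
    obtain ⟨s, h1, h2, hs⟩ := ih
    have hu : ∃ t : Cl n, t * star t = 1 ∧ star t * t = 1 ∧ ∀ v, t * clVec (WithLp.ofLp v) =
        clVec (WithLp.ofLp ((ℝ ∙ u)ᗮ.reflection v)) * involute t := by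
      -- The list of reflections may contain u = 0, for which the reflection is the identity.
      by_cases hu : u = 0
      · refine ⟨1, by simp, by simp, fun v => ?_⟩
        rw [Submodule.reflection_mem_subspace_eq_self, map_one, one_mul, mul_one]
        simp [hu]
      · have hnorm : ∑ a, u a * u a = ‖u‖ * ‖u‖ := by
          rw [← real_inner_self_eq_norm_mul_norm, PiLp.inner_apply]
          rfl
        have hpos : ‖u‖ ≠ 0 := norm_ne_zero_iff.2 hu
        have hsq : (‖u‖⁻¹ • clVec (WithLp.ofLp u)) * (‖u‖⁻¹ • clVec (WithLp.ofLp u)) =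
            (-1 : Cl n) := by
          rw [smul_mul_smul_comm, clVec_mul_self, hnorm, Algebra.algebraMap_eq_smul_one, smul_smul]
          have : ‖u‖⁻¹ * ‖u‖⁻¹ * -(‖u‖ * ‖u‖) = -1 := by field_simp
          rw [this, neg_one_smul]
        refine ⟨‖u‖⁻¹ • clVec (WithLp.ofLp u), ?_, ?_, fun v => ?_⟩
        · rw [CliffordAlgebra.star_smul, CliffordAlgebra.star_ι, smul_neg, mul_neg, hsq, neg_neg]
        · rw [CliffordAlgebra.star_smul, CliffordAlgebra.star_ι, smul_neg, neg_mul, hsq, neg_neg]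
        · have hr : (ℝ ∙ u)ᗮ.reflection v = v - (2 * inner ℝ u v / (‖u‖ * ‖u‖)) • u := by
            rw [Submodule.reflection_orthogonal_apply, Submodule.reflection_singleton_apply,
              neg_sub]
            congr 1
            rw [← Nat.cast_smul_eq_nsmul ℝ, smul_smul]
            congr 1
            simp only [Nat.cast_ofNat, RCLike.ofReal_real_eq_id, id_eq]
            ring
          have hi : ∑ a, u a * v a = inner ℝ u v := by
            rw [PiLp.inner_apply]
            simp [mul_comm]
          have hswap := clVec_swap (WithLp.ofLp u) (WithLp.ofLp v)
          rw [hi] at hswap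
          have hsq' := clVec_mul_self (WithLp.ofLp u)
          rw [hnorm] at hsq'
          rw [map_smul, CliffordAlgebra.involute_ι, hr, WithLp.ofLp_sub, WithLp.ofLp_smul,
            smul_mul_assoc, mul_smul_comm]
          congr 1
          simp only [clVec] at hswap hsq' ⊢
          rw [mul_neg, map_sub, map_smul, sub_mul, smul_mul_assoc, hsq', neg_sub, Algebra.algebraMap_eq_smul_one,
            smul_smul, eq_sub_iff_add_eq, hswap, Algebra.algebraMap_eq_smul_one]
          congr 1
          field_simp
    obtain ⟨t, h1', h2', ht⟩ := hu
    refine ⟨t * s, ?_, ?_, fun v => ?_⟩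
    · rw [star_mul, mul_assoc, ← mul_assoc s, h1, one_mul, h1']
    · rw [star_mul, mul_assoc, ← mul_assoc (star t), h2', one_mul, h2]
    · rw [mul_assoc, hs, ← mul_assoc, ht, List.map_cons, List.prod_cons, map_mul, mul_assoc]
      rfl

theorem exists_isTwistedLift (R : Fin n → Fin n → ℝ)
    (hR : ∀ a b, ∑ k, R a k * R b k = if a = b then 1 else 0) :
    ∃ s : Cl n, s * star s = 1 ∧ star s * s = 1 ∧ IsTwistedLift (fun a => clVec (R a)) s := by
  let r : Fin n → EuclideanSpace ℝ (Fin n) := fun a => WithLp.toLp 2 (R a)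
  have hr : Orthonormal ℝ r := by
    rw [orthonormal_iff_ite]
    intro a b
    rw [← hR a b, PiLp.inner_apply]
    simp [r, mul_comm]
  have hspan : ⊤ ≤ Submodule.span ℝ (Set.range r) :=
    (hr.linearIndependent.span_eq_top_of_card_eq_finrank' (by simp)).ge
  let b := OrthonormalBasis.mk hr hspan
  let φ := (EuclideanSpace.basisFun (Fin n) ℝ).equiv b (Equiv.refl _)
  obtain ⟨s, h1, h2, hs⟩ := exists_isTwistedLift_of_isometry φ
  refine ⟨s, h1, h2, fun a => ?_⟩
  have := hs (EuclideanSpace.basisFun (Fin n) ℝ a)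
  have hφ : φ (EuclideanSpace.basisFun (Fin n) ℝ a) = r a := by
    simp only [φ, OrthonormalBasis.equiv_apply_basis]
    simp [b]
  rw [hφ] at this
  simpa [r] using this

end Twisted

end

noncomputable section

/-! ### Smooth maps into finite dimensional spaces without a norm -/

section WeakSmooth

variable {E : Type*} [NormedAddCommGroup E] [NormedSpace ℝ E] {H : Type*} [TopologicalSpace H]
  (I : ModelWithCorners ℝ E H) {M : Type*} [TopologicalSpace M] [ChartedSpace H M]
  {F G P : Type*} [AddCommGroup F] [Module ℝ F] [AddCommGroup G] [Module ℝ G]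
  [AddCommGroup P] [Module ℝ P]

/-- A map into a finite dimensional space is smooth at a point if its composites with all linear
functionals are. -/
def WeakSmoothAt (f : M → F) (x : M) : Prop :=
  ∀ φ : F →ₗ[ℝ] ℝ, ContMDiffAt I 𝓘(ℝ, ℝ) ∞ (fun y => φ (f y)) x

variable {I} {x : M}

namespace WeakSmoothAt

theorem congr {f f' : M → F} (h : WeakSmoothAt I f x) (hf : f' =ᶠ[𝓝 x] f) :
    WeakSmoothAt I f' x :=
  fun φ => (h φ).congr_of_eventuallyEq (hf.fun_comp φ)

theorem const (c : F) : WeakSmoothAt I (fun _ : M => c) x := fun _ => contMDiffAt_const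

theorem sum {κ : Type*} (s : Finset κ) {f : κ → M → F} (h : ∀ k ∈ s, WeakSmoothAt I (f k) x) :
    WeakSmoothAt I (fun y => ∑ k ∈ s, f k y) x := fun φ => by
  simp only [map_sum]
  exact ContMDiffAt.sum fun k hk => h k hk φ

theorem linear (L : F →ₗ[ℝ] G) {f : M → F} (h : WeakSmoothAt I f x) :
    WeakSmoothAt I (fun y => L (f y)) x := fun φ => h (φ ∘ₗ L)

theorem smul {r : M → ℝ} {f : M → F} (hr : ContMDiffAt I 𝓘(ℝ, ℝ) ∞ r x)
    (h : WeakSmoothAt I f x) : WeakSmoothAt I (fun y => r y • f y) x := fun φ => by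
  simp only [map_smul]
  exact hr.mul (h φ)

theorem sub {f f' : M → F} (h : WeakSmoothAt I f x) (h' : WeakSmoothAt I f' x) :
    WeakSmoothAt I (fun y => f y - f' y) x := fun φ => by
  simp only [map_sub]
  exact (h φ).sub (h' φ)

/-- Expansion in a basis of `F` alone suffices, so the other two spaces are arbitrary. -/
theorem bilinear [Module.Finite ℝ F] (B : F →ₗ[ℝ] G →ₗ[ℝ] P) {f : M → F} {f' : M → G}
    (h : WeakSmoothAt I f x) (h' : WeakSmoothAt I f' x) :
    WeakSmoothAt I (fun y => B (f y) (f' y)) x := by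
  let b := Module.finBasis ℝ F
  have : (fun y => B (f y) (f' y)) = fun y => ∑ k, b.coord k (f y) • B (b k) (f' y) := by
    funext y
    conv_lhs => rw [← b.sum_repr (f y)]
    rw [map_sum, LinearMap.sum_apply]
    exact Finset.sum_congr rfl fun k _ => by rw [map_smul, LinearMap.smul_apply, b.coord_apply]
  rw [this]
  exact sum _ fun k _ => smul (h _) (h'.linear _)

theorem mul {R : Type*} [Ring R] [Algebra ℝ R] [Module.Finite ℝ R] {f f' : M → R}
    (h : WeakSmoothAt I f x) (h' : WeakSmoothAt I f' x) :
    WeakSmoothAt I (fun y => f y * f' y) x :=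
  bilinear (LinearMap.mul ℝ R) h h'

theorem contMDiffAt {F : Type*} [NormedAddCommGroup F] [NormedSpace ℝ F] [FiniteDimensional ℝ F]
    {f : M → F} (h : WeakSmoothAt I f x) : ContMDiffAt I 𝓘(ℝ, F) ∞ f x := by
  let b := Module.finBasis ℝ F
  have : f = fun y => ∑ k, b.coord k (f y) • b k := by
    funext y
    exact (b.sum_repr (f y)).symm
  rw [this]
  exact ContMDiffAt.sum fun k _ => (h _).smul contMDiffAt_const

theorem of_contMDiffAt {F : Type*} [NormedAddCommGroup F] [NormedSpace ℝ F]
    [FiniteDimensional ℝ F] {f : M → F} (h : ContMDiffAt I 𝓘(ℝ, F) ∞ f x) :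
    WeakSmoothAt I f x := fun φ =>
  (LinearMap.toContinuousLinearMap φ).contMDiff.contMDiffAt.comp x h

end WeakSmoothAt

end WeakSmooth

/-! ### Smooth local lifts -/

section LocalLift

variable {n : ℕ}

/-- A linear functional on the Clifford algebra with value `1` at the unit. -/
def unitFunctional (n : ℕ) : Cl n →ₗ[ℝ] ℝ :=
  Classical.choose (LinearMap.exists_leftInverse_of_injective (Algebra.linearMap ℝ (Cl n))
    (LinearMap.ker_eq_bot.2 algebraMap_cl_injective))

theorem unitFunctional_smul (r : ℝ) : unitFunctional n (r • 1) = r := by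
  have := LinearMap.congr_fun (Classical.choose_spec
    (LinearMap.exists_leftInverse_of_injective (Algebra.linearMap ℝ (Cl n))
      (LinearMap.ker_eq_bot.2 algebraMap_cl_injective))) r
  rw [← Algebra.algebraMap_eq_smul_one]
  exact this

/-- The involution `star` of the Clifford algebra as a linear map. -/
def clStar (n : ℕ) : Cl n →ₗ[ℝ] Cl n where
  toFun := star
  map_add' := star_add
  map_smul' r x := CliffordAlgebra.star_smul r x

variable {E : Type*} [NormedAddCommGroup E] [NormedSpace ℝ E] {H : Type*} [TopologicalSpace H]
  {I : ModelWithCorners ℝ E H} {M : Type*} [TopologicalSpace M] [ChartedSpace H M]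

theorem WeakSmoothAt.clStar {f : M → Cl n} {x : M} (h : WeakSmoothAt I f x) :
    WeakSmoothAt I (fun y => star (f y)) x :=
  h.linear (_root_.clStar n)

theorem WeakSmoothAt.twistAvg {w : M → Fin n → Cl n} {x : M}
    (hw : ∀ a, WeakSmoothAt I (fun y => w y a) x) (s : Cl n) :
    WeakSmoothAt I (fun y => twistAvg (w y) s) x := by
  simp only [_root_.twistAvg]
  induction List.finRange n with
  | nil => simpa using WeakSmoothAt.const s
  | cons a l ih =>
    simp only [List.map_cons, List.prod_cons, Module.End.mul_apply, twistStep_apply]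
    exact (ih.sub (((hw a).mul
      (ih.linear (CliffordAlgebra.involute (Q := negEuclid n)).toLinearMap)).mul
        (.const _))).linear ((2⁻¹ : ℝ) • LinearMap.id)

/-- A unit that covers `w` for the twisted adjoint representation. -/
structure IsUnitLift (w : Fin n → Cl n) (s : Cl n) : Prop where
  mul_star : s * star s = 1
  star_mul : star s * s = 1
  lift : IsTwistedLift w s

theorem IsUnitLift.neg {w : Fin n → Cl n} {s : Cl n} (h : IsUnitLift w s) :
    IsUnitLift w (-s) where
  mul_star := by rw [star_neg, neg_mul_neg, h.mul_star]
  star_mul := by rw [star_neg, neg_mul_neg, h.star_mul]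
  lift a := by rw [neg_mul, map_neg, mul_neg, h.lift a]

/-- A smooth family of orthogonal maps has a smooth lift near each point. -/
theorem exists_local_lift {U : Set M} (hU : IsOpen U) {x₀ : M} (hx₀ : x₀ ∈ U)
    (w : M → Fin n → Cl n) (hw : ∀ x ∈ U, ∀ a, WeakSmoothAt I (fun y => w y a) x)
    (hlift : ∀ x ∈ U, ∃ s, IsUnitLift (w x) s) :
    ∃ (U' : Set M) (s : M → Cl n), IsOpen U' ∧ x₀ ∈ U' ∧ U' ⊆ U ∧
      (∀ x ∈ U', WeakSmoothAt I s x) ∧ ∀ x ∈ U', IsUnitLift (w x) (s x) := by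
  obtain ⟨s₀, hs₀⟩ := hlift x₀ hx₀
  -- `T x` is a multiple r(x) of any unit lift at `x`, with T x₀ = s₀, and `ν x` is r(x)². Near `x₀`
  -- this is positive, and dividing by its square root makes `T` a smooth unit lift.
  let T : M → Cl n := fun x => twistAvg (w x) s₀
  let ν : M → ℝ := fun x => unitFunctional n (T x * star (T x))
  have hT : ∀ x ∈ U, WeakSmoothAt I T x := fun x hx => WeakSmoothAt.twistAvg (hw x hx) s₀
  have hν : ∀ x ∈ U, ContMDiffAt I 𝓘(ℝ, ℝ) ∞ ν x := fun x hx =>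
    ((hT x hx).mul (hT x hx).clStar) _
  have hνc : ContinuousOn ν U := fun x hx => (hν x hx).continuousAt.continuousWithinAt
  have hν₀ : ν x₀ = 1 := by
    simp only [ν, T]
    rw [hs₀.lift.twistAvg_self, hs₀.mul_star]
    simpa using unitFunctional_smul (n := n) 1
  refine ⟨U ∩ ν ⁻¹' Set.Ioi 0, fun x => (Real.sqrt (ν x))⁻¹ • T x,
    hνc.isOpen_inter_preimage hU isOpen_Ioi, ⟨hx₀, ?_⟩, Set.inter_subset_left, ?_, ?_⟩
  · simp [hν₀]
  · rintro x ⟨hx, hpos⟩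
    have hpos : 0 < ν x := hpos
    refine WeakSmoothAt.smul ?_ (hT x hx)
    have h1 : ContDiffAt ℝ ∞ (fun r : ℝ => (Real.sqrt r)⁻¹) (ν x) :=
      (Real.contDiffAt_sqrt hpos.ne').inv (Real.sqrt_pos.2 hpos).ne'
    exact h1.contMDiffAt.comp x (hν x hx)
  · rintro x ⟨hx, hpos⟩
    have hpos : 0 < ν x := hpos
    obtain ⟨s, hs⟩ := hlift x hx
    obtain ⟨r, hr⟩ := hs.lift.exists_twistAvg hs.mul_star s₀
    have hTx : T x = r • s := hr
    have hνx : ν x = r * r := by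
      simp only [ν, hTx]
      rw [CliffordAlgebra.star_smul, smul_mul_smul_comm, hs.mul_star, unitFunctional_smul]
    have hr0 : r ≠ 0 := by
      rintro rfl
      simp [hνx] at hpos
    have hsqrt : Real.sqrt (ν x) = |r| := by rw [hνx, Real.sqrt_mul_self_eq_abs]
    simp only [hTx, smul_smul, hsqrt]
    rcases lt_or_gt_of_ne hr0 with h | h
    · rw [abs_of_neg h, inv_neg, neg_mul, inv_mul_cancel₀ hr0, neg_one_smul]
      exact hs.neg
    · rw [abs_of_pos h, inv_mul_cancel₀ hr0, one_smul]
      exact hs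

/-- Two smooth lifts of the same family agree up to a locally constant sign. -/
theorem eventually_eq_of_lifts {w : M → Fin n → Cl n} {s s' : M → Cl n} {x : M}
    (hs : WeakSmoothAt I s x) (hs' : WeakSmoothAt I s' x)
    (hsw : ∀ᶠ y in 𝓝 x, IsUnitLift (w y) (s y)) (hsw' : ∀ᶠ y in 𝓝 x, IsUnitLift (w y) (s' y)) :
    (∀ᶠ y in 𝓝 x, s' y = s y) ∨ ∀ᶠ y in 𝓝 x, s' y = -s y := by
  have hc : ContinuousAt (fun y => unitFunctional n (star (s y) * s' y)) x :=
    ((hs.clStar.mul hs') _).continuousAt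
  -- A continuous function that takes only the values 1 and -1 detects the sign, so the sign is
  -- locally constant.
  have key : ∀ y, IsUnitLift (w y) (s y) → IsUnitLift (w y) (s' y) →
      (s' y = s y ∧ unitFunctional n (star (s y) * s' y) = 1) ∨
      (s' y = -s y ∧ unitFunctional n (star (s y) * s' y) = -1) := by
    intro y h h'
    rcases h.lift.eq_or_eq_neg h'.lift h.mul_star h.star_mul h'.star_mul with e | e
    · refine Or.inl ⟨e, ?_⟩
      rw [e, h.star_mul]
      simpa using unitFunctional_smul (n := n) 1
    · refine Or.inr ⟨e, ?_⟩
      rw [e, mul_neg, h.star_mul, map_neg]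
      simpa using unitFunctional_smul (n := n) 1
  rcases key x hsw.self_of_nhds hsw'.self_of_nhds with ⟨-, e⟩ | ⟨-, e⟩
  · left
    have h0 : ∀ᶠ y in 𝓝 x, 0 < unitFunctional n (star (s y) * s' y) :=
      hc.eventually_mem (Ioi_mem_nhds (by rw [e]; exact one_pos))
    filter_upwards [hsw, hsw', h0] with y h h' hy
    rcases key y h h' with h2 | h2
    · exact h2.1
    · rw [h2.2] at hy
      norm_num at hy
  · right
    have h0 : ∀ᶠ y in 𝓝 x, unitFunctional n (star (s y) * s' y) < 0 :=
      hc.eventually_mem (Iio_mem_nhds (by rw [e]; norm_num))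
    filter_upwards [hsw, hsw', h0] with y h h' hy
    rcases key y h h' with h2 | h2
    · rw [h2.2] at hy
      norm_num at hy
    · exact h2.1

end LocalLift

end

noncomputable section

/-! ### Sign cocycles on simply connected spaces -/

section SignCocycle

variable {X ι : Type*} [TopologicalSpace X]

/-- The two-fold covering defined by a locally constant cocycle of signs. -/
def signBundle (U : ι → Set X) (hU : ∀ j, IsOpen (U j)) (k : X → ι) (hk : ∀ x, x ∈ U (k x))
    (ε : ι → ι → X → ℤˣ) (hε : ∀ i j, ContinuousOn (ε i j) (U i ∩ U j))
    (hcoc : ∀ i j l, ∀ x ∈ U i ∩ U j ∩ U l, ε i j x * ε j l x = ε i l x) :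
    FiberBundleCore ι X ℤˣ where
  baseSet := U
  isOpen_baseSet := hU
  indexAt := k
  mem_baseSet_at := hk
  coordChange i j x v := ε i j x * v
  coordChange_self i x hx v := by
    rw [mul_eq_left.1 (hcoc i i i x ⟨⟨hx, hx⟩, hx⟩), one_mul]
  continuousOn_coordChange i j :=
    ((hε i j).comp continuousOn_fst fun _ h => h.1).mul continuousOn_snd
  coordChange_comp i j l x hx v := by
    rw [← hcoc i j l x hx, mul_comm (ε i j x) (ε j l x), mul_assoc]

/-- Cocycles of signs are coboundaries on simply connected spaces. -/
theorem exists_sign_coboundary [SimplyConnectedSpace X] [LocallyPathConnectedSpace X]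
    (U : ι → Set X) (hU : ∀ j, IsOpen (U j)) (k : X → ι) (hk : ∀ x, x ∈ U (k x))
    (ε : ι → ι → X → ℤˣ) (hε : ∀ i j, ContinuousOn (ε i j) (U i ∩ U j))
    (hcoc : ∀ i j l, ∀ x ∈ U i ∩ U j ∩ U l, ε i j x * ε j l x = ε i l x) :
    ∃ η : ι → X → ℤˣ, (∀ j, ContinuousOn (η j) (U j)) ∧
      ∀ i j, ∀ x ∈ U i ∩ U j, η j x = ε i j x * η i x := by
  let Z := signBundle U hU k hk ε hε hcoc
  -- The identity map of the simply connected base lifts through this covering. The lift is a global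
  -- section, and its local coordinates are the functions `η`.
  have hcov : IsCoveringMap (π ℤˣ Z.Fiber) := FiberBundle.isCoveringMap
  obtain ⟨x₀⟩ : Nonempty X := inferInstance
  obtain ⟨t, ⟨-, ht⟩, -⟩ := hcov.existsUnique_continuousMap_lifts (ContinuousMap.id X) x₀
    (⟨x₀, (1 : ℤˣ)⟩ : TotalSpace ℤˣ Z.Fiber) rfl
  have hproj : ∀ x, (t x).1 = x := fun x => congrFun ht x
  refine ⟨fun j x => (Z.localTriv j (t x)).2, fun j => ?_, fun i j x hx => ?_⟩
  · have h1 : ContinuousOn (Z.localTriv j) (Z.localTriv j).source := (Z.localTriv j).continuousOn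
    refine continuous_snd.comp_continuousOn (h1.comp t.continuous.continuousOn fun x hx => ?_)
    rw [Z.mem_localTriv_source, ← Z.baseSet_at, hproj]
    exact hx
  · have h := Z.coordChange_comp (Z.indexAt (t x).1) i j (t x).1
      (by rw [hproj]; exact ⟨⟨hk x, hx.1⟩, hx.2⟩) (t x).2
    change Z.coordChange (Z.indexAt (t x).1) j (t x).1 (t x).2 =
      ε i j x * Z.coordChange (Z.indexAt (t x).1) i (t x).1 (t x).2
    rw [← h]
    change ε i j (t x).1 * _ = _
    rw [hproj]

end SignCocycle

/-! ### Comparison of orthonormal frames -/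

section Frames

variable {E : Type*} [NormedAddCommGroup E] [NormedSpace ℝ E] {H : Type*} [TopologicalSpace H]
  {I : ModelWithCorners ℝ E H} {M : Type u} [TopologicalSpace M] [ChartedSpace H M]
  [IsManifold I ∞ M] (g : SmoothMetric I M)

/-- Vector fields along a map `b` are allowed because the frames of the factors are pulled back to
the product. -/
theorem contMDiffAt_metric {E' : Type*} [NormedAddCommGroup E'] [NormedSpace ℝ E'] {H' : Type*}
    [TopologicalSpace H'] {I' : ModelWithCorners ℝ E' H'} {M' : Type*} [TopologicalSpace M']
    [ChartedSpace H' M'] {b : M' → M} {v w : ∀ m, TangentSpace I (b m)} {x : M'}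
    (hv : ContMDiffAt I' I.tangent ∞ (fun m => (⟨b m, v m⟩ : TangentBundle I M)) x)
    (hw : ContMDiffAt I' I.tangent ∞ (fun m => (⟨b m, w m⟩ : TangentBundle I M)) x) :
    ContMDiffAt I' 𝓘(ℝ, ℝ) ∞ (fun m => g.inner (b m) (v m) (w m)) x := by
  have hb : ContMDiffAt I' I ∞ b x := (Bundle.contMDiffAt_totalSpace.1 hv).1
  have : ContMDiffAt I' (I.prod 𝓘(ℝ, ℝ)) ∞
      (fun m ↦ TotalSpace.mk' ℝ (E := Bundle.Trivial M ℝ) (b m) (g.inner (b m) (v m) (w m))) x := by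
    apply ContMDiffAt.clm_bundle_apply₂ (F₁ := E) (F₂ := E)
    · exact ContMDiffAt.comp x g.contMDiff.contMDiffAt hb
    · exact hv
    · exact hw
  exact (Bundle.contMDiffAt_totalSpace.1 this).2

variable {g} {n : ℕ}

/-- An orthonormal basis of a tangent space. -/
structure IsOrthoFrame (g : SmoothMetric I M) {x : M} (f : Fin n → TangentSpace I x) : Prop where
  inner_eq : ∀ a b, g.inner x (f a) (f b) = if a = b then 1 else 0
  span_eq : ⊤ ≤ Submodule.span ℝ (Set.range f)

theorem IsOrthoFrame.expand {x : M} {f : Fin n → TangentSpace I x} (hf : IsOrthoFrame g f)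
    (v : TangentSpace I x) : ∑ a, g.inner x (f a) v • f a = v := by
  obtain ⟨c, rfl⟩ := (Submodule.mem_span_range_iff_exists_fun ℝ).1 (hf.span_eq (Submodule.mem_top (x := v)))
  refine Finset.sum_congr rfl fun a _ => ?_
  congr 1
  simp [hf.inner_eq]

theorem IsOrthoFrame.parseval {x : M} {f : Fin n → TangentSpace I x} (hf : IsOrthoFrame g f)
    (v w : TangentSpace I x) : ∑ a, g.inner x (f a) v * g.inner x (f a) w = g.inner x v w := by
  conv_rhs => rw [← hf.expand w]
  rw [map_sum]
  refine Finset.sum_congr rfl fun a _ => ?_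
  rw [map_smul, g.symm x v, smul_eq_mul, mul_comm]

/-- The coordinates of a frame with respect to another one, in the Clifford algebra. -/
def frameChange (g : SmoothMetric I M) {x : M} (f f' : Fin n → TangentSpace I x) (a : Fin n) :
    Cl n :=
  ∑ b, g.inner x (f' b) (f a) • clE b

theorem frameChange_eq {x : M} (f f' : Fin n → TangentSpace I x) (a : Fin n) :
    frameChange g f f' a = clVec fun b => g.inner x (f' b) (f a) := by
  rw [clVec_eq_sum]
  rfl

/-- The frames may be oppositely oriented. The lift is then not an element of the spin group, which
is why the twisted adjoint representation is used. -/
theorem exists_isUnitLift_frameChange {x : M} {f f' : Fin n → TangentSpace I x}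
    (hf : IsOrthoFrame g f) (hf' : IsOrthoFrame g f') :
    ∃ s, IsUnitLift (frameChange g f f') s := by
  obtain ⟨s, h1, h2, hs⟩ := exists_isTwistedLift (fun a b => g.inner x (f' b) (f a)) fun a b => by
    rw [hf'.parseval, hf.inner_eq]
  exact ⟨s, h1, h2, fun a => by rw [frameChange_eq, hs a]⟩

theorem IsTwistedLift.mul_clVec {w : Fin n → Cl n} {s : Cl n} (hs : IsTwistedLift w s)
    (v : Fin n → ℝ) : s * clVec v = (∑ a, v a • w a) * CliffordAlgebra.involute s := by
  rw [clVec_eq_sum, Finset.mul_sum, Finset.sum_mul]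
  exact Finset.sum_congr rfl fun a _ => by rw [mul_smul_comm, hs a, smul_mul_assoc]

theorem IsUnitLift.trans {x : M} {f f' f'' : Fin n → TangentSpace I x}
    (hf' : IsOrthoFrame g f') {s t : Cl n} (hs : IsUnitLift (frameChange g f f') s)
    (ht : IsUnitLift (frameChange g f' f'') t) : IsUnitLift (frameChange g f f'') (t * s) where
  mul_star := by rw [StarMul.star_mul, mul_assoc, ← mul_assoc s, hs.mul_star, one_mul, ht.mul_star]
  star_mul := by
    rw [StarMul.star_mul, mul_assoc, ← mul_assoc (star t), ht.star_mul, one_mul, hs.star_mul]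
  lift a := by
    rw [mul_assoc, hs.lift a, frameChange_eq, ← mul_assoc, ht.lift.mul_clVec, map_mul, mul_assoc]
    congr 1
    simp only [frameChange, Finset.smul_sum, smul_smul]
    rw [Finset.sum_comm]
    refine Finset.sum_congr rfl fun c _ => ?_
    rw [← Finset.sum_smul, ← hf'.parseval]
    congr 1
    exact Finset.sum_congr rfl fun b _ => by rw [g.symm x (f'' c), mul_comm]

theorem frameChange_weakSmoothAt {f f' : Fin n → (x : M) → TangentSpace I x} {x : M}
    (hf : ∀ a, ContMDiffAt I I.tangent ∞ (fun y => (⟨y, f a y⟩ : TangentBundle I M)) x)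
    (hf' : ∀ a, ContMDiffAt I I.tangent ∞ (fun y => (⟨y, f' a y⟩ : TangentBundle I M)) x)
    (a : Fin n) :
    WeakSmoothAt I (fun y => frameChange g (fun b => f b y) (fun b => f' b y) a) x :=
  WeakSmoothAt.sum _ fun b _ =>
    WeakSmoothAt.smul (contMDiffAt_metric g (hf' b) (hf a)) (WeakSmoothAt.const _)

namespace SpinStructure

variable (σ σ' : SpinStructure I g n)

theorem isOrthoFrame (α : σ.Index) {x : M} (hx : x ∈ σ.baseSet α) :
    IsOrthoFrame g fun a => σ.frame α a x where
  inner_eq := σ.orthonormal α x hx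
  span_eq := (σ.isLocalFrameOn α).generating hx

theorem contMDiffAt_frame (α : σ.Index) {x : M} (hx : x ∈ σ.baseSet α) (a : Fin n) :
    ContMDiffAt I I.tangent ∞ (fun y => (⟨y, σ.frame α a y⟩ : TangentBundle I M)) x :=
  (σ.isLocalFrameOn α).contMDiffAt (σ.isOpen_baseSet α) hx a

/-- Elements of the spin group are even, so the involution fixes them and twisted conjugation is
ordinary conjugation. -/
theorem isUnitLift_lift (α β : σ.Index) {x : M} (hx : x ∈ σ.baseSet α ∩ σ.baseSet β) :
    IsUnitLift (frameChange g (fun a => σ.frame β a x) fun a => σ.frame α a x)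
      (σ.lift α β x : Cl n) where
  mul_star := spinGroup.mul_star_self_of_mem (σ.lift α β x).2
  star_mul := spinGroup.star_mul_self_of_mem (σ.lift α β x).2
  lift b := by
    have h := σ.lift_covers α β x hx b
    rw [spinGroup.involute_eq (σ.lift α β x).2, frameChange, ← h, mul_assoc, ← spinGroup.star_eq_inv,
      spinGroup.coe_star, spinGroup.coe_star_mul_self, mul_one]

theorem weakSmoothAt_lift (α β : σ.Index) {x : M} (hx : x ∈ σ.baseSet α ∩ σ.baseSet β) :
    WeakSmoothAt I (fun y => (σ.lift α β y : Cl n)) x := fun φ =>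
  (σ.lift_smooth α β φ).contMDiffAt
    (((σ.isOpen_baseSet α).inter (σ.isOpen_baseSet β)).mem_nhds hx)

theorem lift_mul_lift (α β γ : σ.Index) {x : M} (hα : x ∈ σ.baseSet α) (hβ : x ∈ σ.baseSet β)
    (hγ : x ∈ σ.baseSet γ) : (σ.lift α β x : Cl n) * σ.lift β γ x = σ.lift α γ x :=
  congrArg Subtype.val (σ.lift_cocycle α β γ x ⟨⟨hα, hβ⟩, hγ⟩)

/-- The local expression `s` of a map between the spin structures at `x`, for the sections with
number `α`, `α'`, becomes `transport s` for the sections with number `β`, `β'`. -/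
def transport (α β : σ.Index) (α' β' : σ'.Index) (x : M) (s : Cl n) : Cl n :=
  σ'.lift β' α' x * s * σ.lift α β x

variable {σ σ'}

theorem transport_transport {α β γ : σ.Index} {α' β' γ' : σ'.Index} {x : M}
    (hα : x ∈ σ.baseSet α ∩ σ'.baseSet α') (hβ : x ∈ σ.baseSet β ∩ σ'.baseSet β')
    (hγ : x ∈ σ.baseSet γ ∩ σ'.baseSet γ') (s : Cl n) :
    transport σ σ' β γ β' γ' x (transport σ σ' α β α' β' x s) =
      transport σ σ' α γ α' γ' x s := by
  simp only [transport]
  rw [← σ.lift_mul_lift α β γ hα.1 hβ.1 hγ.1, ← σ'.lift_mul_lift γ' β' α' hγ.2 hβ.2 hα.2]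
  simp only [mul_assoc]

theorem transport_smul {α β : σ.Index} {α' β' : σ'.Index} {x : M} (ε : ℤˣ) (s : Cl n) :
    transport σ σ' α β α' β' x (ε • s) = ε • transport σ σ' α β α' β' x s := by
  simp only [transport, Units.smul_def, mul_smul_comm, smul_mul_assoc]

theorem isUnitLift_transport {α β : σ.Index} {α' β' : σ'.Index} {x : M}
    (hα : x ∈ σ.baseSet α ∩ σ'.baseSet α') (hβ : x ∈ σ.baseSet β ∩ σ'.baseSet β') {s : Cl n}
    (hs : IsUnitLift (frameChange g (fun a => σ.frame α a x) fun a => σ'.frame α' a x) s) :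
    IsUnitLift (frameChange g (fun a => σ.frame β a x) fun a => σ'.frame β' a x)
      (transport σ σ' α β α' β' x s) :=
  (σ.isUnitLift_lift α β ⟨hα.1, hβ.1⟩).trans (σ.isOrthoFrame α hα.1)
    (hs.trans (σ'.isOrthoFrame α' hα.2) (σ'.isUnitLift_lift β' α' ⟨hβ.2, hα.2⟩))

theorem weakSmoothAt_transport {α β : σ.Index} {α' β' : σ'.Index} {x : M}
    (hα : x ∈ σ.baseSet α ∩ σ'.baseSet α') (hβ : x ∈ σ.baseSet β ∩ σ'.baseSet β') {s : M → Cl n}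
    (hs : WeakSmoothAt I s x) :
    WeakSmoothAt I (fun y => transport σ σ' α β α' β' y (s y)) x :=
  ((σ'.weakSmoothAt_lift β' α' ⟨hβ.2, hα.2⟩).mul hs).mul
    (σ.weakSmoothAt_lift α β ⟨hα.1, hβ.1⟩)

end SpinStructure

theorem IsUnitLift.ne_zero {w : Fin n → Cl n} {s : Cl n} (hs : IsUnitLift w s) : s ≠ 0 := by
  rintro rfl
  simpa using hs.mul_star

theorem IsUnitLift.sign_eq {w : Fin n → Cl n} {s : Cl n} (hs : IsUnitLift w s) {ε ε' : ℤˣ}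
    (h : ε • s = ε' • s) : ε = ε' := by
  have h2 : s ≠ -s := fun h => hs.ne_zero <| calc
    s = (2⁻¹ : ℝ) • (s + s) := (half_smul_two s).symm
    _ = (2⁻¹ : ℝ) • (s + -s) := by rw [← h]
    _ = 0 := by rw [add_neg_cancel, smul_zero]
  rcases Int.units_eq_one_or ε with rfl | rfl <;> rcases Int.units_eq_one_or ε' with rfl | rfl
  · rfl
  · simp [h2] at h
  · simp [h2.symm] at h
  · rfl

theorem IsUnitLift.exists_sign {w : Fin n → Cl n} {s s' : Cl n} (hs : IsUnitLift w s)
    (hs' : IsUnitLift w s') : ∃ ε : ℤˣ, s' = ε • s := by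
  rcases hs.lift.eq_or_eq_neg hs'.lift hs.mul_star hs.star_mul hs'.star_mul with h | h
  · exact ⟨1, by rw [h, one_smul]⟩
  · exact ⟨-1, by rw [h, Units.neg_smul, one_smul]⟩

theorem IsUnitLift.sign_smul {w : Fin n → Cl n} {s : Cl n} (hs : IsUnitLift w s) (ε : ℤˣ) :
    IsUnitLift w (ε • s) := by
  rcases Int.units_eq_one_or ε with rfl | rfl
  · rwa [one_smul]
  · rw [Units.neg_smul, one_smul]
    exact hs.neg

/-- On a simply connected manifold any two spin structures for the same metric are related by a
global family of units of the Clifford algebra, which is smooth in local sections. -/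
theorem SpinStructure.exists_global_lift [SimplyConnectedSpace M] [LocallyPathConnectedSpace M]
    (σ σ' : SpinStructure I g n) :
    ∃ s : M → Cl n,
      (∀ x, IsUnitLift (frameChange g (fun a => σ.frame (σ.indexAt x) a x)
        fun a => σ'.frame (σ'.indexAt x) a x) (s x)) ∧
      ∀ x₀, WeakSmoothAt I (fun y => transport σ σ' (σ.indexAt y) (σ.indexAt x₀) (σ'.indexAt y)
        (σ'.indexAt x₀) y (s y)) x₀ := by
  -- Local lifts, indexed by the points of `M`; on overlaps they are compared after transport to
  -- common sections, and they differ there by the signs `ε`.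
  have hloc : ∀ x₀ : M, ∃ (U : Set M) (s : M → Cl n), IsOpen U ∧ x₀ ∈ U ∧
      U ⊆ σ.baseSet (σ.indexAt x₀) ∩ σ'.baseSet (σ'.indexAt x₀) ∧
      (∀ x ∈ U, WeakSmoothAt I s x) ∧ ∀ x ∈ U, IsUnitLift
        (frameChange g (fun a => σ.frame (σ.indexAt x₀) a x)
          fun a => σ'.frame (σ'.indexAt x₀) a x) (s x) := fun x₀ =>
    exists_local_lift ((σ.isOpen_baseSet _).inter (σ'.isOpen_baseSet _))
      ⟨σ.mem_baseSet_at x₀, σ'.mem_baseSet_at x₀⟩ _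
      (fun x hx a => frameChange_weakSmoothAt (fun b => σ.contMDiffAt_frame _ hx.1 b)
        (fun b => σ'.contMDiffAt_frame _ hx.2 b) a)
      fun x hx => exists_isUnitLift_frameChange (σ.isOrthoFrame _ hx.1) (σ'.isOrthoFrame _ hx.2)
  choose U s hUo hxU hU hsm hs using hloc
  let tr : M → M → M → Cl n := fun i j y => transport σ σ' (σ.indexAt i) (σ.indexAt j)
    (σ'.indexAt i) (σ'.indexAt j) y (s i y)
  have htr : ∀ i j, ∀ y ∈ U i ∩ U j, IsUnitLift
      (frameChange g (fun a => σ.frame (σ.indexAt j) a y)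
        fun a => σ'.frame (σ'.indexAt j) a y) (tr i j y) := fun i j y hy =>
    isUnitLift_transport (hU i hy.1) (hU j hy.2) (hs i y hy.1)
  have hex : ∀ i j y, ∃ ε : ℤˣ, y ∈ U i ∩ U j → s j y = ε • tr i j y := fun i j y => by
    by_cases hy : y ∈ U i ∩ U j
    · obtain ⟨ε, h⟩ := (htr i j y hy).exists_sign (hs j y hy.2)
      exact ⟨ε, fun _ => h⟩
    · exact ⟨1, fun h => absurd h hy⟩
  choose ε hε using hex
  -- The signs are locally constant because smooth lifts agree up to a locally constant sign, and
  -- they satisfy the cocycle condition because transport composes.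
  obtain ⟨η, hη, hηε⟩ := exists_sign_coboundary U hUo id hxU ε (fun i j y hy => by
      have hev : ∀ᶠ z in 𝓝 y, z ∈ U i ∩ U j := ((hUo i).inter (hUo j)).mem_nhds hy
      have hconst : ∀ c : ℤˣ, (∀ᶠ z in 𝓝 y, s j z = c • tr i j z) → ContinuousAt (ε i j) y := by
        intro c hc
        refine (continuousAt_const (y := c)).congr ?_
        filter_upwards [hev, hc] with z hz hz'
        exact (htr i j z hz).sign_eq (hz'.symm.trans (hε i j z hz))
      refine ContinuousAt.continuousWithinAt ?_
      rcases eventually_eq_of_lifts (weakSmoothAt_transport (hU i hy.1) (hU j hy.2)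
        (hsm i y hy.1)) (hsm j y hy.2) (hev.mono fun z hz => htr i j z hz)
        (hev.mono fun z hz => hs j z hz.2) with h | h
      · exact hconst 1 (h.mono fun z hz => by rw [hz, one_smul])
      · exact hconst (-1) (h.mono fun z hz => by rw [hz, Units.neg_smul, one_smul]))
    (fun i j l y hy => by
      refine (htr i l y ⟨hy.1.1, hy.2⟩).sign_eq ?_
      rw [← hε i l y ⟨hy.1.1, hy.2⟩, hε j l y ⟨hy.1.2, hy.2⟩]
      simp only [tr]
      rw [hε i j y hy.1, transport_smul,
        transport_transport (hU i hy.1.1) (hU j hy.1.2) (hU l hy.2), smul_smul, mul_comm])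
  -- At each point the local lift of that point, corrected by `η`, is used. By the coboundary
  -- relation, its transport to the sections at `x₀` is the single local lift `s x₀` up to a
  -- constant sign near `x₀`.
  refine ⟨fun x => η x x • s x x, fun x => (hs x x (hxU x)).sign_smul _, fun x₀ => ?_⟩
  have h1 : ∀ᶠ y in 𝓝 x₀, η x₀ y = η x₀ x₀ :=
    ((hη x₀).continuousAt ((hUo x₀).mem_nhds (hxU x₀))).eventually_mem
      ((isOpen_discrete {η x₀ x₀}).mem_nhds rfl)
  have h2 : WeakSmoothAt I (fun y => η x₀ x₀ • s x₀ y) x₀ := by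
    simp only [Units.smul_def]
    exact (hsm x₀ x₀ (hxU x₀)).linear (((η x₀ x₀ : ℤˣ) : ℤ) • LinearMap.id)
  refine h2.congr ?_
  filter_upwards [h1, (hUo x₀).mem_nhds (hxU x₀)] with y hy hyU
  rw [← hy, transport_smul, hηε y x₀ y ⟨hxU y, hyU⟩, hε y x₀ y ⟨hxU y, hyU⟩, smul_smul,
    mul_right_comm, Int.units_mul_self, one_mul]

end Frames

end

noncomputable section

/-! ### Products of simply connected manifolds -/

/-- A homotopy class of paths in a product is determined by its projections. -/
theorem simplyConnectedSpace_pi {ι : Type*} {X : ι → Type*} [∀ i, TopologicalSpace (X i)]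
    [∀ i, SimplyConnectedSpace (X i)] : SimplyConnectedSpace (∀ i, X i) := by
  rw [simply_connected_iff_paths_homotopic]
  refine ⟨inferInstance, fun x y => ⟨fun p q => ?_⟩⟩
  rw [← Path.Homotopic.pi_proj p, ← Path.Homotopic.pi_proj q]
  congr 1
  funext i
  have : Subsingleton (Path.Homotopic.Quotient (x i) (y i)) :=
    (simply_connected_iff_paths_homotopic.1 inferInstance).2 _ _
  exact Subsingleton.elim _ _

theorem locallyPathConnectedSpace_pi {N : ℕ} {D : Fin N → ℕ} (M : Fin N → Type*)
    [∀ i, TopologicalSpace (M i)] [∀ i, ChartedSpace (EuclideanSpace ℝ (Fin (D i))) (M i)] :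
    LocallyPathConnectedSpace (∀ i, M i) := by
  have : LocallyPathConnectedSpace (ModelPi fun i => EuclideanSpace ℝ (Fin (D i))) :=
    inferInstanceAs (LocallyPathConnectedSpace (∀ i, EuclideanSpace ℝ (Fin (D i))))
  exact ChartedSpace.locallyPathConnectedSpace (ModelPi fun i => EuclideanSpace ℝ (Fin (D i))) _

/-! ### The homomorphism from the product of spin groups -/

section SpinProduct

variable {N : ℕ} {D : Fin N → ℕ}

theorem embCl_involute (i : Fin N) (a : Cl (D i)) :
    embCl i (CliffordAlgebra.involute a) = CliffordAlgebra.involute (embCl i a) := by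
  induction a using CliffordAlgebra.induction with
  | algebraMap r => simp
  | ι v =>
    rw [CliffordAlgebra.involute_ι, map_neg, embCl_clVec, CliffordAlgebra.involute_ι]
  | mul a b ha hb => simp only [map_mul, ha, hb]
  | add a b ha hb => simp only [map_add, ha, hb]

theorem embCl_reverse (i : Fin N) (a : Cl (D i)) :
    embCl i (CliffordAlgebra.reverse a) = CliffordAlgebra.reverse (embCl i a) := by
  induction a using CliffordAlgebra.induction with
  | algebraMap r => simp
  | ι v =>
    rw [CliffordAlgebra.reverse_ι, embCl_clVec, CliffordAlgebra.reverse_ι]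
  | mul a b ha hb =>
    rw [CliffordAlgebra.reverse.map_mul, map_mul, map_mul, ha, hb, CliffordAlgebra.reverse.map_mul]
  | add a b ha hb => simp only [map_add, ha, hb]

theorem embCl_star (i : Fin N) (a : Cl (D i)) : embCl i (star a) = star (embCl i a) := by
  rw [CliffordAlgebra.star_def, CliffordAlgebra.star_def, embCl_reverse, embCl_involute]

theorem embCl_mem_even (i : Fin N) {a : Cl (D i)}
    (ha : a ∈ CliffordAlgebra.even (negEuclid (D i))) :
    embCl i a ∈ CliffordAlgebra.even (negEuclid (∑ i, D i)) := by
  refine CliffordAlgebra.even_induction (Q := negEuclid (D i))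
    (motive := fun a _ => embCl i a ∈ CliffordAlgebra.even (negEuclid (∑ i, D i))) ?_ ?_ ?_ a ha
  · intro r
    rw [AlgHom.commutes]
    exact Subalgebra.algebraMap_mem _ r
  · intro x y _ _ hx hy
    rw [map_add]
    exact add_mem hx hy
  · intro v w x _ hx
    rw [map_mul, map_mul]
    refine mul_mem ?_ hx
    erw [embCl_clVec, embCl_clVec]
    exact CliffordAlgebra.ι_mul_ι_mem_evenOdd_zero _ _ _

/-- The Lipschitz group is generated by invertible vectors, and the inclusion of a block sends
vectors to vectors; it also preserves evenness and `star`. -/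
theorem embCl_mem_spin (i : Fin N) {a : Cl (D i)} (ha : a ∈ Spin (D i)) :
    embCl i a ∈ Spin (∑ i, D i) := by
  refine spinGroup.mem_iff.2 ⟨pinGroup.mem_iff.2 ⟨?_, ?_⟩, embCl_mem_even i (spinGroup.mem_even ha)⟩
  · obtain ⟨x, hx, rfl⟩ := pinGroup.mem_lipschitzGroup (spinGroup.mem_pin ha)
    refine ⟨Units.map ((embCl (D := D) i).toRingHom : Cl (D i) →* Cl (∑ i, D i)) x, ?_, rfl⟩
    have h : lipschitzGroup (negEuclid (D i)) ≤ (lipschitzGroup (negEuclid (∑ i, D i))).comap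
        (Units.map ((embCl (D := D) i).toRingHom : Cl (D i) →* Cl (∑ i, D i))) := by
      refine (Subgroup.closure_le _).2 ?_
      rintro y ⟨v, hv⟩
      refine Subgroup.subset_closure ⟨blockVec i v, ?_⟩
      exact (embCl_clVec i v).symm.trans (congrArg (embCl i) hv)
    exact h hx
  · rw [Unitary.mem_iff, ← embCl_star, ← map_mul, ← map_mul, spinGroup.star_mul_self_of_mem ha,
      spinGroup.mul_star_self_of_mem ha, map_one]
    exact ⟨rfl, rfl⟩

/-- The inclusion of the spin group of the block number `i`. -/
def embSpin (i : Fin N) (a : Spin (D i)) : Spin (∑ i, D i) :=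
  ⟨embCl i a, embCl_mem_spin i a.2⟩

theorem list_prod_map_mul_of_commute {ι G : Type*} [Monoid G] (f f' : ι → G)
    (h : ∀ i j, i ≠ j → Commute (f i) (f' j)) (l : List ι) (hl : l.Nodup) :
    (l.map fun i => f i * f' i).prod = (l.map f).prod * (l.map f').prod := by
  induction l with
  | nil => simp
  | cons a l ih =>
    rw [List.nodup_cons] at hl
    have hc : Commute (f' a) (l.map f).prod := Commute.list_prod_right _ _ fun y hy => by
      obtain ⟨i, hi, rfl⟩ := List.mem_map.1 hy
      exact (h i a fun e => hl.1 (e ▸ hi)).symm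
    rw [List.map_cons, List.prod_cons, ih hl.2, List.map_cons, List.map_cons, List.prod_cons,
      List.prod_cons, mul_assoc, mul_assoc, ← mul_assoc (f' a), hc.eq, mul_assoc]

/-- The homomorphism from the product of the groups `Spin(D i)` to `Spin(∑ i, D i)`. -/
def spinProd (s : ∀ i, Spin (D i)) : Spin (∑ i, D i) :=
  ((List.finRange N).map fun i => embSpin i (s i)).prod

theorem coe_spinProd (s : ∀ i, Spin (D i)) :
    (spinProd s : Cl (∑ i, D i)) = ((List.finRange N).map fun i => embCl i (s i : Cl (D i))).prod := by
  rw [spinProd, SubmonoidClass.coe_list_prod, List.map_map]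
  rfl

/-- Even elements from different blocks commute, so the ordered product is multiplicative. -/
theorem spinProd_mul (s t : ∀ i, Spin (D i)) :
    spinProd (fun i => s i * t i) = spinProd s * spinProd t := by
  rw [spinProd, spinProd, spinProd, ← list_prod_map_mul_of_commute]
  · congr 1
    refine List.map_congr_left fun i _ => Subtype.ext ?_
    exact map_mul (embCl i) _ _
  · exact fun i j hij => Subtype.ext (commute_embCl hij (spinGroup.mem_even (s i).2) _)
  · exact List.nodup_finRange N

/-- The product of the spin groups acts blockwise. -/
theorem spinProd_mul_embCl (s : ∀ i, Spin (D i)) (i : Fin N) (a : Cl (D i)) :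
    (spinProd s : Cl (∑ i, D i)) * embCl i a =
      embCl i ((s i : Cl (D i)) * a * star (s i : Cl (D i))) * (spinProd s : Cl (∑ i, D i)) := by
  rw [coe_spinProd]
  -- For a partial product only the block `i` can move `a`, and it does so exactly if `i` already
  -- occurs in the list.
  have key : ∀ l : List (Fin N), l.Nodup →
      (l.map fun i => embCl i (s i : Cl (D i))).prod * embCl i a =
      embCl i (if i ∈ l then (s i : Cl (D i)) * a * star (s i : Cl (D i)) else a) *
        (l.map fun i => embCl i (s i : Cl (D i))).prod := by
    intro l hl
    induction l with
    | nil => simp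
    | cons j l ih =>
      rw [List.nodup_cons] at hl
      rw [List.map_cons, List.prod_cons, mul_assoc, ih hl.2, ← mul_assoc, ← mul_assoc]
      congr 1
      by_cases hij : j = i
      · subst hij
        rw [if_neg hl.1, if_pos List.mem_cons_self, ← map_mul, ← map_mul, mul_assoc, mul_assoc,
          spinGroup.star_mul_self_of_mem (s j).2, mul_one]
      · rw [(commute_embCl hij (spinGroup.mem_even (s j).2) _).eq]
        congr 2
        simp [Ne.symm hij]
  rw [key _ (List.nodup_finRange N), if_pos (List.mem_finRange i)]

variable {E : Type*} [NormedAddCommGroup E] [NormedSpace ℝ E] {H : Type*} [TopologicalSpace H]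
  {I : ModelWithCorners ℝ E H} {M : Type*} [TopologicalSpace M] [ChartedSpace H M]

theorem weakSmoothAt_spinProd {s : M → ∀ i, Spin (D i)} {x : M}
    (hs : ∀ i, WeakSmoothAt I (fun y => (s y i : Cl (D i))) x) :
    WeakSmoothAt I (fun y => (spinProd (s y) : Cl (∑ i, D i))) x := by
  simp only [coe_spinProd]
  induction List.finRange N with
  | nil => simpa using WeakSmoothAt.const (1 : Cl (∑ i, D i))
  | cons i l ih =>
    simp only [List.map_cons, List.prod_cons]
    exact ((hs i).linear (embCl i).toLinearMap).mul ih

end SpinProduct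

/-! ### Smoothness of inverse matrices -/

section MatrixInverse

variable {E : Type*} [NormedAddCommGroup E] [NormedSpace ℝ E] {H : Type*} [TopologicalSpace H]
  {I : ModelWithCorners ℝ E H} {M : Type*} [TopologicalSpace M] [ChartedSpace H M] {n : ℕ} {x : M}

theorem contMDiffAt_det {T : M → Matrix (Fin n) (Fin n) ℝ}
    (hT : ∀ k l, ContMDiffAt I 𝓘(ℝ, ℝ) ∞ (fun y => T y k l) x) :
    ContMDiffAt I 𝓘(ℝ, ℝ) ∞ (fun y => (T y).det) x := by
  simp only [Matrix.det_apply']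
  exact ContMDiffAt.sum fun p _ => contMDiffAt_const.mul (contMDiffAt_finsetProd fun k _ => hT _ _)

/-- Cramer's rule: the entries of the inverse are quotients of determinants. -/
theorem contMDiffAt_inv {T : M → Matrix (Fin n) (Fin n) ℝ}
    (hT : ∀ k l, ContMDiffAt I 𝓘(ℝ, ℝ) ∞ (fun y => T y k l) x) (hx : (T x).det ≠ 0)
    (k l : Fin n) : ContMDiffAt I 𝓘(ℝ, ℝ) ∞ (fun y => (T y)⁻¹ k l) x := by
  have h : ∀ y, (T y)⁻¹ k l = ((T y).det)⁻¹ * (T y).adjugate k l := fun y => by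
    rw [Matrix.inv_def, Ring.inverse_eq_inv', Matrix.smul_apply, smul_eq_mul]
  simp only [h]
  have h1 : ContDiffAt ℝ ∞ (fun r : ℝ => r⁻¹) (T x).det := contDiffAt_inv ℝ hx
  refine ContMDiffAt.mul (h1.contMDiffAt.comp x (contMDiffAt_det hT)) ?_
  simp only [Matrix.adjugate_apply]
  refine contMDiffAt_det fun a b => ?_
  simp only [Matrix.updateRow_apply]
  split_ifs
  · exact contMDiffAt_const
  · exact hT _ _

end MatrixInverse

end

noncomputable section

/-! ### The spin structure of the product -/

theorem finrank_tangentSpace_pi {N : ℕ} {D : Fin N → ℕ} {M : Fin N → Type u}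
    [∀ i, TopologicalSpace (M i)] [∀ i, ChartedSpace (EuclideanSpace ℝ (Fin (D i))) (M i)]
    (x : ∀ i, M i) : Module.finrank ℝ (TangentSpace (prodModel D) x) = ∑ i, D i := by
  change Module.finrank ℝ (∀ i, EuclideanSpace ℝ (Fin (D i))) = _
  rw [Module.finrank_pi_fintype]
  simp

section ProductSpin

variable {N : ℕ} {D : Fin N → ℕ} {M : Fin N → Type u} [∀ i, TopologicalSpace (M i)]
  [∀ i, ChartedSpace (EuclideanSpace ℝ (Fin (D i))) (M i)]
  [∀ i, IsManifold (𝓡 (D i)) ∞ (M i)] {g : ∀ i, SmoothMetric (𝓡 (D i)) (M i)}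
  (σ : ∀ i, SpinStructure (𝓡 (D i)) (g i) (D i))
  {gM : SmoothMetric (prodModel D) (∀ i, M i)}
  (A : ∀ i, ∀ x : (∀ i, M i), TangentSpace (𝓡 (D i)) (x i) →L[ℝ] TangentSpace (𝓡 (D i)) (x i))

/-- The set on which the product of local sections is defined. -/
def prodBase (α : ∀ i, (σ i).Index) : Set (∀ i, M i) :=
  Set.univ.pi fun i => (σ i).baseSet (α i)

theorem isOpen_prodBase (α : ∀ i, (σ i).Index) : IsOpen (prodBase σ α) :=
  isOpen_set_pi Set.finite_univ fun i _ => (σ i).isOpen_baseSet (α i)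

/-- The coordinates of `Aᵢ Xᵢ` in the frames of the factors. -/
def prodCoframe (α : ∀ i, (σ i).Index) (x : ∀ i, M i) :
    TangentSpace (prodModel D) x →ₗ[ℝ] (Fin (∑ i, D i) → ℝ) where
  toFun X k := (g (finSigmaFinEquiv.symm k).1).inner (x (finSigmaFinEquiv.symm k).1)
    ((σ (finSigmaFinEquiv.symm k).1).frame (α (finSigmaFinEquiv.symm k).1)
      (finSigmaFinEquiv.symm k).2 (x (finSigmaFinEquiv.symm k).1))
    (A (finSigmaFinEquiv.symm k).1 x (tangentProj x (finSigmaFinEquiv.symm k).1 X))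
  map_add' X Y := by ext k; simp
  map_smul' r X := by ext k; simp

theorem prodCoframe_apply (α : ∀ i, (σ i).Index) (x : ∀ i, M i)
    (X : TangentSpace (prodModel D) x) (i : Fin N) (a : Fin (D i)) :
    prodCoframe σ A α x X (finSigmaFinEquiv ⟨i, a⟩) =
      (g i).inner (x i) ((σ i).frame (α i) a (x i)) (A i x (tangentProj x i X)) := by
  have h : ∀ p : Σ j, Fin (D j), p = ⟨i, a⟩ →
      (g p.1).inner (x p.1) ((σ p.1).frame (α p.1) p.2 (x p.1)) (A p.1 x (tangentProj x p.1 X)) =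
      (g i).inner (x i) ((σ i).frame (α i) a (x i)) (A i x (tangentProj x i X)) := by
    rintro _ rfl
    rfl
  exact h _ (Equiv.symm_apply_apply _ _)

variable (gM) (g)

/-- The metric on the product comes from the metrics on the factors through the smooth maps `A`. -/
structure IsProductMetric : Prop where
  smooth : ∀ i, ContMDiff (prodModel D).tangent (𝓡 (D i)).tangent ∞
    fun p : TangentBundle (prodModel D) (∀ i, M i) =>
      (⟨p.1 i, A i p.1 (tangentProj p.1 i p.2)⟩ : TangentBundle (𝓡 (D i)) (M i))
  inner_eq : ∀ (x : ∀ i, M i) (X Y : TangentSpace (prodModel D) x),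
    gM.inner x X Y =
      ∑ i, (g i).inner (x i) (A i x (tangentProj x i X)) (A i x (tangentProj x i Y))

variable {gM} {g} {A}

/-- Smoothness of the projection to a factor is contained in the smoothness of `A i` as a map of
tangent bundles: evaluate it on the zero section and take base points. -/
theorem IsProductMetric.contMDiff_apply (h : IsProductMetric g gM A) (i : Fin N) :
    ContMDiff (prodModel D) (𝓡 (D i)) ∞ fun x : ∀ i, M i => x i :=
  (Bundle.contMDiff_proj (TangentSpace (𝓡 (D i)))).comp ((h.smooth i).comp
    (Bundle.contMDiff_zeroSection ℝ (TangentSpace (prodModel D) (M := ∀ i, M i))))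

theorem IsProductMetric.sum_prodCoframe_mul (h : IsProductMetric g gM A) {α : ∀ i, (σ i).Index}
    {x : ∀ i, M i} (hx : x ∈ prodBase σ α) (X Y : TangentSpace (prodModel D) x) :
    ∑ k, prodCoframe σ A α x X k * prodCoframe σ A α x Y k = gM.inner x X Y := by
  rw [sum_block, h.inner_eq]
  refine Finset.sum_congr rfl fun i _ => ?_
  simp only [prodCoframe_apply]
  exact ((σ i).isOrthoFrame (α i) (hx i trivial)).parseval _ _

/-- The coframe is isometric and the metric on the product is positive definite, so invertibility of
the `A i` need not be assumed. -/
theorem IsProductMetric.prodCoframe_injective (h : IsProductMetric g gM A)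
    {α : ∀ i, (σ i).Index} {x : ∀ i, M i} (hx : x ∈ prodBase σ α) :
    Function.Injective (prodCoframe σ A α x) := by
  refine (injective_iff_map_eq_zero _).2 fun X hX => ?_
  by_contra hX0
  have h1 := gM.pos x X hX0
  rw [← h.sum_prodCoframe_mul σ hx, hX] at h1
  simp at h1

/-- The coordinates of `Aᵢ Xᵢ` determine the tangent vector `X`. -/
def prodCoordEquiv (h : IsProductMetric g gM A) {α : ∀ i, (σ i).Index} {x : ∀ i, M i}
    (hx : x ∈ prodBase σ α) :
    TangentSpace (prodModel D) x ≃ₗ[ℝ] (Fin (∑ i, D i) → ℝ) :=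
  have : FiniteDimensional ℝ (TangentSpace (prodModel D) x) :=
    inferInstanceAs (FiniteDimensional ℝ (∀ i, EuclideanSpace ℝ (Fin (D i))))
  LinearMap.linearEquivOfInjective _ (h.prodCoframe_injective σ hx)
    (by rw [finrank_tangentSpace_pi, Module.finrank_fin_fun])

theorem prodCoordEquiv_apply (h : IsProductMetric g gM A) {α : ∀ i, (σ i).Index} {x : ∀ i, M i}
    (hx : x ∈ prodBase σ α) (X : TangentSpace (prodModel D) x) :
    prodCoordEquiv σ h hx X = prodCoframe σ A α x X := rfl

open Classical in
/-- The orthonormal frame of the product that is dual to the coframe. -/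
def prodFrame (h : IsProductMetric g gM A) (α : ∀ i, (σ i).Index) (k : Fin (∑ i, D i))
    (x : ∀ i, M i) : TangentSpace (prodModel D) x :=
  if hx : x ∈ prodBase σ α then (prodCoordEquiv σ h hx).symm (Pi.single k 1) else 0

theorem prodFrame_eq (h : IsProductMetric g gM A) {α : ∀ i, (σ i).Index} {x : ∀ i, M i}
    (hx : x ∈ prodBase σ α) (k : Fin (∑ i, D i)) :
    prodFrame σ h α k x = (prodCoordEquiv σ h hx).symm (Pi.single k 1) :=
  dif_pos hx

theorem prodCoframe_prodFrame (h : IsProductMetric g gM A) {α : ∀ i, (σ i).Index} {x : ∀ i, M i}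
    (hx : x ∈ prodBase σ α) (k : Fin (∑ i, D i)) :
    prodCoframe σ A α x (prodFrame σ h α k x) = Pi.single k 1 := by
  rw [prodFrame_eq σ h hx, ← prodCoordEquiv_apply σ h hx, LinearEquiv.apply_symm_apply]

theorem inner_prodFrame (h : IsProductMetric g gM A) {α : ∀ i, (σ i).Index} {x : ∀ i, M i}
    (hx : x ∈ prodBase σ α) (k : Fin (∑ i, D i)) (Y : TangentSpace (prodModel D) x) :
    gM.inner x (prodFrame σ h α k x) Y = prodCoframe σ A α x Y k := by
  rw [← h.sum_prodCoframe_mul σ hx, prodCoframe_prodFrame σ h hx]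
  simp [Pi.single_apply]

theorem contMDiffAt_prodCoframe (h : IsProductMetric g gM A) {α : ∀ i, (σ i).Index}
    {x : ∀ i, M i} (hx : x ∈ prodBase σ α) {X : ∀ x : (∀ i, M i), TangentSpace (prodModel D) x}
    (hX : ContMDiffAt (prodModel D) (prodModel D).tangent ∞
      (fun y => (⟨y, X y⟩ : TangentBundle (prodModel D) (∀ i, M i))) x) (k : Fin (∑ i, D i)) :
    ContMDiffAt (prodModel D) 𝓘(ℝ, ℝ) ∞ (fun y => prodCoframe σ A α y (X y) k) x := by
  obtain ⟨⟨i, a⟩, rfl⟩ := finSigmaFinEquiv.surjective k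
  simp only [prodCoframe_apply]
  refine contMDiffAt_metric (g i) (b := fun y : ∀ i, M i => y i) ?_ ?_
  · exact ((σ i).contMDiffAt_frame (α i) (hx i trivial) a).comp x (h.contMDiff_apply i x)
  · exact ((h.smooth i).contMDiffAt).comp x hX

/-- In a smooth local frame the coframe is a smooth invertible matrix, and its inverse gives the
coefficients of the dual frame. -/
theorem contMDiffAt_prodFrame (h : IsProductMetric g gM A) {α : ∀ i, (σ i).Index}
    {x : ∀ i, M i} (hx : x ∈ prodBase σ α) (k : Fin (∑ i, D i)) :
    ContMDiffAt (prodModel D) (prodModel D).tangent ∞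
      (fun y => (⟨y, prodFrame σ h α k y⟩ : TangentBundle (prodModel D) (∀ i, M i))) x := by
  let e := trivializationAt (∀ i, EuclideanSpace ℝ (Fin (D i)))
    (TangentSpace (prodModel D) (M := ∀ i, M i)) x
  let b : Module.Basis (Fin (∑ i, D i)) ℝ (∀ i, EuclideanSpace ℝ (Fin (D i))) :=
    Module.finBasisOfFinrankEq ℝ _ (finrank_tangentSpace_pi x)
  have hxe : x ∈ e.baseSet := FiberBundle.mem_baseSet_trivializationAt' x
  have hloc := e.isLocalFrameOn_localFrame_baseSet (prodModel D) ∞ b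
  let T : (∀ i, M i) → Matrix (Fin (∑ i, D i)) (Fin (∑ i, D i)) ℝ := fun y =>
    Matrix.of fun k l => prodCoframe σ A α y (e.localFrame b l y) k
  have hT : ∀ k l, ContMDiffAt (prodModel D) 𝓘(ℝ, ℝ) ∞ (fun y => T y k l) x := fun k l =>
    contMDiffAt_prodCoframe σ h hx (hloc.contMDiffAt e.open_baseSet hxe l) k
  have hdet : ∀ y ∈ prodBase σ α, y ∈ e.baseSet → IsUnit (T y).det := by
    intro y hy hye
    have h1 : T y = LinearMap.toMatrix (hloc.toBasisAt hye) (Pi.basisFun ℝ _)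
        (prodCoordEquiv σ h hy).toLinearMap := by
      ext k l
      rw [LinearMap.toMatrix_apply, hloc.toBasisAt_coe hye]
      rfl
    rw [h1]
    exact LinearEquiv.isUnit_det _ _ _
  have hsum : ContMDiffAt (prodModel D) (prodModel D).tangent ∞
      (fun y => (⟨y, ∑ l, (T y)⁻¹ l k • e.localFrame b l y⟩ :
        TangentBundle (prodModel D) (∀ i, M i))) x :=
    ContMDiffAt.sum_section fun l _ => ContMDiffAt.smul_section
      (contMDiffAt_inv hT (hdet x hx hxe).ne_zero l k) (hloc.contMDiffAt e.open_baseSet hxe l)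
  refine hsum.congr_of_eventuallyEq ?_
  filter_upwards [(isOpen_prodBase σ α).mem_nhds hx, e.open_baseSet.mem_nhds hxe] with y hy hye
  refine congrArg (TotalSpace.mk y) (h.prodCoframe_injective σ hy ?_)
  rw [prodCoframe_prodFrame σ h hy, map_sum]
  ext m
  have h1 : (T y * (T y)⁻¹) m k = (1 : Matrix _ _ ℝ) m k := by
    rw [Matrix.mul_nonsing_inv _ (hdet y hy hye)]
  rw [Matrix.mul_apply, Matrix.one_apply] at h1
  rw [Finset.sum_apply, Pi.single_apply, ← h1]
  refine Finset.sum_congr rfl fun l _ => ?_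
  rw [map_smul, Pi.smul_apply, smul_eq_mul, mul_comm]
  rfl

theorem isLocalFrameOn_prodFrame (h : IsProductMetric g gM A) (α : ∀ i, (σ i).Index) :
    IsLocalFrameOn (prodModel D) (∀ i, EuclideanSpace ℝ (Fin (D i))) ∞ (prodFrame σ h α)
      (prodBase σ α) where
  linearIndependent {x} hx := by
    have h1 : (prodFrame σ h α · x) =
        (Pi.basisFun ℝ _).map (prodCoordEquiv σ h hx).symm := by
      funext k
      simp [prodFrame_eq σ h hx]
    rw [h1]
    exact Module.Basis.linearIndependent _
  generating {x} hx := by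
    have h1 : (prodFrame σ h α · x) =
        (Pi.basisFun ℝ _).map (prodCoordEquiv σ h hx).symm := by
      funext k
      simp [prodFrame_eq σ h hx]
    rw [h1]
    exact (Module.Basis.span_eq _).ge
  contMDiffOn k x hx := (contMDiffAt_prodFrame σ h hx k).contMDiffWithinAt

/-- The frames of the product transform blockwise. -/
theorem prodCoframe_prodFrame_block (h : IsProductMetric g gM A) {α β : ∀ i, (σ i).Index}
    {x : ∀ i, M i} (hβ : x ∈ prodBase σ β) (j : Fin N) (b : Fin (D j)) :
    prodCoframe σ A α x (prodFrame σ h β (finSigmaFinEquiv ⟨j, b⟩) x) =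
      blockVec j fun a => (g j).inner (x j) ((σ j).frame (α j) a (x j))
        ((σ j).frame (β j) b (x j)) := by
  ext k
  obtain ⟨⟨i, a⟩, rfl⟩ := finSigmaFinEquiv.surjective k
  rw [prodCoframe_apply, blockVec_apply]
  -- By duality, `A i` maps the frame vector number (j, b) to the vector number b of the β-frame if
  -- i = j and to zero otherwise; Parseval in the β-frame then gives its α-coordinates.
  have h1 : ∀ c, (g i).inner (x i) ((σ i).frame (β i) c (x i)) (A i x (tangentProj x i
      (prodFrame σ h β (finSigmaFinEquiv ⟨j, b⟩) x))) =
      if (⟨i, c⟩ : Σ i, Fin (D i)) = ⟨j, b⟩ then 1 else 0 := fun c => by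
    rw [← prodCoframe_apply, prodCoframe_prodFrame σ h hβ, Pi.single_apply]
    simp only [EmbeddingLike.apply_eq_iff_eq]
  rw [← ((σ i).isOrthoFrame (β i) (hβ i trivial)).parseval]
  simp only [h1]
  by_cases hij : i = j
  · subst hij
    simp [(g i).symm (x i)]
  · simp [hij]

/-- The spin structure of the product. -/
def prodSpinStructure (h : IsProductMetric g gM A) :
    SpinStructure (prodModel D) gM (∑ i, D i) where
  Index := ∀ i, (σ i).Index
  baseSet := prodBase σ
  isOpen_baseSet := isOpen_prodBase σ
  indexAt x i := (σ i).indexAt (x i)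
  mem_baseSet_at x i _ := (σ i).mem_baseSet_at (x i)
  frame := prodFrame σ h
  isLocalFrameOn := isLocalFrameOn_prodFrame σ h
  orthonormal α x hx a b := by
    rw [inner_prodFrame σ h hx, prodCoframe_prodFrame σ h hx, Pi.single_apply]
  lift α β x := spinProd fun i => (σ i).lift (α i) (β i) (x i)
  lift_smooth α β φ x hx := ContMDiffAt.contMDiffWithinAt <|
    weakSmoothAt_spinProd (I := prodModel D)
      (s := fun (y : ∀ i, M i) i => (σ i).lift (α i) (β i) (y i)) (fun i ψ =>
        ContMDiffAt.comp x (g := fun z => ψ ((σ i).lift (α i) (β i) z)) (f := fun y => y i)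
          ((σ i).weakSmoothAt_lift (α i) (β i) ⟨hx.1 i trivial, hx.2 i trivial⟩ ψ)
          (h.contMDiff_apply i x)) φ
  lift_cocycle α β γ x hx := by
    rw [← spinProd_mul]
    congr 1
    funext i
    exact (σ i).lift_cocycle _ _ _ _ ⟨⟨hx.1.1 i trivial, hx.1.2 i trivial⟩, hx.2 i trivial⟩
  lift_covers α β x hx k := by
    obtain ⟨⟨j, b⟩, rfl⟩ := finSigmaFinEquiv.surjective k
    simp only [inner_prodFrame σ h hx.1]
    -- The change of frames stays inside block `j`, where the product of lifts acts by conjugation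
    -- with its own `j`th component; this reduces to the covering condition of the factor.
    rw [← clVec_eq_sum, prodCoframe_prodFrame_block σ h hx.2, ← embCl_clVec, ← embCl_clE,
      spinProd_mul_embCl, mul_assoc, ← spinGroup.star_eq_inv, spinGroup.coe_star,
      spinGroup.mul_star_self_of_mem (spinProd _).2, mul_one]
    congr 1
    have := (σ j).lift_covers (α j) (β j) (x j) ⟨hx.1 j trivial, hx.2 j trivial⟩ b
    rw [← spinGroup.star_eq_inv, spinGroup.coe_star] at this
    rw [this, clVec_eq_sum]

end ProductSpin

end

noncomputable section

/-! ### Smooth homomorphisms of vector bundles in local coordinates -/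

section BundleHom

variable {E : Type*} [NormedAddCommGroup E] [NormedSpace ℝ E] {H : Type*} [TopologicalSpace H]
  {I : ModelWithCorners ℝ E H} {B : Type*} [TopologicalSpace B] [ChartedSpace H B]

theorem WeakSmoothAt.comp {E' : Type*} [NormedAddCommGroup E'] [NormedSpace ℝ E'] {H' : Type*}
    [TopologicalSpace H'] {I' : ModelWithCorners ℝ E' H'} {B' : Type*} [TopologicalSpace B']
    [ChartedSpace H' B'] {F : Type*} [AddCommGroup F] [Module ℝ F] {f : B → F} {h : B' → B} (x : B')
    (hf : WeakSmoothAt I f (h x)) (hh : ContMDiffAt I' I ∞ h x) :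
    WeakSmoothAt I' (fun y => f (h y)) x := fun φ =>
  ContMDiffAt.comp x (g := fun z => φ (f z)) (hf φ) hh

variable {F F' : Type*} [NormedAddCommGroup F] [NormedSpace ℂ F] [FiniteDimensional ℂ F]
  [NormedAddCommGroup F'] [NormedSpace ℂ F'] [FiniteDimensional ℂ F'] {ι ι' : Type*}

/-- A map of vector bundles that is given by smooth matrices in local coordinates is smooth. -/
theorem contMDiff_bundleHom (Z : VectorBundleCore ℂ B F ι) (Z' : VectorBundleCore ℂ B F' ι')
    (Φ : ∀ x, Z.Fiber x → Z'.Fiber x)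
    (hΦ : ∀ x₀, ∃ L : B → F →ₗ[ℝ] F', WeakSmoothAt I L x₀ ∧ ∀ᶠ y in 𝓝 x₀, ∀ ψ : Z.Fiber y,
      Z'.coordChange (Z'.indexAt y) (Z'.indexAt x₀) y (Φ y ψ) =
        L y (Z.coordChange (Z.indexAt y) (Z.indexAt x₀) y ψ)) :
    ContMDiff (I.prod 𝓘(ℝ, F)) (I.prod 𝓘(ℝ, F')) ∞
      fun p : TotalSpace F Z.Fiber => TotalSpace.mk' F' (E := Z'.Fiber) p.1 (Φ p.1 p.2) := by
  have : FiniteDimensional ℝ F := FiniteDimensional.complexToReal F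
  have : FiniteDimensional ℝ F' := FiniteDimensional.complexToReal F'
  intro p₀
  obtain ⟨L, hL, hLΦ⟩ := hΦ p₀.1
  have hproj : ContMDiffAt (I.prod 𝓘(ℝ, F)) I ∞ (fun p : TotalSpace F Z.Fiber => p.1) p₀ :=
    Bundle.contMDiffAt_proj Z.Fiber
  have hcoord := (Bundle.contMDiffAt_totalSpace.1
    (contMDiffAt_id (I := I.prod 𝓘(ℝ, F)) (n := ∞) (x := p₀))).2
  refine Bundle.contMDiffAt_totalSpace.2 ⟨hproj, ?_⟩
  have h1 : WeakSmoothAt (I.prod 𝓘(ℝ, F)) (fun p : TotalSpace F Z.Fiber =>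
      L p.1 (Z.coordChange (Z.indexAt p.1) (Z.indexAt p₀.1) p.1 p.2)) p₀ :=
    -- Evaluation of a linear map at a vector is bilinear, so the smooth matrix and the smooth fibre
    -- coordinate combine.
    WeakSmoothAt.bilinear LinearMap.id (hL.comp p₀ hproj) (WeakSmoothAt.of_contMDiffAt hcoord)
  refine h1.contMDiffAt.congr_of_eventuallyEq ?_
  filter_upwards [hproj.continuousAt.eventually hLΦ] with p hp
  exact hp p.2

end BundleHom

/-! ### The isomorphism -/

section Equivariance

variable {N : ℕ} {D : Fin N → ℕ} {V : Fin N → Type v} [∀ i, NormedAddCommGroup (V i)]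
  [∀ i, NormedSpace ℂ (V i)]

theorem list_prod_singleMap {ι : Type*} [DecidableEq ι] {s : ι → Type*}
    [∀ i, AddCommGroup (s i)] [∀ i, Module ℂ (s i)] (f : ∀ i, Module.End ℂ (s i)) (l : List ι)
    (hl : l.Nodup) :
    (l.map fun i => singleMap i (f i)).prod =
      PiTensorProduct.map fun i => if i ∈ l then f i else 1 := by
  induction l with
  | nil => simp [PiTensorProduct.map_one]
  | cons a l ih =>
    rw [List.nodup_cons] at hl
    rw [List.map_cons, List.prod_cons, ih hl.2, singleMap_apply, ← PiTensorProduct.map_mul]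
    congr 1
    funext j
    by_cases hj : j = a
    · subst hj
      simp [hl.1]
    · simp [hj]

variable {ρ : ∀ i, ClRep (D i) (V i)} {K : Finset (Fin N)} {V' : Type w} [NormedAddCommGroup V']
  [NormedSpace ℂ V'] {ρ' : ClRep (∑ i, D i) V'}

/-- Elements of each Spin(Dᵢ) are even, so compatibility of Ψ with the even parts becomes
equivariance under the product of the spin groups. This lets Ψ glue over the product spin structure.
-/
theorem fiberS_equiv_spinProd {Ψ : V' ≃ₗ[ℂ] fiberS ρ K}
    (hΨ : ∀ i, ∀ a ∈ CliffordAlgebra.even (negEuclid (D i)), ∀ ξ,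
      (Ψ (ρ' (embCl i a) ξ) : ⨂[ℂ] i, (ρ i).Graded) =
        singleMap i ((ρ i).gradedRep a) (Ψ ξ : ⨂[ℂ] i, (ρ i).Graded))
    (s : ∀ i, Spin (D i)) (ξ : V') :
    (Ψ (ρ' (spinProd s : Cl (∑ i, D i)) ξ) : ⨂[ℂ] i, (ρ i).Graded) =
      PiTensorProduct.map (fun i => (ρ i).gradedRep (s i : Cl (D i)))
        (Ψ ξ : ⨂[ℂ] i, (ρ i).Graded) := by
  have key : ∀ l : List (Fin N), ∀ ξ,
      (Ψ (ρ' (l.map fun i => embCl i (s i : Cl (D i))).prod ξ) : ⨂[ℂ] i, (ρ i).Graded) =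
        (l.map fun i => singleMap i ((ρ i).gradedRep (s i : Cl (D i)))).prod
          (Ψ ξ : ⨂[ℂ] i, (ρ i).Graded) := by
    intro l
    induction l with
    | nil => simp
    | cons i l ih =>
      intro ξ
      rw [List.map_cons, List.prod_cons, map_mul, Module.End.mul_apply,
        hΨ i _ (spinGroup.mem_even (s i).2), ih, List.map_cons, List.prod_cons,
        Module.End.mul_apply]
  rw [coe_spinProd, key, list_prod_singleMap _ _ (List.nodup_finRange N)]
  simp

end Equivariance

section Main

variable {N : ℕ} {D : Fin N → ℕ} {M : Fin N → Type u} [∀ i, TopologicalSpace (M i)]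
  [∀ i, ChartedSpace (EuclideanSpace ℝ (Fin (D i))) (M i)]
  [∀ i, IsManifold (𝓡 (D i)) ∞ (M i)] {g : ∀ i, SmoothMetric (𝓡 (D i)) (M i)}
  (σ : ∀ i, SpinStructure (𝓡 (D i)) (g i) (D i))
  {V : Fin N → Type v} [∀ i, NormedAddCommGroup (V i)] [∀ i, NormedSpace ℂ (V i)]
  [∀ i, FiniteDimensional ℂ (V i)] (ρ : ∀ i, ClRep (D i) (V i))

/-- A spin element acts on both halves in the same way, and for even elements this agrees with the
graded representation, in which vectors exchange the halves. -/
theorem coordChange_bundleS (K : Finset (Fin N)) (α β : ∀ i, (σ i).Index) (x : ∀ i, M i)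
    (t : fiberS ρ K) :
    ((bundleS σ ρ K).coordChange α β x t : ⨂[ℂ] i, (ρ i).Graded) =
      PiTensorProduct.map (fun i => (ρ i).gradedRep ((σ i).lift (β i) (α i) (x i) : Cl (D i)))
        (t : ⨂[ℂ] i, (ρ i).Graded) := by
  change PiTensorProduct.map (fun i => (((σ i).gradedSpinorBundle (ρ i)).coordChange (α i) (β i)
    (x i)).toLinearMap) (t : ⨂[ℂ] i, (ρ i).Graded) = _
  congr 2
  funext i
  refine LinearMap.ext fun ξ => ?_
  have h := (ρ i).gradedRep_of_mem_even (spinGroup.mem_even ((σ i).lift (β i) (α i) (x i)).2) ξ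
  exact ClRep.graded_ext h.1.symm h.2.symm

theorem ClRep.gradedVec_zero {n : ℕ} {V : Type v} [NormedAddCommGroup V] [NormedSpace ℂ V]
    (ρ : ClRep n V) : ρ.gradedVec 0 = 0 :=
  map_zero ρ.gradedLin

variable (A : ∀ i, ∀ x : (∀ i, M i),
  TangentSpace (𝓡 (D i)) (x i) →L[ℝ] TangentSpace (𝓡 (D i)) (x i))

/-- The Clifford multiplication by a vector tangent to one factor. -/
theorem cliffordMulW_of_factor {x : ∀ i, M i} {i : Fin N} {X : TangentSpace (prodModel D) x}
    (hX : ∀ j, j ≠ i → tangentProj x j X = 0) :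
    cliffordMulW σ ρ A x X = PiTensorProduct.map (Function.update
      (fun j => if j < i then (ρ j).parity else 1) i
      ((ρ i).gradedVec ((σ i).frameCoord (x i) (A i x (tangentProj x i X))))) := by
  unfold cliffordMulW
  refine (Finset.sum_eq_single i (fun k _ hk => ?_) (by simp)).trans ?_
  · refine PiTensorProduct.ext (MultilinearMap.ext fun ξ => ?_)
    simp only [LinearMap.compMultilinearMap_apply, PiTensorProduct.map_tprod]
    refine MultilinearMap.map_coord_zero _ k ?_
    have h0 : (σ k).frameCoord (x k) (A k x (tangentProj x k X)) = 0 := by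
      funext a
      simp [SpinStructure.frameCoord, hX k hk]
    simp [h0, ClRep.gradedVec_zero]
  · congr 1
    funext j
    by_cases hj : j = i
    · subst hj
      simp
    · simp [hj]
      rfl

/-- In `W` a vector carries the parities of all factors in front, on `S` only of the even
dimensional ones. In a product of two vectors of one factor either set of parities squares to the
identity, so both give the same operator. -/
theorem cliffordMulW_mul_of_factor {x : ∀ i, M i} {i : Fin N}
    {X Y : TangentSpace (prodModel D) x} (hX : ∀ j, j ≠ i → tangentProj x j X = 0)
    (hY : ∀ j, j ≠ i → tangentProj x j Y = 0) (t : ⨂[ℂ] i, (ρ i).Graded) :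
    cliffordMulW σ ρ A x X (cliffordMulW σ ρ A x Y t) =
      singleMap i ((ρ i).gradedRep
        (clVec ((σ i).frameCoord (x i) (A i x (tangentProj x i X))) *
          clVec ((σ i).frameCoord (x i) (A i x (tangentProj x i Y))))) t := by
  rw [map_mul, ClRep.gradedRep_clVec, ClRep.gradedRep_clVec,
    ← map_update_mul_map_update (b := fun j => if j < i then (ρ j).parity else 1),
    cliffordMulW_of_factor σ ρ A hX, cliffordMulW_of_factor σ ρ A hY]
  · rfl
  · intro j
    split_ifs
    · exact (ρ j).parity_mul_self
    · exact one_mul 1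

end Main

end

/-! ### Products of two vectors under a change of orthonormal frames -/

noncomputable section

section Intertwining

variable {E : Type*} [NormedAddCommGroup E] [NormedSpace ℝ E] {H : Type*} [TopologicalSpace H]
  {I : ModelWithCorners ℝ E H} {M : Type u} [TopologicalSpace M] [ChartedSpace H M]
  [IsManifold I ∞ M] {g : SmoothMetric I M} {n : ℕ}

/-- A lift of a change of frames intertwines products of two vectors. -/
theorem IsUnitLift.mul_clVec_mul_clVec {x : M} {f f' : Fin n → TangentSpace I x}
    (hf : IsOrthoFrame g f) {s : Cl n} (hs : IsUnitLift (frameChange g f f') s)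
    (X Y : TangentSpace I x) :
    s * (clVec (fun a => g.inner x (f a) X) * clVec fun a => g.inner x (f a) Y) =
      (clVec (fun a => g.inner x (f' a) X) * clVec fun a => g.inner x (f' a) Y) * s := by
  have h1 : ∀ X, s * clVec (fun a => g.inner x (f a) X) =
      clVec (fun a => g.inner x (f' a) X) * CliffordAlgebra.involute s := by
    intro X
    rw [hs.lift.mul_clVec, clVec_eq_sum fun a => g.inner x (f' a) X]
    congr 1
    simp only [frameChange, Finset.smul_sum, smul_smul]
    rw [Finset.sum_comm]
    refine Finset.sum_congr rfl fun c _ => ?_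
    rw [← Finset.sum_smul, ← hf.parseval]
    congr 1
    exact Finset.sum_congr rfl fun b _ => by rw [g.symm x (f' c), mul_comm]
  -- Applying the involution to `h1` exchanges `s` and its involute, so two vectors in succession
  -- bring back `s` itself, be it even or odd.
  have h2 : CliffordAlgebra.involute s * clVec (fun a => g.inner x (f a) Y) =
      clVec (fun a => g.inner x (f' a) Y) * s := by
    have := congrArg CliffordAlgebra.involute (h1 Y)
    rwa [map_mul, map_mul, CliffordAlgebra.involute_involute, CliffordAlgebra.involute_ι,
      CliffordAlgebra.involute_ι, mul_neg, neg_mul, neg_inj] at this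
  rw [← mul_assoc, h1, mul_assoc, h2, mul_assoc]

end Intertwining

/-! ### Construction of the isomorphism of bundles -/

section MainIso

variable {N : ℕ} {D : Fin N → ℕ} {M : Fin N → Type u} [∀ i, TopologicalSpace (M i)]
  [∀ i, ChartedSpace (EuclideanSpace ℝ (Fin (D i))) (M i)]
  [∀ i, IsManifold (𝓡 (D i)) ∞ (M i)] {g : ∀ i, SmoothMetric (𝓡 (D i)) (M i)}
  (σ : ∀ i, SpinStructure (𝓡 (D i)) (g i) (D i))
  {V : Fin N → Type v} [∀ i, NormedAddCommGroup (V i)] [∀ i, NormedSpace ℂ (V i)]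
  [∀ i, FiniteDimensional ℂ (V i)] {ρ : ∀ i, ClRep (D i) (V i)}
  {gM : SmoothMetric (prodModel D) (∀ i, M i)}
  {A : ∀ i, ∀ x : (∀ i, M i), TangentSpace (𝓡 (D i)) (x i) →L[ℝ] TangentSpace (𝓡 (D i)) (x i)}

/-- The coordinates of a vector tangent to one factor form a single block. -/
theorem prodCoframe_of_factor {α : ∀ i, (σ i).Index} {x : ∀ i, M i} {i : Fin N}
    {X : TangentSpace (prodModel D) x} (hX : ∀ j, j ≠ i → tangentProj x j X = 0) :
    prodCoframe σ A α x X = blockVec i fun a =>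
      (g i).inner (x i) ((σ i).frame (α i) a (x i)) (A i x (tangentProj x i X)) := by
  ext k
  obtain ⟨⟨j, b⟩, rfl⟩ := finSigmaFinEquiv.surjective k
  rw [prodCoframe_apply, blockVec_apply]
  by_cases hj : j = i
  · subst hj
    simp
  · simp [hj, hX j hj]

variable {V' : Type w} [NormedAddCommGroup V'] [NormedSpace ℂ V'] [FiniteDimensional ℂ V']
  {ρ' : ClRep (∑ i, D i) V'} {K : Finset (Fin N)}

/-- A unit of the Clifford algebra acts by an isomorphism. -/
def unitAction (ρ' : ClRep (∑ i, D i) V') {s : Cl (∑ i, D i)} (h₁ : s * star s = 1)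
    (h₂ : star s * s = 1) : V' ≃ₗ[ℂ] V' :=
  LinearEquiv.ofLinearMap (ρ' s) (ρ' (star s))
    (by rw [← Module.End.mul_eq_comp, ← map_mul, h₁, map_one]; rfl)
    (by rw [← Module.End.mul_eq_comp, ← map_mul, h₂, map_one]; rfl)

/-- In the preferred sections Φ is Ψ ∘ ρ'(s), with s the global lift from `τ` to the product spin
structure. In the sections at a fixed point it is Ψ ∘ ρ'(transported s), because Ψ carries the spin
cocycle of the product to the coordinate changes of `S`; the transported s is smooth, hence so is Φ.
-/
theorem exists_smoothBundleIso [∀ i, SimplyConnectedSpace (M i)] (h : IsProductMetric g gM A)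
    (τ : SpinStructure (prodModel D) gM (∑ i, D i)) {Ψ : V' ≃ₗ[ℂ] fiberS ρ K}
    (hΨ : ∀ i, ∀ a ∈ CliffordAlgebra.even (negEuclid (D i)), ∀ ξ,
      (Ψ (ρ' (embCl i a) ξ) : ⨂[ℂ] i, (ρ i).Graded) =
        singleMap i ((ρ i).gradedRep a) (Ψ ξ : ⨂[ℂ] i, (ρ i).Graded)) :
    ∃ Φ : SmoothBundleIso (prodModel D) (τ.spinorBundle ρ') (bundleS σ ρ K),
      ∀ (x : ∀ i, M i) (i : Fin N) (X Y : TangentSpace (prodModel D) x),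
        (∀ j, j ≠ i → tangentProj x j X = 0) → (∀ j, j ≠ i → tangentProj x j Y = 0) →
        ∀ ψ : (τ.spinorBundle ρ').Fiber x,
          inclS σ ρ K x (Φ.fiberEquiv x (τ.cliffordMul ρ' x X (τ.cliffordMul ρ' x Y ψ))) =
            cliffordMulW σ ρ A x X
              (cliffordMulW σ ρ A x Y (inclS σ ρ K x (Φ.fiberEquiv x ψ))) := by
  have := simplyConnectedSpace_pi (X := M)
  have := locallyPathConnectedSpace_pi (D := D) M
  let σ' := prodSpinStructure σ h
  obtain ⟨s, hs, hsm⟩ := τ.exists_global_lift σ'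
  let Φ : ∀ x, (τ.spinorBundle ρ').Fiber x ≃ₗ[ℂ] (bundleS σ ρ K).Fiber x := fun x =>
    (unitAction ρ' (hs x).mul_star (hs x).star_mul).trans Ψ
  have hcc : ∀ α β x (ξ : V'), (bundleS σ ρ K).coordChange α β x (Ψ ξ) =
      Ψ (ρ' (σ'.lift β α x : Cl (∑ i, D i)) ξ) := fun α β x ξ => Subtype.ext <| by
    rw [coordChange_bundleS]
    exact (fiberS_equiv_spinProd hΨ _ ξ).symm
  let S : (∀ i, M i) → (∀ i, M i) → Cl (∑ i, D i) := fun x₀ y =>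
    SpinStructure.transport τ σ' (τ.indexAt y) (τ.indexAt x₀) (σ'.indexAt y) (σ'.indexAt x₀) y (s y)
  have hloc : ∀ x₀, ∀ᶠ y in 𝓝 x₀, (y ∈ τ.baseSet (τ.indexAt x₀)) ∧
      y ∈ σ'.baseSet (σ'.indexAt x₀) := fun x₀ =>
    Filter.inter_mem ((τ.isOpen_baseSet _).mem_nhds (τ.mem_baseSet_at x₀))
      ((σ'.isOpen_baseSet _).mem_nhds (σ'.mem_baseSet_at x₀))
  -- The transition of `τ` contained in `S x₀ y` cancels against the coordinate change of the spinor
  -- bundle.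
  have hlocal : ∀ x₀ y, y ∈ τ.baseSet (τ.indexAt x₀) → ∀ ψ : V',
      (bundleS σ ρ K).coordChange ((bundleS σ ρ K).indexAt y) ((bundleS σ ρ K).indexAt x₀) y
        (Φ y ψ) = Ψ (ρ' (S x₀ y) ((τ.spinorBundle ρ').coordChange
          ((τ.spinorBundle ρ').indexAt y) ((τ.spinorBundle ρ').indexAt x₀) y ψ)) := by
    intro x₀ y hy ψ
    refine (hcc _ _ y (ρ' (s y) ψ)).trans (congrArg Ψ ?_)
    change ρ' _ (ρ' (s y) ψ) = ρ' (S x₀ y) (ρ' (τ.lift (τ.indexAt x₀) (τ.indexAt y) y :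
      Cl (∑ i, D i)) ψ)
    rw [← Module.End.mul_apply, ← Module.End.mul_apply, ← map_mul, ← map_mul]
    congr 2
    simp only [S, SpinStructure.transport]
    rw [mul_assoc _ _ (τ.lift (τ.indexAt x₀) (τ.indexAt y) y : Cl (∑ i, D i)),
      τ.lift_mul_lift _ _ _ (τ.mem_baseSet_at y) hy (τ.mem_baseSet_at y),
      τ.lift_self _ _ (τ.mem_baseSet_at y)]
    exact (mul_one _).symm
  have hSunit : ∀ x₀ y, y ∈ τ.baseSet (τ.indexAt x₀) → y ∈ σ'.baseSet (σ'.indexAt x₀) →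
      star (S x₀ y) * S x₀ y = 1 := fun x₀ y hy hy' =>
    (SpinStructure.isUnitLift_transport ⟨τ.mem_baseSet_at y, σ'.mem_baseSet_at y⟩ ⟨hy, hy'⟩
      (hs y)).star_mul
  let R : Cl (∑ i, D i) →ₗ[ℝ] V' →ₗ[ℝ] V' :=
    (LinearMap.restrictScalarsₗ ℝ ℂ V' V' ℝ).comp ρ'.toLinearMap
  refine ⟨⟨Φ, ?_, ?_⟩, ?_⟩
  · refine contMDiff_bundleHom _ _ (fun x => Φ x) fun x₀ =>
      ⟨fun y => (Ψ.toLinearMap.restrictScalars ℝ).comp (R (S x₀ y)), ?_, ?_⟩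
    · exact (hsm x₀).linear (G := V' →ₗ[ℝ] fiberS ρ K) ((LinearMap.llcomp ℝ V' V' (fiberS ρ K)
        (Ψ.toLinearMap.restrictScalars ℝ)).comp R)
    · filter_upwards [hloc x₀] with y hy ψ
      exact hlocal x₀ y hy.1 ψ
  -- The inverse of the unit `S x₀ y` is its `star`, which is linear, so the inverse map is smooth
  -- for the same reason.
  · refine contMDiff_bundleHom _ _ (fun x => (Φ x).symm) fun x₀ =>
      ⟨fun y => (R (star (S x₀ y))).comp (Ψ.symm.toLinearMap.restrictScalars ℝ), ?_, ?_⟩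
    · exact (hsm x₀).clStar.linear (G := fiberS ρ K →ₗ[ℝ] V') (((LinearMap.llcomp ℝ (fiberS ρ K) V' V').flip
        (Ψ.symm.toLinearMap.restrictScalars ℝ)).comp R)
    · filter_upwards [hloc x₀] with y hy η
      obtain ⟨ψ, rfl⟩ := (Φ y).surjective η
      refine Eq.trans ?_
        (congrArg (fun t => ρ' (star (S x₀ y)) (Ψ.symm t)) (hlocal x₀ y hy.1 ψ)).symm
      rw [LinearEquiv.symm_apply_apply, LinearEquiv.symm_apply_apply, ← Module.End.mul_apply, ← map_mul,
        hSunit x₀ y hy.1 hy.2, map_one]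
      rfl
  -- The lift s moves the product of the two vectors from the frame of `τ` to the product frame,
  -- where it is an even element of block `i`; Ψ then carries it to the factor `i` of the tensor
  -- product.
  · intro x i X Y hX hY ψ
    refine Eq.trans ?_ (cliffordMulW_mul_of_factor σ ρ A hX hY _).symm
    change (Ψ (ρ' (s x) (ρ' (clVec (τ.frameCoord x X)) (ρ' (clVec (τ.frameCoord x Y)) ψ))) :
      ⨂[ℂ] i, (ρ i).Graded) = singleMap i _ (Ψ (ρ' (s x) ψ) : ⨂[ℂ] i, (ρ i).Graded)
    have hfc : ∀ X : TangentSpace (prodModel D) x, (∀ j, j ≠ i → tangentProj x j X = 0) →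
        (clVec fun a => gM.inner x (σ'.frame (σ'.indexAt x) a x) X) =
        embCl i (clVec ((σ i).frameCoord (x i) (A i x (tangentProj x i X)))) := by
      intro X hX
      rw [embCl_clVec]
      refine congrArg clVec ?_
      refine Eq.trans ?_ (prodCoframe_of_factor σ (α := σ'.indexAt x) hX)
      funext a
      exact inner_prodFrame σ h (σ'.mem_baseSet_at x) a X
    have key := (hs x).mul_clVec_mul_clVec (τ.isOrthoFrame _ (τ.mem_baseSet_at x)) X Y
    rw [hfc X hX, hfc Y hY] at key
    rw [← hΨ i _ (CliffordAlgebra.ι_mul_ι_mem_evenOdd_zero _ _ _)]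
    refine congrArg (fun ξ => (Ψ ξ : ⨂[ℂ] i, (ρ i).Graded)) ?_
    have := LinearMap.congr_fun (congrArg ρ' key) ψ
    rw [map_mul ρ', map_mul ρ', map_mul ρ', map_mul ρ'] at this
    rw [map_mul (embCl i), map_mul ρ']
    exact this

end MainIso

end

/-! ### The theorem -/

theorem theorem3 {N : ℕ} {D : Fin N → ℕ}
    -- the simply connected manifolds `M i` of dimension `D i`, with metrics and spin structures
    (M : Fin N → Type u) [∀ i, TopologicalSpace (M i)]
    [∀ i, T2Space (M i)] [∀ i, SecondCountableTopology (M i)]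
    [∀ i, ChartedSpace (EuclideanSpace ℝ (Fin (D i))) (M i)]
    [∀ i, IsManifold (𝓡 (D i)) ∞ (M i)] [∀ i, SimplyConnectedSpace (M i)]
    (g : ∀ i, SmoothMetric (𝓡 (D i)) (M i))
    (σ : ∀ i, SpinStructure (𝓡 (D i)) (g i) (D i))
    -- the spinor modules that define the spinor bundles of the factors
    {V : Fin N → Type v} [∀ i, NormedAddCommGroup (V i)] [∀ i, NormedSpace ℂ (V i)]
    [∀ i, FiniteDimensional ℂ (V i)] (ρ : ∀ i, ClRep (D i) (V i))
    (hρ : ∀ i, (ρ i).IsSpinorModule)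
    -- the metric on the product, related to the `g i` by the smooth maps `A i`
    (gM : SmoothMetric (prodModel D) (∀ i, M i))
    (A : ∀ i, ∀ x : (∀ i, M i), TangentSpace (𝓡 (D i)) (x i) →L[ℝ] TangentSpace (𝓡 (D i)) (x i))
    (hA : ∀ i, ContMDiff (prodModel D).tangent (𝓡 (D i)).tangent ∞
      fun p : TangentBundle (prodModel D) (∀ i, M i) =>
        (⟨p.1 i, A i p.1 (tangentProj p.1 i p.2)⟩ : TangentBundle (𝓡 (D i)) (M i)))
    (hgM : ∀ (x : ∀ i, M i) (X Y : TangentSpace (prodModel D) x),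
      gM.inner x X Y =
        ∑ i, (g i).inner (x i) (A i x (tangentProj x i X)) (A i x (tangentProj x i Y)))
    -- the choice of the odd dimensional factors that are diagonalized
    (K : Finset (Fin N)) (hK : K ⊆ Finset.univ.filter fun i => Odd (D i))
    (hKcard : K.card = (Finset.univ.filter fun i => Odd (D i)).card -
      (Finset.univ.filter fun i => Odd (D i)).card / 2) :
    Nonempty (SpinStructure (prodModel D) gM (∑ i, D i)) ∧
      ∀ (τ : SpinStructure (prodModel D) gM (∑ i, D i))
        {V' : Type w} [NormedAddCommGroup V'] [NormedSpace ℂ V'] [FiniteDimensional ℂ V']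
        (ρ' : ClRep (∑ i, D i) V'), ρ'.IsSpinorModule →
        ∃ Φ : SmoothBundleIso (prodModel D) (τ.spinorBundle ρ') (bundleS σ ρ K),
          ∀ (x : ∀ i, M i) (i : Fin N) (X Y : TangentSpace (prodModel D) x),
            (∀ j, j ≠ i → tangentProj x j X = 0) → (∀ j, j ≠ i → tangentProj x j Y = 0) →
            ∀ ψ : (τ.spinorBundle ρ').Fiber x,
              inclS σ ρ K x (Φ.fiberEquiv x (τ.cliffordMul ρ' x X (τ.cliffordMul ρ' x Y ψ))) =
                cliffordMulW σ ρ A x X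
                  (cliffordMulW σ ρ A x Y (inclS σ ρ K x (Φ.fiberEquiv x ψ))) := by
  have h : IsProductMetric g gM A := ⟨hA, hgM⟩
  refine ⟨⟨prodSpinStructure σ h⟩, fun τ V' _ _ _ ρ' hρ' => ?_⟩
  obtain ⟨Ψ, hΨ⟩ := exists_fiberS_equiv ρ hK hρ hKcard ρ' hρ'
  exact exists_smoothBundleIso σ h τ hΨ
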